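/- Let $d\ge 1$, let $\Omega\subset\mathbb R^d$ be a bounded domain, $\alpha>0$ and $f,y_d\in L^2(\Omega)$. Let $\mathcal M$ be the set of matrices $A\in\mathbb R^{d\times d}$ with $\xi^TA\xi\ge\alpha|\xi|^2$ for all $\xi\in\mathbb R^d$, and let $\mathcal A$ be the set of $a\in L^\infty(\Omega;\mathbb R^{d\times d})$ with $a(x)\in\mathcal M$ for almost all $x\in\Omega$. For $a\in\mathcal A$ let $y_a\in H^1_0(\Omega)$ be the weak solution of $$\int_\Omega a\nabla y_a\cdot\nabla v\,dx=\int_\Omega f v\,dx\qquad\forall v\in H^1_0(\Omega),$$ and put $J(a)=\tfrac12\|y_a-y_d\|_{L^2(\Omega)}^2$. Fix $a\in\mathcal A$, let $y=y_a$, and let $p\in H_0^1(\Omega)$ be the adjoint state, i.e. the solution of $$\int_\Omega a\nabla v\cdot\nabla p\,dx=\int_\Omega (y-y_d)v\,dx\qquad\forall v\in H^1_0(\Omega).$$ Let $\omega=B(0,1)$ be the open unit ball, and let $b\in\mathbb R$ be such that $b I_d\in\mathcal M$ (that is, $b\ge\alpha$). For $x_0\in\Omega$ and $r>0$ put $a_r:=a+\chi_{x_0+r\omega}(bI_d-a)$.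 Then for almost every $x_0\in\Omega$ the following holds: if $a(x_0)$ is a multiple of the identity matrix, say $a(x_0)=s I_d$ with $s\in\mathbb R$, then the topological derivative $$\delta J(a;b,x_0,\omega)=\lim_{r\searrow0}\frac{J(a_r)-J(a)}{r^d|\omega|}$$ exists and $$\delta J(a;b,x_0,B(0,1))=-\nabla y(x_0)\cdot\nabla p(x_0)\;\frac{d\,s}{b+s(d-1)}\,(b-s).$$ -/

import Mathlib

open MeasureTheory Filter Topology

noncomputable section

namespace TopDeriv

/-- Euclidean space `ℝ^d`. -/
abbrev E (d : ℕ) : Type := EuclideanSpace ℝ (Fin d)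

/-- Real `d × d` matrices. -/
abbrev Mat (d : ℕ) : Type := Matrix (Fin d) (Fin d) ℝ

variable {d : ℕ}

/-- Lebesgue measure on the open set `Ω`. -/
def leb (Ω : TopologicalSpace.Opens (E d)) : Measure (E d) := volume.restrict (Ω : Set (E d))

/-- `G` is a weak gradient of `u` on `Ω`: integration by parts holds against `C_c^∞(Ω)`. -/
def IsWeakGradient (Ω : TopologicalSpace.Opens (E d)) (u : E d → ℝ) (G : E d → E d) : Prop :=
  ∀ φ : TestFunction Ω ℝ (⊤ : ℕ∞),
    ∫ x, u x • gradient φ x ∂(leb Ω) = - ∫ x, φ x • G x ∂(leb Ω)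

/-- `u ∈ H¹(Ω)` with weak gradient (represented by) `G`. -/
structure MemH1 (Ω : TopologicalSpace.Opens (E d)) (u : E d → ℝ) (G : E d → E d) : Prop where
  memLp : MemLp u 2 (leb Ω)
  memLp_grad : MemLp G 2 (leb Ω)
  weakGradient : IsWeakGradient Ω u G

/-- `u ∈ H¹₀(Ω)` with weak gradient `G`: `u` lies in the closure of `C_c^∞(Ω)` in `H¹(Ω)`. -/
structure MemH10 (Ω : TopologicalSpace.Opens (E d)) (u : E d → ℝ) (G : E d → E d) : Prop
    extends MemH1 Ω u G where
  approx : ∃ φ : ℕ → TestFunction Ω ℝ (⊤ : ℕ∞),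
    Tendsto (fun n => eLpNorm (fun x => φ n x - u x) 2 (leb Ω)) atTop (𝓝 0) ∧
    Tendsto (fun n => eLpNorm (fun x => gradient (φ n) x - G x) 2 (leb Ω)) atTop (𝓝 0)

/-- The set `M` of matrices `A` with `ξᵀ A ξ ≥ α |ξ|²` for all `ξ`. -/
def ellipticMatrices (d : ℕ) (α : ℝ) : Set (Mat d) :=
  {A | ∀ ξ : E d, α * ‖ξ‖ ^ 2 ≤ inner ℝ (Matrix.toEuclideanLin A ξ) ξ}

/-- The admissible coefficients: `a ∈ L^∞(Ω; ℝ^{d×d})` with values in `M` almost everywhere. -/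
structure IsAdmissible (Ω : TopologicalSpace.Opens (E d)) (α : ℝ) (a : E d → Mat d) : Prop where
  memLp : ∀ i j, MemLp (fun x => a x i j) ⊤ (leb Ω)
  elliptic : ∀ᵐ x ∂(leb Ω), a x ∈ ellipticMatrices d α

/-- `∫_Ω a G · H dx`. -/
def energyForm (Ω : TopologicalSpace.Opens (E d)) (a : E d → Mat d) (G H : E d → E d) : ℝ :=
  ∫ x, inner ℝ (Matrix.toEuclideanLin (a x) (G x)) (H x) ∂(leb Ω)

/-- `y ∈ H¹₀(Ω)`, with weak gradient `Gy`, solves the state equation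
`∫ a ∇y · ∇v = ∫ f v` for all `v ∈ H¹₀(Ω)`. -/
def IsState (Ω : TopologicalSpace.Opens (E d)) (f : E d → ℝ) (a : E d → Mat d)
    (y : E d → ℝ) (Gy : E d → E d) : Prop :=
  MemH10 Ω y Gy ∧ ∀ v Gv, MemH10 Ω v Gv → energyForm Ω a Gy Gv = ∫ x, f x * v x ∂(leb Ω)

/-- `p ∈ H¹₀(Ω)`, with weak gradient `Gp`, solves the adjoint equation
`∫ a ∇v · ∇p = ∫ (y - yd) v` for all `v ∈ H¹₀(Ω)`. -/
def IsAdjoint (Ω : TopologicalSpace.Opens (E d)) (yd : E d → ℝ) (a : E d → Mat d)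
    (y : E d → ℝ) (p : E d → ℝ) (Gp : E d → E d) : Prop :=
  MemH10 Ω p Gp ∧
    ∀ v Gv, MemH10 Ω v Gv → energyForm Ω a Gv Gp = ∫ x, (y x - yd x) * v x ∂(leb Ω)

/-- The solution of the state equation with coefficient `a`; for admissible `a` and square
integrable `f` on a bounded `Ω` it exists, and is unique up to null sets, by Lax-Milgram. -/
def state (Ω : TopologicalSpace.Opens (E d)) (f : E d → ℝ) (a : E d → Mat d) : E d → ℝ :=
  Classical.epsilon fun y => ∃ Gy, IsState Ω f a y Gy

/-- `J(a) = ½ ‖y_a - yd‖²_{L²(Ω)}`, with `y_a` the state belonging to `a`. -/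
def J (Ω : TopologicalSpace.Opens (E d)) (f yd : E d → ℝ) (a : E d → Mat d) : ℝ :=
  1 / 2 * ∫ x, (state Ω f a x - yd x) ^ 2 ∂(leb Ω)

/-- `a_r = a + χ_{x₀ + r ω} (b - a)`. -/
def perturb (a : E d → Mat d) (b : Mat d) (x₀ : E d) (ω : Set (E d)) (r : ℝ) : E d → Mat d :=
  fun x => a x + Set.indicator ((fun x' => x₀ + r • x') '' ω) (fun z => b - a z) x

/-- `δJ(a; b, x₀, ω) = L`, i.e. the limit of `(J(a_r) - J(a)) / (r^d |ω|)` as `r ↘ 0`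
exists and equals `L`. -/
def HasTopologicalDerivative (Ω : TopologicalSpace.Opens (E d)) (f yd : E d → ℝ)
    (a : E d → Mat d) (b : Mat d) (x₀ : E d) (ω : Set (E d)) (L : ℝ) : Prop :=
  Tendsto (fun r : ℝ => (J Ω f yd (perturb a b x₀ ω r) - J Ω f yd a) / (r ^ d * volume.real ω))
    (𝓝[>] 0) (𝓝 L)

end TopDeriv

end

open MeasureTheory Filter Topology

noncomputable section

namespace TopDeriv

variable {d : ℕ}

/-! Write `y_r` for the state of `a_r` and `g = y_r - y`. Expanding the square gives `J(a_r) - J(a)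
= ∫ (y - yd) g + ½ ‖g‖²`. Testing the adjoint equation with `g` and the two state equations with `p`
turns the linear term into `-∫_{B_r} (b - a)∇y·∇p - ∫_{B_r} (b - a)∇g·∇p`, where `B_r` is the ball
of radius `r` about `x₀`. After division by `r^d |ω|` there are three limits to find.

The integral with `∇y` is handled by Lebesgue differentiation and gives `-(b - s) ∇y·∇p`. The
quadratic term vanishes: coercivity gives `‖∇g‖ = O(r^{d/2})`, duality shows that `r^{-d/2} g` tends
weakly to zero in `L²`, and compactness makes this strong (`PerturbedFamily.tendsto_nrm_sub`). Both
the compactness and the Poincaré inequality come from one Fourier estimate,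
`MemH10.nrm_sq_le_fourier`: low frequencies are integrated over a ball, high ones are paid for by
the gradient.

The remaining integral needs the mean of `∇g` over `B_r`, of the same order as `∇y(x₀)`. No limit of
rescaled states is taken. Instead the equation of `g` is tested with a rescaled explicit corrector
`⟨x, e⟩ min(1, |x|^{-d})`. Its gradient is `e` in the unit ball, and for the coefficient `b` inside
and `s` outside its flux acts on test functions as `(b + s(d-1)) e` on the ball
(`integral_coeff_mul_inner_field₀`). Hence the mean of `∇g` tends to `-(b - s)∇y(x₀) / (b +
s(d-1))`, with errors controlled at Lebesgue points (`PerturbedFamily.tendsto_integral_inner`).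

Adding up, `1 - (b - s)/(b + s(d-1)) = sd/(b + s(d-1))`, which is the stated factor. -/

set_option linter.unusedSectionVars false

/-! ### The `L²` norm as a real number. -/

section L2

variable {X H : Type*} [MeasurableSpace X] {μ : Measure X}
  [NormedAddCommGroup H] [InnerProductSpace ℝ H]

theorem integrable_inner_of_memLp {f g : X → H} (hf : MemLp f 2 μ) (hg : MemLp g 2 μ) :
    Integrable (fun x => inner ℝ (f x) (g x)) μ := by
  refine (L2.integrable_inner (𝕜 := ℝ) (hf.toLp f) (hg.toLp g)).congr ?_
  filter_upwards [hf.coeFn_toLp, hg.coeFn_toLp] with x h1 h2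
  rw [h1, h2]

theorem integrable_norm_sq_of_memLp {f : X → H} (hf : MemLp f 2 μ) :
    Integrable (fun x => ‖f x‖ ^ 2) μ :=
  (memLp_two_iff_integrable_sq_norm hf.1).1 hf

/-- The `L²` norm as a real number. -/
def nrm (μ : Measure X) (f : X → H) : ℝ := √(∫ x, ‖f x‖ ^ 2 ∂μ)

theorem nrm_nonneg (f : X → H) : 0 ≤ nrm μ f := Real.sqrt_nonneg _

theorem nrm_sq (f : X → H) : nrm μ f ^ 2 = ∫ x, ‖f x‖ ^ 2 ∂μ :=
  Real.sq_sqrt (integral_nonneg fun _ => by positivity)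

theorem inner_toLp {f g : X → H} (hf : MemLp f 2 μ) (hg : MemLp g 2 μ) :
    inner ℝ (hf.toLp f) (hg.toLp g) = ∫ x, inner ℝ (f x) (g x) ∂μ := by
  rw [L2.inner_def]
  refine integral_congr_ae ?_
  filter_upwards [hf.coeFn_toLp, hg.coeFn_toLp] with x h1 h2
  rw [h1, h2]

theorem nrm_eq_norm_toLp {f : X → H} (hf : MemLp f 2 μ) : nrm μ f = ‖hf.toLp f‖ := by
  rw [nrm, ← Real.sqrt_sq (norm_nonneg (hf.toLp f)), ← real_inner_self_eq_norm_sq, inner_toLp]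
  simp

theorem ofReal_nrm {f : X → H} (hf : MemLp f 2 μ) : ENNReal.ofReal (nrm μ f) = eLpNorm f 2 μ := by
  rw [nrm_eq_norm_toLp hf, Lp.norm_toLp, ENNReal.ofReal_toReal hf.2.ne]

theorem abs_integral_inner_le {f g : X → H} (hf : MemLp f 2 μ) (hg : MemLp g 2 μ) :
    |∫ x, inner ℝ (f x) (g x) ∂μ| ≤ nrm μ f * nrm μ g := by
  rw [← inner_toLp hf hg, nrm_eq_norm_toLp hf, nrm_eq_norm_toLp hg]
  exact abs_real_inner_le_norm _ _

theorem nrm_add_le {f g : X → H} (hf : MemLp f 2 μ) (hg : MemLp g 2 μ) :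
    nrm μ (fun x => f x + g x) ≤ nrm μ f + nrm μ g := by
  have h : nrm μ (fun x => f x + g x) = ‖(hf.add hg).toLp (f + g)‖ := nrm_eq_norm_toLp (hf.add hg)
  rw [h, MemLp.toLp_add, nrm_eq_norm_toLp hf, nrm_eq_norm_toLp hg]
  exact norm_add_le _ _

theorem nrm_smul (c : ℝ) (f : X → H) : nrm μ (fun x => c • f x) = |c| * nrm μ f := by
  unfold nrm
  simp_rw [norm_smul, mul_pow, integral_const_mul]
  rw [Real.sqrt_mul (by positivity), Real.sqrt_sq (norm_nonneg _), Real.norm_eq_abs]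

/-- No measurability of `f` is needed: if its square is not integrable, the Bochner integral is zero
by convention and the bound is trivial. -/
theorem nrm_mono_of_ae_le {H' : Type*} [NormedAddCommGroup H'] [InnerProductSpace ℝ H']
    {f : X → H} {g : X → H'} (hg : MemLp g 2 μ) (h : ∀ᵐ x ∂μ, ‖f x‖ ≤ ‖g x‖) :
    nrm μ f ≤ nrm μ g := by
  refine Real.sqrt_le_sqrt ?_
  refine integral_mono_of_nonneg (ae_of_all _ fun _ => by positivity)
    (integrable_norm_sq_of_memLp hg) ?_
  filter_upwards [h] with x hx
  gcongr

theorem nrm_mono_measure {ν : Measure X} {f : X → H} (h : ν ≤ μ) (hf : MemLp f 2 μ) :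
    nrm ν f ≤ nrm μ f :=
  Real.sqrt_le_sqrt (integral_mono_measure h (ae_of_all _ fun _ => by positivity)
    (integrable_norm_sq_of_memLp hf))

theorem ae_eq_zero_of_nrm_eq_zero {f : X → H} (hf : MemLp f 2 μ) (h : nrm μ f = 0) :
    f =ᵐ[μ] 0 := by
  rw [nrm_eq_norm_toLp hf, norm_eq_zero] at h
  exact (MemLp.toLp_eq_toLp_iff hf MemLp.zero').1 h

theorem tendsto_nrm_of_tendsto_eLpNorm {ι : Type*} {l : Filter ι} {f : ι → X → H}
    (hf : ∀ i, MemLp (f i) 2 μ) (h : Tendsto (fun i => eLpNorm (f i) 2 μ) l (𝓝 0)) :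
    Tendsto (fun i => nrm μ (f i)) l (𝓝 0) := by
  have := (ENNReal.tendsto_toReal ENNReal.zero_ne_top).comp h
  refine this.congr fun i => ?_
  rw [Function.comp_apply, ← ofReal_nrm (hf i), ENNReal.toReal_ofReal (nrm_nonneg _)]

end L2

/-! ### Matrix fields acting on vector fields. -/

/-- The pointwise action of a matrix field on a vector field. -/
def act (a : E d → Mat d) (G : E d → E d) : E d → E d := fun x => Matrix.toEuclideanLin (a x) (G x)

theorem act_apply (a : E d → Mat d) (G : E d → E d) (x : E d) :
    act a G x = Matrix.toEuclideanLin (a x) (G x) := rfl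

theorem toEuclideanLin_coord (A : Mat d) (ξ : E d) (i : Fin d) :
    Matrix.toEuclideanLin A ξ i = ∑ j, A i j * ξ j := by
  simp [Matrix.toLpLin_apply, Matrix.mulVec, dotProduct]

theorem toEuclideanLin_scalar (s : ℝ) (ξ : E d) :
    Matrix.toEuclideanLin (s • (1 : Mat d)) ξ = s • ξ := by
  ext i
  rw [toEuclideanLin_coord]
  simp [Matrix.one_apply]

theorem inner_toEuclideanLin_transpose (A : Mat d) (ξ η : E d) :
    inner ℝ (Matrix.toEuclideanLin A ξ) η = inner ℝ ξ (Matrix.toEuclideanLin A.transpose η) := by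
  simp only [PiLp.inner_apply, toEuclideanLin_coord, RCLike.inner_apply, conj_trivial,
    Finset.mul_sum, Finset.sum_mul, Matrix.transpose_apply]
  rw [Finset.sum_comm]
  refine Finset.sum_congr rfl fun i _ => Finset.sum_congr rfl fun j _ => by ring

/-- Cauchy–Schwarz in each row. The Frobenius norm is used because it is polynomial in the entries
and invariant under transposition. -/
theorem norm_sq_toEuclideanLin_le (A : Mat d) (ξ : E d) :
    ‖Matrix.toEuclideanLin A ξ‖ ^ 2 ≤ (∑ i, ∑ j, A i j ^ 2) * ‖ξ‖ ^ 2 := by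
  rw [EuclideanSpace.norm_sq_eq, EuclideanSpace.norm_sq_eq, Finset.sum_mul]
  refine Finset.sum_le_sum fun i _ => ?_
  simp only [Real.norm_eq_abs, sq_abs]
  rw [toEuclideanLin_coord]
  exact Finset.sum_mul_sq_le_sq_mul_sq _ _ _

theorem aestronglyMeasurable_act {μ : Measure (E d)} {a : E d → Mat d} {G : E d → E d}
    (ha : ∀ i j, AEStronglyMeasurable (fun x => a x i j) μ) (hG : AEStronglyMeasurable G μ) :
    AEStronglyMeasurable (act a G) μ := by
  have h : AEMeasurable (fun x => (WithLp.ofLp (act a G x))) μ := by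
    refine aemeasurable_pi_lambda _ fun i => ?_
    have : (fun x => (act a G x) i) = fun x => ∑ j, a x i j * G x j := by
      ext x
      exact toEuclideanLin_coord _ _ _
    rw [this]
    refine Finset.aemeasurable_fun_sum _ fun j _ => ?_
    refine (ha i j).aemeasurable.mul ?_
    exact (by fun_prop : Measurable fun v : E d => v j).comp_aemeasurable hG.aemeasurable
  have h2 := (by fun_prop : Measurable (WithLp.toLp 2 : (Fin d → ℝ) → E d)).comp_aemeasurable h
  exact h2.aestronglyMeasurable

/-- A measurable, essentially bounded matrix field, together with a bound for its action. -/
structure IsBdd (μ : Measure (E d)) (a : E d → Mat d) (C : ℝ) : Prop where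
  nonneg : 0 ≤ C
  meas : ∀ i j, AEStronglyMeasurable (fun x => a x i j) μ
  bound : ∀ᵐ x ∂μ, ∑ i, ∑ j, a x i j ^ 2 ≤ C ^ 2

namespace IsBdd

variable {μ : Measure (E d)} {a : E d → Mat d} {C : ℝ}

theorem norm_act_le (h : IsBdd μ a C) (G : E d → E d) : ∀ᵐ x ∂μ, ‖act a G x‖ ≤ C * ‖G x‖ := by
  filter_upwards [h.bound] with x hx
  refine abs_le_of_sq_le_sq' ?_ (mul_nonneg h.nonneg (norm_nonneg _)) |>.2
  rw [mul_pow]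
  exact (norm_sq_toEuclideanLin_le _ _).trans (by gcongr)

theorem memLp_act (h : IsBdd μ a C) {G : E d → E d} (hG : MemLp G 2 μ) : MemLp (act a G) 2 μ :=
  hG.of_le_mul (aestronglyMeasurable_act h.meas hG.1) (h.norm_act_le G)

theorem nrm_act_le (h : IsBdd μ a C) {G : E d → E d} (hG : MemLp G 2 μ) :
    nrm μ (act a G) ≤ C * nrm μ G := by
  rw [← abs_of_nonneg h.nonneg, ← nrm_smul]
  refine nrm_mono_of_ae_le (hG.const_smul C) ?_
  filter_upwards [h.norm_act_le G] with x hx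
  rwa [norm_smul, Real.norm_of_nonneg h.nonneg]

theorem restrict (h : IsBdd μ a C) (s : Set (E d)) : IsBdd (μ.restrict s) a C :=
  ⟨h.nonneg, fun i j => (h.meas i j).restrict, ae_restrict_of_ae h.bound⟩

theorem transpose (h : IsBdd μ a C) : IsBdd μ (fun x => (a x).transpose) C := by
  refine ⟨h.nonneg, fun i j => h.meas j i, ?_⟩
  filter_upwards [h.bound] with x hx
  simp only [Matrix.transpose_apply]
  rwa [Finset.sum_comm]

theorem const_sub (h : IsBdd μ a C) (B : Mat d) : ∃ C', IsBdd μ (fun x => B - a x) C' := by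
  refine ⟨√((∑ i, ∑ j, 2 * B i j ^ 2) + 2 * C ^ 2), Real.sqrt_nonneg _,
    fun i j => aestronglyMeasurable_const.sub (h.meas i j), ?_⟩
  filter_upwards [h.bound] with x hx
  rw [Real.sq_sqrt (add_nonneg (Finset.sum_nonneg fun i _ => Finset.sum_nonneg fun j _ => by
    positivity) (by positivity))]
  have : ∑ i, ∑ j, (B - a x) i j ^ 2 ≤ ∑ i, ∑ j, (2 * B i j ^ 2 + 2 * a x i j ^ 2) := by
    refine Finset.sum_le_sum fun i _ => Finset.sum_le_sum fun j _ => ?_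
    rw [Matrix.sub_apply]
    nlinarith [sq_nonneg (B i j + a x i j)]
  refine this.trans ?_
  simp only [Finset.sum_add_distrib, ← Finset.mul_sum]
  gcongr

end IsBdd

theorem memLp_top_isBdd {μ : Measure (E d)} {a : E d → Mat d}
    (h : ∀ i j, MemLp (fun x => a x i j) ⊤ μ) : ∃ C, IsBdd μ a C := by
  have key : ∀ i j, ∃ c : ℝ, ∀ᵐ x ∂μ, a x i j ^ 2 ≤ c := fun i j => by
    refine ⟨(eLpNorm (fun x => a x i j) ⊤ μ).toReal ^ 2, ?_⟩
    filter_upwards [ae_le_eLpNormEssSup (f := fun x => a x i j) (μ := μ)] with x hx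
    rw [← eLpNorm_exponent_top] at hx
    have := ENNReal.toReal_mono (h i j).2.ne hx
    rw [toReal_enorm, Real.norm_eq_abs] at this
    exact sq_le_sq' (abs_le.1 this).1 (abs_le.1 this).2
  choose c hc using key
  refine ⟨√(∑ i, ∑ j, |c i j|), Real.sqrt_nonneg _, fun i j => (h i j).1, ?_⟩
  have hall : ∀ᵐ x ∂μ, ∀ i j, a x i j ^ 2 ≤ c i j := by
    simp only [ae_all_iff]
    exact hc
  filter_upwards [hall] with x hx
  rw [Real.sq_sqrt (Finset.sum_nonneg fun i _ => Finset.sum_nonneg fun j _ => abs_nonneg _)]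
  exact Finset.sum_le_sum fun i _ => Finset.sum_le_sum fun j _ => (hx i j).trans (le_abs_self _)

/-! ### Gradients of smooth functions. -/

section Gradient

theorem inner_gradient (φ : E d → ℝ) (x v : E d) :
    inner ℝ (gradient φ x) v = fderiv ℝ φ x v := by
  rw [gradient, InnerProductSpace.toDual_symm_apply]

theorem norm_gradient (φ : E d → ℝ) (x : E d) : ‖gradient φ x‖ = ‖fderiv ℝ φ x‖ := by
  rw [gradient, LinearIsometryEquiv.norm_map]

theorem continuous_gradient {φ : E d → ℝ} (h : ContDiff ℝ (⊤ : ℕ∞) φ) : Continuous (gradient φ) :=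
  (LinearIsometryEquiv.continuous _).comp (h.continuous_fderiv (by simp))

theorem hasCompactSupport_gradient {φ : E d → ℝ} (h : HasCompactSupport φ) :
    HasCompactSupport (gradient φ) :=
  (h.fderiv (𝕜 := ℝ)).comp_left (map_zero _)

theorem memLp_gradient {φ : E d → ℝ} (h : ContDiff ℝ (⊤ : ℕ∞) φ) (hc : HasCompactSupport φ)
    (p : ENNReal) (μ : Measure (E d)) [IsFiniteMeasureOnCompacts μ] : MemLp (gradient φ) p μ :=
  (continuous_gradient h).memLp_of_hasCompactSupport (hasCompactSupport_gradient hc)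

theorem gradient_add' {φ ψ : E d → ℝ} (h : Differentiable ℝ φ) (h' : Differentiable ℝ ψ) :
    gradient (fun x => φ x + ψ x) = fun x => gradient φ x + gradient ψ x := by
  ext1 x
  simp only [gradient, fderiv_fun_add (h x) (h' x), map_add]

theorem gradient_smul' {φ : E d → ℝ} (c : ℝ) (h : Differentiable ℝ φ) :
    gradient (fun x => c * φ x) = fun x => c • gradient φ x := by
  ext1 x
  simp only [gradient, fderiv_const_mul (h x), map_smul]

end Gradient

/-! ### The space `H¹₀(Ω)`, Lax–Milgram and uniqueness of the state. -/

section H10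

variable {Ω : TopologicalSpace.Opens (E d)}

instance : IsFiniteMeasureOnCompacts (leb Ω) := by
  unfold leb; infer_instance

theorem TestFunction.differentiable (φ : TestFunction Ω ℝ (⊤ : ℕ∞)) : Differentiable ℝ φ :=
  φ.contDiff.differentiable (by simp)

theorem TestFunction.memLp_two (φ : TestFunction Ω ℝ (⊤ : ℕ∞)) : MemLp φ 2 (leb Ω) :=
  φ.continuous.memLp_of_hasCompactSupport φ.hasCompactSupport

theorem TestFunction.memLp_gradient (φ : TestFunction Ω ℝ (⊤ : ℕ∞)) :
    MemLp (gradient φ) 2 (leb Ω) :=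
  TopDeriv.memLp_gradient φ.contDiff φ.hasCompactSupport 2 _

theorem setIntegral_leb_of_support {F : Type*} [NormedAddCommGroup F] [NormedSpace ℝ F]
    (f : E d → F) (h : ∀ x ∉ (Ω : Set (E d)), f x = 0) : ∫ x, f x ∂(leb Ω) = ∫ x, f x :=
  setIntegral_eq_integral_of_forall_compl_eq_zero h

theorem TestFunction.eq_zero (φ : TestFunction Ω ℝ (⊤ : ℕ∞)) {x : E d}
    (hx : x ∉ (Ω : Set (E d))) : φ x = 0 :=
  image_eq_zero_of_notMem_tsupport fun h => hx (φ.tsupport_subset h)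

theorem TestFunction.gradient_eq_zero (φ : TestFunction Ω ℝ (⊤ : ℕ∞)) {x : E d}
    (hx : x ∉ (Ω : Set (E d))) : gradient φ x = 0 := by
  have : fderiv ℝ φ x = 0 :=
    image_eq_zero_of_notMem_tsupport fun h => hx (φ.tsupport_subset (tsupport_fderiv_subset ℝ h))
  rw [gradient, this, map_zero]

theorem TestFunction.integral_mul_gradient (φ ψ : TestFunction Ω ℝ (⊤ : ℕ∞)) (v : E d) :
    ∫ x, φ x * inner ℝ (gradient ψ x) v ∂(leb Ω) =
      - ∫ x, ψ x * inner ℝ (gradient φ x) v ∂(leb Ω) := by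
  rw [setIntegral_leb_of_support _ fun x hx => by rw [TestFunction.eq_zero φ hx, zero_mul],
    setIntegral_leb_of_support _ fun x hx => by rw [TestFunction.eq_zero ψ hx, zero_mul]]
  simp_rw [inner_gradient]
  have hc (χ : TestFunction Ω ℝ (⊤ : ℕ∞)) : Continuous fun x => fderiv ℝ χ x v :=
    (χ.contDiff.continuous_fderiv (by simp)).clm_apply continuous_const
  have := integral_mul_fderiv_eq_neg_fderiv_mul_of_integrable (μ := volume)
    (f := φ) (g := ψ) (v := v)
    (((hc φ).mul ψ.continuous).integrable_of_hasCompactSupport ψ.hasCompactSupport.mul_left)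
    ((φ.continuous.mul (hc ψ)).integrable_of_hasCompactSupport φ.hasCompactSupport.mul_right)
    ((φ.continuous.mul ψ.continuous).integrable_of_hasCompactSupport φ.hasCompactSupport.mul_right)
    (fun x _ => TestFunction.differentiable φ x) (fun x _ => TestFunction.differentiable ψ x)
  rw [this]
  simp_rw [mul_comm]

theorem integral_mul_inner_tendsto {u : E d → ℝ} {H : E d → ℝ} {un : ℕ → E d → ℝ}
    {μ : Measure (E d)} (hu : MemLp u 2 μ) (hun : ∀ n, MemLp (un n) 2 μ) (hH : MemLp H 2 μ)
    (h : Tendsto (fun n => nrm μ (fun x => un n x - u x)) atTop (𝓝 0)) :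
    Tendsto (fun n => ∫ x, un n x * H x ∂μ) atTop (𝓝 (∫ x, u x * H x ∂μ)) := by
  rw [tendsto_iff_norm_sub_tendsto_zero]
  have h2 := h.mul_const (nrm μ H)
  rw [zero_mul] at h2
  refine squeeze_zero (fun _ => norm_nonneg _) (fun n => ?_) h2
  have hi1 : Integrable (fun x => un n x * H x) μ := (hun n).integrable_mul hH
  have hi2 : Integrable (fun x => u x * H x) μ := hu.integrable_mul hH
  rw [← integral_sub hi1 hi2]
  have := abs_integral_inner_le ((hun n).sub hu) hH
  simp only [Pi.sub_apply, RCLike.inner_apply, conj_trivial] at this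
  refine le_trans (le_of_eq ?_) this
  rw [Real.norm_eq_abs]
  congr 2
  ext x
  ring

theorem nrm_inner_const_le {μ : Measure (E d)} {G : E d → E d} (hG : MemLp G 2 μ) (v : E d) :
    nrm μ (fun x => inner ℝ (G x) v) ≤ ‖v‖ * nrm μ G := by
  rw [← abs_of_nonneg (norm_nonneg v), ← nrm_smul]
  refine nrm_mono_of_ae_le (hG.const_smul ‖v‖) (ae_of_all _ fun x => ?_)
  rw [norm_smul, norm_norm, mul_comm]
  exact norm_inner_le_norm _ _

/-- A limit of test functions in the `H¹` norm lies in `H¹₀`. -/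
theorem MemH10.of_tendsto {u : E d → ℝ} {G : E d → E d} (hu : MemLp u 2 (leb Ω))
    (hG : MemLp G 2 (leb Ω)) (φ : ℕ → TestFunction Ω ℝ (⊤ : ℕ∞))
    (h1 : Tendsto (fun n => nrm (leb Ω) (fun x => φ n x - u x)) atTop (𝓝 0))
    (h2 : Tendsto (fun n => nrm (leb Ω) (fun x => gradient (φ n) x - G x)) atTop (𝓝 0)) :
    MemH10 Ω u G := by
  refine ⟨⟨hu, hG, fun ψ => ?_⟩, φ, ?_, ?_⟩
  -- Paired with a fixed vector `v`, both sides of the weak gradient identity are continuous in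
  -- `L²`, so integration by parts for test functions passes to the limit.
  · refine ext_inner_left ℝ fun v => ?_
    rw [inner_neg_right, ← integral_inner, ← integral_inner]
    · simp_rw [inner_smul_right]
      have hψ : MemLp (fun x => inner ℝ v (gradient ψ x)) 2 (leb Ω) :=
        (TestFunction.memLp_gradient ψ).const_inner v
      have l1 := integral_mul_inner_tendsto hu (fun n => TestFunction.memLp_two (φ n)) hψ h1
      have l2 := integral_mul_inner_tendsto (u := fun x => inner ℝ (G x) v)
        (un := fun n x => inner ℝ (gradient (φ n) x) v)
        (by simpa only [real_inner_comm] using hG.const_inner v)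
        (fun n => by
          simpa only [real_inner_comm] using (TestFunction.memLp_gradient (φ n)).const_inner v)
        (TestFunction.memLp_two ψ) (by
          have h3 := h2.const_mul ‖v‖
          rw [mul_zero] at h3
          refine squeeze_zero (fun _ => nrm_nonneg _) (fun n => ?_) h3
          simp_rw [← inner_sub_left]
          exact nrm_inner_const_le ((TestFunction.memLp_gradient (φ n)).sub hG) v)
      refine tendsto_nhds_unique l1 ?_
      have l3 := l2.neg
      have e1 : ∫ x, ψ x * inner ℝ v (G x) ∂(leb Ω) = ∫ x, inner ℝ (G x) v * ψ x ∂(leb Ω) :=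
        integral_congr_ae (ae_of_all _ fun x => by dsimp only; rw [mul_comm, real_inner_comm])
      rw [e1]
      refine l3.congr fun n => ?_
      have := TestFunction.integral_mul_gradient (φ n) ψ v
      simp_rw [real_inner_comm v]
      simp_rw [real_inner_comm v] at this
      rw [this]
      simp_rw [mul_comm]
    · exact memLp_one_iff_integrable.1 (hG.smul (TestFunction.memLp_two ψ))
    · exact memLp_one_iff_integrable.1 ((TestFunction.memLp_gradient ψ).smul hu)
  · have h3 := ENNReal.tendsto_ofReal h1
    rw [ENNReal.ofReal_zero] at h3
    exact h3.congr fun n => ofReal_nrm ((TestFunction.memLp_two (φ n)).sub hu)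
  · have h3 := ENNReal.tendsto_ofReal h2
    rw [ENNReal.ofReal_zero] at h3
    exact h3.congr fun n => ofReal_nrm ((TestFunction.memLp_gradient (φ n)).sub hG)

theorem MemH10.exists_tendsto {u : E d → ℝ} {G : E d → E d} (h : MemH10 Ω u G) :
    ∃ φ : ℕ → TestFunction Ω ℝ (⊤ : ℕ∞),
      Tendsto (fun n => nrm (leb Ω) (fun x => φ n x - u x)) atTop (𝓝 0) ∧
      Tendsto (fun n => nrm (leb Ω) (fun x => gradient (φ n) x - G x)) atTop (𝓝 0) := by
  obtain ⟨φ, h1, h2⟩ := h.approx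
  exact ⟨φ, tendsto_nrm_of_tendsto_eLpNorm (fun n => (TestFunction.memLp_two (φ n)).sub h.memLp) h1,
    tendsto_nrm_of_tendsto_eLpNorm
      (fun n => (TestFunction.memLp_gradient (φ n)).sub h.memLp_grad) h2⟩

theorem TestFunction.memH10 (φ : TestFunction Ω ℝ (⊤ : ℕ∞)) : MemH10 Ω φ (gradient φ) :=
  MemH10.of_tendsto (TestFunction.memLp_two φ) (TestFunction.memLp_gradient φ) (fun _ => φ)
    (by simp [nrm]) (by simp [nrm])

variable (Ω) in
/-- The ambient Hilbert space of pairs (function, gradient). -/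
abbrev PairSpace : Type := WithLp 2 (Lp ℝ 2 (leb Ω) × Lp (E d) 2 (leb Ω))

/-- The pair of classes of a function and a vector field. -/
def mkPair {u : E d → ℝ} {G : E d → E d} (hu : MemLp u 2 (leb Ω)) (hG : MemLp G 2 (leb Ω)) :
    PairSpace Ω := WithLp.toLp 2 (hu.toLp u, hG.toLp G)

theorem norm_mkPair_sq {u : E d → ℝ} {G : E d → E d} (hu : MemLp u 2 (leb Ω))
    (hG : MemLp G 2 (leb Ω)) :
    ‖mkPair hu hG‖ ^ 2 = nrm (leb Ω) u ^ 2 + nrm (leb Ω) G ^ 2 := by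
  rw [WithLp.prod_norm_sq_eq_of_L2, nrm_eq_norm_toLp hu, nrm_eq_norm_toLp hG]
  rfl

variable (Ω) in
/-- The subspace of pairs `(φ, ∇φ)` with `φ` a test function. -/
def testPairs : Submodule ℝ (PairSpace Ω) where
  carrier := {U | ∃ φ : TestFunction Ω ℝ (⊤ : ℕ∞),
    U = mkPair (TestFunction.memLp_two φ) (TestFunction.memLp_gradient φ)}
  zero_mem' := ⟨0, by
    rw [eq_comm, ← norm_eq_zero, ← sq_eq_zero_iff, norm_mkPair_sq]
    have : gradient (0 : TestFunction Ω ℝ (⊤ : ℕ∞)) = 0 := by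
      ext1 x
      have : (⇑(0 : TestFunction Ω ℝ (⊤ : ℕ∞)) : E d → ℝ) = fun _ => 0 := by ext; simp
      rw [this]
      simp [gradient]
    rw [this]
    simp [nrm]⟩
  add_mem' := by
    rintro _ _ ⟨φ, rfl⟩ ⟨ψ, rfl⟩
    refine ⟨φ + ψ, ?_⟩
    have h1 : ⇑(φ + ψ) = fun x => φ x + ψ x := by ext; simp
    have h2 := gradient_add' (TestFunction.differentiable φ) (TestFunction.differentiable ψ)
    rw [← h1] at h2
    simp only [mkPair, ← WithLp.toLp_add, Prod.mk_add_mk, ← MemLp.toLp_add]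
    congr 2
    simp only [h2]
    rfl
  smul_mem' := by
    rintro c _ ⟨φ, rfl⟩
    refine ⟨c • φ, ?_⟩
    have h1 : ⇑(c • φ) = fun x => c * φ x := by ext; simp
    have h2 := gradient_smul' c (TestFunction.differentiable φ)
    rw [← h1] at h2
    simp only [mkPair, ← WithLp.toLp_smul, Prod.smul_mk, ← MemLp.toLp_const_smul]
    congr 2
    simp only [h2]
    rfl

variable (Ω) in
/-- `H¹₀(Ω)` as a closed subspace of the space of pairs. -/
def h10 : Submodule ℝ (PairSpace Ω) := (testPairs Ω).topologicalClosure

instance : CompleteSpace (h10 Ω) :=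
  (Submodule.isClosed_topologicalClosure _).completeSpace_coe

theorem mkPair_sub {u v : E d → ℝ} {G H : E d → E d} (hu : MemLp u 2 (leb Ω))
    (hG : MemLp G 2 (leb Ω)) (hv : MemLp v 2 (leb Ω)) (hH : MemLp H 2 (leb Ω)) :
    mkPair hu hG - mkPair hv hH = mkPair (hu.sub hv) (hG.sub hH) := rfl

theorem mkPair_self (U : PairSpace Ω) : mkPair (Lp.memLp U.fst) (Lp.memLp U.snd) = U := by
  simp only [mkPair, Lp.toLp_coeFn]
  rfl

/-- The squared norm in the pair space is the sum of the two squared `L²` norms, so convergence of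
pairs is convergence of both components. This translates `MemH10` into membership in a closed
subspace, from which linearity and completeness are inherited. -/
theorem mkPair_mem_h10 {u : E d → ℝ} {G : E d → E d} (hu : MemLp u 2 (leb Ω))
    (hG : MemLp G 2 (leb Ω)) : mkPair hu hG ∈ h10 Ω ↔ MemH10 Ω u G := by
  constructor
  · intro h
    obtain ⟨U, hU, hlim⟩ := mem_closure_iff_seq_limit.1
      (show mkPair hu hG ∈ closure (testPairs Ω : Set (PairSpace Ω)) from h)
    choose φ hφ using hU
    rw [tendsto_iff_norm_sub_tendsto_zero] at hlim
    have key : ∀ n, ‖U n - mkPair hu hG‖ ^ 2 = nrm (leb Ω) (fun x => φ n x - u x) ^ 2 +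
        nrm (leb Ω) (fun x => gradient (φ n) x - G x) ^ 2 := fun n => by
      rw [hφ n, mkPair_sub, norm_mkPair_sq]
      rfl
    refine MemH10.of_tendsto hu hG φ ?_ ?_
    · refine squeeze_zero (fun _ => nrm_nonneg _) (fun n => ?_) hlim
      refine abs_le_of_sq_le_sq' ?_ (norm_nonneg _) |>.2
      rw [key]
      exact le_add_of_nonneg_right (sq_nonneg _)
    · refine squeeze_zero (fun _ => nrm_nonneg _) (fun n => ?_) hlim
      refine abs_le_of_sq_le_sq' ?_ (norm_nonneg _) |>.2
      rw [key]
      exact le_add_of_nonneg_left (sq_nonneg _)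
  · intro h
    obtain ⟨φ, h1, h2⟩ := h.exists_tendsto
    refine mem_closure_of_tendsto (b := atTop) (f := fun n =>
      mkPair (TestFunction.memLp_two (φ n)) (TestFunction.memLp_gradient (φ n))) ?_
      (Eventually.of_forall fun n => ⟨φ n, rfl⟩)
    rw [tendsto_iff_norm_sub_tendsto_zero]
    have h3 := ((h1.pow 2).add (h2.pow 2)).sqrt
    simp only [ne_eq, OfNat.ofNat_ne_zero, not_false_eq_true, zero_pow, add_zero,
      Real.sqrt_zero] at h3
    refine h3.congr fun n => ?_
    rw [mkPair_sub, ← Real.sqrt_sq (norm_nonneg (mkPair _ _)), norm_mkPair_sq]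
    rfl

theorem MemH10.sub {u v : E d → ℝ} {G H : E d → E d} (h : MemH10 Ω u G) (h' : MemH10 Ω v H) :
    MemH10 Ω (fun x => u x - v x) (fun x => G x - H x) :=
  (mkPair_mem_h10 (h.memLp.sub h'.memLp) (h.memLp_grad.sub h'.memLp_grad)).1 <| by
    rw [← mkPair_sub h.memLp h.memLp_grad h'.memLp h'.memLp_grad]
    exact (h10 Ω).sub_mem ((mkPair_mem_h10 _ _).2 h) ((mkPair_mem_h10 _ _).2 h')

theorem MemH10.const_smul {u : E d → ℝ} {G : E d → E d} (h : MemH10 Ω u G) (c : ℝ) :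
    MemH10 Ω (fun x => c * u x) (fun x => c • G x) :=
  (mkPair_mem_h10 (h.memLp.const_mul c) (h.memLp_grad.const_smul c)).1 <|
    (h10 Ω).smul_mem c ((mkPair_mem_h10 h.memLp h.memLp_grad).2 h)

variable (Ω) in
/-- `K` is a constant in the Poincaré inequality on `H¹₀(Ω)`. -/
def PoincareConst (K : ℝ) : Prop :=
  0 ≤ K ∧ ∀ u G, MemH10 Ω u G → nrm (leb Ω) u ≤ K * nrm (leb Ω) G

theorem IsAdmissible.exists_isBdd {α : ℝ} {a : E d → Mat d} (h : IsAdmissible Ω α a) :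
    ∃ C, IsBdd (leb Ω) a C := memLp_top_isBdd h.memLp

/-- The quadratic form does not see transposition. Adjoint problems thereby become state problems
for the transposed coefficient, and existence for them is free. -/
theorem IsAdmissible.transpose {α : ℝ} {a : E d → Mat d} (h : IsAdmissible Ω α a) :
    IsAdmissible Ω α (fun x => (a x).transpose) := by
  refine ⟨fun i j => h.memLp j i, ?_⟩
  filter_upwards [h.elliptic] with x hx ξ
  rw [real_inner_comm, ← inner_toEuclideanLin_transpose]
  exact hx ξ

theorem energyForm_transpose (a : E d → Mat d) (G H : E d → E d) :
    energyForm Ω (fun x => (a x).transpose) G H = energyForm Ω a H G := by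
  refine integral_congr_ae (ae_of_all _ fun x => ?_)
  dsimp only
  rw [real_inner_comm, ← inner_toEuclideanLin_transpose]

theorem IsAdmissible.coercive {α : ℝ} {a : E d → Mat d} (h : IsAdmissible Ω α a) {G : E d → E d}
    (hG : MemLp G 2 (leb Ω)) : α * nrm (leb Ω) G ^ 2 ≤ energyForm Ω a G G := by
  obtain ⟨C, hC⟩ := h.exists_isBdd
  rw [nrm_sq, ← integral_const_mul]
  refine integral_mono_ae ((integrable_norm_sq_of_memLp hG).const_mul α)
    (integrable_inner_of_memLp (hC.memLp_act hG) hG) ?_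
  filter_upwards [h.elliptic] with x hx
  exact hx (G x)

/-- The action of a bounded matrix field as a bounded operator on `L²`. -/
def actCLM {a : E d → Mat d} {C : ℝ} (h : IsBdd (leb Ω) a C) :
    Lp (E d) 2 (leb Ω) →L[ℝ] Lp (E d) 2 (leb Ω) :=
  LinearMap.mkContinuous
    { toFun := fun G => (h.memLp_act (Lp.memLp G)).toLp _
      map_add' := fun G H => by
        rw [← MemLp.toLp_add, MemLp.toLp_eq_toLp_iff]
        filter_upwards [Lp.coeFn_add G H] with x hx
        simp only [act_apply, hx, Pi.add_apply, map_add]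
      map_smul' := fun c G => by
        rw [RingHom.id_apply, ← MemLp.toLp_const_smul, MemLp.toLp_eq_toLp_iff]
        filter_upwards [Lp.coeFn_smul c G] with x hx
        simp only [act_apply, hx, Pi.smul_apply, map_smul] }
    C fun G => by
      rw [LinearMap.coe_mk, AddHom.coe_mk, ← nrm_eq_norm_toLp]
      refine (h.nrm_act_le (Lp.memLp G)).trans_eq ?_
      rw [nrm_eq_norm_toLp (Lp.memLp G), Lp.toLp_coeFn]

theorem inner_actCLM {a : E d → Mat d} {C : ℝ} (h : IsBdd (leb Ω) a C)
    (G H : Lp (E d) 2 (leb Ω)) : inner ℝ (actCLM h G) H = energyForm Ω a G H := by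
  have : inner ℝ (actCLM h G) ((Lp.memLp H).toLp H) = energyForm Ω a G H :=
    inner_toLp (h.memLp_act (Lp.memLp G)) (Lp.memLp H)
  rwa [Lp.toLp_coeFn] at this

/-- Lax–Milgram: existence of the state. -/
theorem IsAdmissible.exists_isState {α K : ℝ} (hα : 0 < α) (hK : PoincareConst Ω K)
    {a : E d → Mat d} (h : IsAdmissible Ω α a) {g : E d → ℝ} (hg : MemLp g 2 (leb Ω)) :
    ∃ y Gy, IsState Ω g a y Gy := by
  obtain ⟨C, hC⟩ := h.exists_isBdd
  have hmem (U : h10 Ω) : MemH10 Ω (U : PairSpace Ω).fst (U : PairSpace Ω).snd :=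
    (mkPair_mem_h10 (Lp.memLp _) (Lp.memLp _)).1 (by rw [mkPair_self]; exact U.2)
  let P : h10 Ω →L[ℝ] Lp (E d) 2 (leb Ω) := (WithLp.sndL 2 ℝ _ _).comp (h10 Ω).subtypeL
  let Q : h10 Ω →L[ℝ] Lp ℝ 2 (leb Ω) := (WithLp.fstL 2 ℝ _ _).comp (h10 Ω).subtypeL
  let B : h10 Ω →L[ℝ] h10 Ω →L[ℝ] ℝ := (innerSL ℝ).bilinearComp ((actCLM hC).comp P) P
  have hB (U V : h10 Ω) :
      B U V = energyForm Ω a (U : PairSpace Ω).snd (V : PairSpace Ω).snd := inner_actCLM hC _ _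
  have hco : IsCoercive B := by
    -- By Poincaré the full norm satisfies `‖U‖² = ‖u‖² + ‖∇u‖² ≤ (K² + 1) ‖∇u‖²`.
    refine ⟨α / (K ^ 2 + 1), by positivity, fun U => ?_⟩
    rw [hB]
    refine le_trans ?_ (h.coercive (Lp.memLp _))
    rw [mul_assoc, ← sq, div_mul_eq_mul_div, div_le_iff₀ (by positivity), mul_assoc]
    refine mul_le_mul_of_nonneg_left ?_ hα.le
    have h1 : ‖U‖ ^ 2 = nrm (leb Ω) (U : PairSpace Ω).fst ^ 2
        + nrm (leb Ω) (U : PairSpace Ω).snd ^ 2 := by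
      rw [← norm_mkPair_sq (Lp.memLp _) (Lp.memLp _), mkPair_self]
      rfl
    have h2 := pow_le_pow_left₀ (nrm_nonneg _) (hK.2 _ _ (hmem U)) 2
    rw [mul_pow] at h2
    rw [h1]
    linarith
  let ℓ : h10 Ω →L[ℝ] ℝ := (innerSL ℝ (hg.toLp g)).comp Q
  let U := hco.continuousLinearEquivOfBilin.symm ((InnerProductSpace.toDual ℝ _).symm ℓ)
  refine ⟨(U : PairSpace Ω).fst, (U : PairSpace Ω).snd, hmem U, fun v Gv hv => ?_⟩
  let V : h10 Ω := ⟨mkPair hv.memLp hv.memLp_grad, (mkPair_mem_h10 _ _).2 hv⟩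
  have h1 : B U V = ℓ V := by
    rw [← hco.continuousLinearEquivOfBilin_apply, ContinuousLinearEquiv.apply_symm_apply,
      InnerProductSpace.toDual_symm_apply]
  have h2 : B U V = energyForm Ω a (U : PairSpace Ω).snd Gv := by
    rw [hB]
    refine integral_congr_ae ?_
    filter_upwards [hv.memLp_grad.coeFn_toLp] with x hx
    have : (V : PairSpace Ω).snd x = Gv x := hx
    rw [this]
  have h3 : ℓ V = ∫ x, g x * v x ∂(leb Ω) := by
    have : ℓ V = inner ℝ (hg.toLp g) (hv.memLp.toLp v) := rfl
    rw [this, inner_toLp]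
    simp [mul_comm]
  rw [← h2, h1, h3]

theorem energyForm_sub_left {a : E d → Mat d} {C : ℝ} (h : IsBdd (leb Ω) a C)
    {G G' H : E d → E d} (hG : MemLp G 2 (leb Ω)) (hG' : MemLp G' 2 (leb Ω))
    (hH : MemLp H 2 (leb Ω)) :
    energyForm Ω a (fun x => G x - G' x) H = energyForm Ω a G H - energyForm Ω a G' H := by
  have := integral_sub (integrable_inner_of_memLp (h.memLp_act hG) hH)
    (integrable_inner_of_memLp (h.memLp_act hG') hH)
  refine Eq.trans (integral_congr_ae (ae_of_all _ fun x => ?_)) this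
  simp only [act_apply, map_sub, inner_sub_left]

/-- Uniqueness of the state. -/
theorem IsState.ae_eq {α K : ℝ} (hα : 0 < α) (hK : PoincareConst Ω K)
    {a : E d → Mat d} (h : IsAdmissible Ω α a) {g y y' : E d → ℝ} {Gy Gy' : E d → E d}
    (hy : IsState Ω g a y Gy) (hy' : IsState Ω g a y' Gy') : y =ᵐ[leb Ω] y' := by
  obtain ⟨C, hC⟩ := h.exists_isBdd
  have hs := hy.1.sub hy'.1
  have h1 := h.coercive hs.memLp_grad
  rw [energyForm_sub_left hC hy.1.memLp_grad hy'.1.memLp_grad hs.memLp_grad, hy.2 _ _ hs,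
    hy'.2 _ _ hs, sub_self] at h1
  -- The equation of the difference, tested with itself, has right side zero; coercivity kills the
  -- gradient and Poincaré then the function.
  have h2 : nrm (leb Ω) (fun x => Gy x - Gy' x) = 0 := by
    have h3 : nrm (leb Ω) (fun x => Gy x - Gy' x) ^ 2 ≤ 0 := by
      by_contra! hc
      nlinarith
    nlinarith [nrm_nonneg (μ := leb Ω) (fun x => Gy x - Gy' x)]
  have h3 := hK.2 _ _ hs
  rw [h2, mul_zero] at h3
  filter_upwards [ae_eq_zero_of_nrm_eq_zero hs.memLp (le_antisymm h3 (nrm_nonneg _))] with x hx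
  exact sub_eq_zero.1 hx

end H10
-- Poincaré inequality and compactness by Fourier analysis.
section Fourier

open FourierTransform LineDeriv SchwartzMap

/-- Plancherel for `φ` and for each partial derivative, summed over the coordinates; `φ` is
complexified and viewed as a Schwartz function. -/
theorem integral_norm_sq_mul_fourier {φ : E d → ℝ} (h : ContDiff ℝ (⊤ : ℕ∞) φ)
    (hc : HasCompactSupport φ) :
    Integrable (fun ξ : E d => (2 * Real.pi) ^ 2 * ‖ξ‖ ^ 2 * ‖𝓕 (fun x => (φ x : ℂ)) ξ‖ ^ 2) ∧
    ∫ ξ : E d, (2 * Real.pi) ^ 2 * ‖ξ‖ ^ 2 * ‖𝓕 (fun x => (φ x : ℂ)) ξ‖ ^ 2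
      = nrm volume (gradient φ) ^ 2 ∧
    Integrable (fun ξ : E d => ‖𝓕 (fun x => (φ x : ℂ)) ξ‖ ^ 2) ∧
    ∫ ξ : E d, ‖𝓕 (fun x => (φ x : ℂ)) ξ‖ ^ 2 = nrm volume φ ^ 2 := by
  have hcC : HasCompactSupport fun x => (φ x : ℂ) := hc.comp_left (g := ((↑) : ℝ → ℂ)) rfl
  have hC : ContDiff ℝ (⊤ : ℕ∞) fun x => (φ x : ℂ) := Complex.ofRealCLM.contDiff.comp h
  let S : 𝓢(E d, ℂ) := hcC.toSchwartzMap hC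
  have hS : ∀ x, S x = φ x := fun x => rfl
  have hFS : 𝓕 (fun x => (φ x : ℂ)) = 𝓕 S := rfl
  have hint (T : 𝓢(E d, ℂ)) : Integrable fun x => ‖T x‖ ^ 2 :=
    integrable_norm_sq_of_memLp (T.memLp 2 volume)
  let e (i : Fin d) : E d := EuclideanSpace.single i 1
  have hD (i : Fin d) (x : E d) : ‖(∂_{e i} S) x‖ ^ 2 = (gradient φ x i) ^ 2 := by
    have h1 : (∂_{e i} S) x = fderiv ℝ (fun x => (φ x : ℂ)) x (e i) := rfl
    have h2 : HasFDerivAt (fun x => (φ x : ℂ)) (Complex.ofRealCLM.comp (fderiv ℝ φ x)) x :=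
      Complex.ofRealCLM.hasFDerivAt.comp x ((h.differentiable (by simp)) x).hasFDerivAt
    rw [h1, h2.fderiv, ContinuousLinearMap.comp_apply, ← inner_gradient,
      EuclideanSpace.inner_single_right]
    simp
  have hF (i : Fin d) (ξ : E d) : ‖𝓕 (∂_{e i} S) ξ‖ ^ 2 =
      (2 * Real.pi) ^ 2 * ξ i ^ 2 * ‖𝓕 S ξ‖ ^ 2 := by
    rw [SchwartzMap.fourier_lineDerivOp_eq]
    have : (inner ℝ · (e i)).HasTemperateGrowth := ((innerSL ℝ).flip (e i)).hasTemperateGrowth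
    simp only [smul_apply, SchwartzMap.smulLeftCLM_apply_apply this, norm_smul,
      mul_pow]
    simp [e, EuclideanSpace.inner_single_right, mul_pow]
    ring
  have hsum (ξ : E d) : (2 * Real.pi) ^ 2 * ‖ξ‖ ^ 2 * ‖𝓕 S ξ‖ ^ 2 =
      ∑ i, ‖𝓕 (∂_{e i} S) ξ‖ ^ 2 := by
    simp only [hF, EuclideanSpace.norm_sq_eq, ← Finset.sum_mul, ← Finset.mul_sum,
      Real.norm_eq_abs, sq_abs]
  rw [hFS]
  refine ⟨?_, ?_, hint _, ?_⟩
  · simp_rw [hsum]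
    exact integrable_finsetSum _ fun i _ => hint _
  · simp_rw [hsum]
    rw [integral_finsetSum _ fun i _ => hint _, nrm_sq]
    simp_rw [SchwartzMap.integral_norm_sq_fourier]
    rw [← integral_finsetSum _ fun i _ => hint _]
    simp_rw [hD, EuclideanSpace.norm_sq_eq, Real.norm_eq_abs, sq_abs]
  · rw [SchwartzMap.integral_norm_sq_fourier, nrm_sq]
    simp [hS]

variable (Ω : TopologicalSpace.Opens (E d))

/-- The Fourier transform of a function restricted to `Ω`. -/
def ft (u : E d → ℝ) : E d → ℂ :=
  VectorFourier.fourierIntegral Real.fourierChar (leb Ω) (innerₗ (E d)) fun x => (u x : ℂ)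

variable {Ω}

theorem isFiniteMeasure_leb (hΩ : Bornology.IsBounded (Ω : Set (E d))) :
    IsFiniteMeasure (leb Ω) := by
  unfold leb
  exact ⟨by simpa using hΩ.measure_lt_top⟩

theorem norm_ft_le [IsFiniteMeasure (leb Ω)] {u : E d → ℝ} (hu : MemLp u 2 (leb Ω)) (ξ : E d) :
    ‖ft Ω u ξ‖ ≤ √((leb Ω).real Set.univ) * nrm (leb Ω) u := by
  refine (VectorFourier.norm_fourierIntegral_le_integral_norm _ _ _ _ _).trans ?_
  have h1 := abs_integral_inner_le (memLp_const (1 : ℝ)) hu.norm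
  have h2 : nrm (leb Ω) (fun _ => (1 : ℝ)) = √((leb Ω).real Set.univ) := by simp [nrm]
  have h3 : nrm (leb Ω) (fun x => ‖u x‖) = nrm (leb Ω) u := by simp [nrm]
  rw [h2, h3] at h1
  refine le_trans (le_of_eq ?_) ((le_abs_self _).trans h1)
  simp

theorem integrable_of_memLp_two [IsFiniteMeasure (leb Ω)] {u : E d → ℝ}
    (hu : MemLp u 2 (leb Ω)) : Integrable (fun x => (u x : ℂ)) (leb Ω) :=
  (hu.integrable (by norm_num)).ofReal

theorem continuous_ft [IsFiniteMeasure (leb Ω)] {u : E d → ℝ} (hu : MemLp u 2 (leb Ω)) :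
    Continuous (ft Ω u) :=
  VectorFourier.fourierIntegral_continuous Real.continuous_fourierChar
    (by simpa only [innerₗ_apply_apply] using continuous_inner) (integrable_of_memLp_two hu)

theorem ft_sub [IsFiniteMeasure (leb Ω)] {u v : E d → ℝ} (hu : MemLp u 2 (leb Ω))
    (hv : MemLp v 2 (leb Ω)) (ξ : E d) :
    ft Ω (fun x => u x - v x) ξ = ft Ω u ξ - ft Ω v ξ := by
  have hi {u : E d → ℝ} (hu : MemLp u 2 (leb Ω)) :=
    (VectorFourier.fourierIntegral_convergent_iff Real.continuous_fourierChar
      (L := innerₗ (E d))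
      (by simpa only [innerₗ_apply_apply] using continuous_inner) ξ).2 (integrable_of_memLp_two hu)
  unfold ft VectorFourier.fourierIntegral
  rw [← integral_sub (hi hu) (hi hv)]
  simp [smul_sub]

/-- At a fixed frequency the transform is a combination of two pairings of `u` with bounded real
functions, so weak `L²` convergence on a bounded set implies its pointwise convergence. -/
theorem ft_eq_integral_re_add_im [IsFiniteMeasure (leb Ω)] {u : E d → ℝ} (hu : MemLp u 2 (leb Ω))
    (ξ : E d) : ft Ω u ξ =
      ((∫ x, u x * (Real.fourierChar (-(inner ℝ x ξ)) : ℂ).re ∂(leb Ω) : ℝ) : ℂ) +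
      ((∫ x, u x * (Real.fourierChar (-(inner ℝ x ξ)) : ℂ).im ∂(leb Ω) : ℝ) : ℂ) * Complex.I := by
  have hi := (VectorFourier.fourierIntegral_convergent_iff Real.continuous_fourierChar
      (L := innerₗ (E d))
      (by simpa only [innerₗ_apply_apply] using continuous_inner) ξ).2 (integrable_of_memLp_two hu)
  have := integral_re_add_im (𝕜 := ℂ) hi
  unfold ft VectorFourier.fourierIntegral
  rw [← this]
  simp [Circle.smul_def, mul_comm]

/-- Dominated convergence: the transforms are bounded uniformly in the frequency by the `L²` norms,
and the ball of frequencies has finite measure. -/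
theorem tendsto_integral_norm_sq_ft [IsFiniteMeasure (leb Ω)] {ι : Type*} {l : Filter ι}
    [l.IsCountablyGenerated] {u : ι → E d → ℝ} (hu : ∀ i, MemLp (u i) 2 (leb Ω)) {M : ℝ}
    (hM : ∀ᶠ i in l, nrm (leb Ω) (u i) ≤ M) {F : E d → ℂ}
    (hF : ∀ ξ, Tendsto (fun i => ft Ω (u i) ξ) l (𝓝 (F ξ))) (R : ℝ) :
    Tendsto (fun i => ∫ ξ in Metric.closedBall (0 : E d) R, ‖ft Ω (u i) ξ‖ ^ 2) l
      (𝓝 (∫ ξ in Metric.closedBall (0 : E d) R, ‖F ξ‖ ^ 2)) := by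
  have : IsFiniteMeasure (volume.restrict (Metric.closedBall (0 : E d) R)) :=
    ⟨by simpa using measure_closedBall_lt_top⟩
  refine tendsto_integral_filter_of_dominated_convergence
    (fun _ => (√((leb Ω).real Set.univ) * M) ^ 2) ?_ ?_ (integrable_const _) ?_
  · exact Eventually.of_forall fun i => ((continuous_ft (hu i)).norm.pow 2).aestronglyMeasurable
  · filter_upwards [hM] with i hi
    refine ae_of_all _ fun ξ => ?_
    rw [Real.norm_of_nonneg (by positivity)]
    gcongr
    exact (norm_ft_le (hu i) ξ).trans (by gcongr)
  · exact ae_of_all _ fun ξ => ((hF ξ).norm.pow 2)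

/-- Plancherel with frequencies split at `R`: beyond it `1 ≤ |ξ|²/R²`, so that part is dominated by
the transform of the gradient. -/
theorem nrm_sq_le_fourier_test [IsFiniteMeasure (leb Ω)] (φ : TestFunction Ω ℝ (⊤ : ℕ∞))
    {R : ℝ} (hR : 0 < R) :
    nrm (leb Ω) φ ^ 2 ≤ (∫ ξ in Metric.closedBall (0 : E d) R, ‖ft Ω φ ξ‖ ^ 2)
      + (2 * Real.pi * R)⁻¹ ^ 2 * nrm (leb Ω) (gradient φ) ^ 2 := by
  obtain ⟨h1, h2, h3, h4⟩ := integral_norm_sq_mul_fourier φ.contDiff φ.hasCompactSupport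
  have e1 : nrm (leb Ω) φ = nrm volume φ := by
    unfold nrm
    rw [setIntegral_leb_of_support]
    intro x hx
    simp [TestFunction.eq_zero φ hx]
  have e2 : nrm (leb Ω) (gradient φ) = nrm volume (gradient φ) := by
    unfold nrm
    rw [setIntegral_leb_of_support]
    intro x hx
    simp [TestFunction.gradient_eq_zero φ hx]
  have e3 : ft Ω φ = 𝓕 (fun x => (φ x : ℂ)) := by
    ext1 ξ
    rw [Real.fourier_eq]
    refine setIntegral_leb_of_support _ fun x hx => ?_
    simp [TestFunction.eq_zero φ hx]
  rw [e1, e2, e3, ← h2, ← h4, ← integral_const_mul, ← integral_indicator measurableSet_closedBall,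
    ← integral_add (h3.indicator measurableSet_closedBall) (h1.const_mul _)]
  refine integral_mono h3 ((h3.indicator measurableSet_closedBall).add (h1.const_mul _)) fun ξ => ?_
  by_cases hξ : ξ ∈ Metric.closedBall (0 : E d) R
  · simp only [Set.indicator_of_mem hξ]
    exact le_add_of_nonneg_right (by positivity)
  · simp only [Set.indicator_of_notMem hξ]
    rw [Metric.mem_closedBall, dist_zero_right] at hξ
    have hRξ : R ≤ ‖ξ‖ := (not_le.1 hξ).le
    have : 1 ≤ R⁻¹ ^ 2 * ‖ξ‖ ^ 2 := by
      rw [← mul_pow, inv_mul_eq_div]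
      exact one_le_pow₀ ((one_le_div hR).2 hRξ)
    have e : (2 * Real.pi * R)⁻¹ ^ 2 * ((2 * Real.pi) ^ 2 * ‖ξ‖ ^ 2 *
        ‖𝓕 (fun x => (φ x : ℂ)) ξ‖ ^ 2) = (R⁻¹ ^ 2 * ‖ξ‖ ^ 2) *
        ‖𝓕 (fun x => (φ x : ℂ)) ξ‖ ^ 2 := by
      have := Real.pi_pos
      field_simp
    rw [zero_add, e]
    exact le_mul_of_one_le_left (by positivity) this

theorem abs_nrm_sub_nrm_le {X H : Type*} [MeasurableSpace X] {μ : Measure X}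
    [NormedAddCommGroup H] [InnerProductSpace ℝ H] {f g : X → H} (hf : MemLp f 2 μ)
    (hg : MemLp g 2 μ) : |nrm μ f - nrm μ g| ≤ nrm μ (fun x => f x - g x) := by
  have : nrm μ (fun x => f x - g x) = ‖(hf.sub hg).toLp (f - g)‖ := nrm_eq_norm_toLp (hf.sub hg)
  rw [this, MemLp.toLp_sub, nrm_eq_norm_toLp hf, nrm_eq_norm_toLp hg]
  exact abs_norm_sub_norm_le _ _

theorem tendsto_nrm {X H : Type*} [MeasurableSpace X] {μ : Measure X}
    [NormedAddCommGroup H] [InnerProductSpace ℝ H] {ι : Type*} {l : Filter ι} {f : ι → X → H}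
    {g : X → H} (hf : ∀ i, MemLp (f i) 2 μ) (hg : MemLp g 2 μ)
    (h : Tendsto (fun i => nrm μ (fun x => f i x - g x)) l (𝓝 0)) :
    Tendsto (fun i => nrm μ (f i)) l (𝓝 (nrm μ g)) := by
  rw [tendsto_iff_norm_sub_tendsto_zero]
  exact squeeze_zero (fun _ => norm_nonneg _) (fun i => abs_nrm_sub_nrm_le (hf i) hg) h

theorem MemH10.nrm_sq_le_fourier [IsFiniteMeasure (leb Ω)] {u : E d → ℝ} {G : E d → E d}
    (h : MemH10 Ω u G) {R : ℝ} (hR : 0 < R) :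
    nrm (leb Ω) u ^ 2 ≤ (∫ ξ in Metric.closedBall (0 : E d) R, ‖ft Ω u ξ‖ ^ 2)
      + (2 * Real.pi * R)⁻¹ ^ 2 * nrm (leb Ω) G ^ 2 := by
  obtain ⟨φ, h1, h2⟩ := h.exists_tendsto
  have l1 := tendsto_nrm (fun n => TestFunction.memLp_two (φ n)) h.memLp h1
  have l2 := tendsto_nrm (fun n => TestFunction.memLp_gradient (φ n)) h.memLp_grad h2
  have l3 (ξ : E d) : Tendsto (fun n => ft Ω (φ n) ξ) atTop (𝓝 (ft Ω u ξ)) := by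
    rw [tendsto_iff_norm_sub_tendsto_zero]
    have := h1.const_mul (√((leb Ω).real Set.univ))
    rw [mul_zero] at this
    refine squeeze_zero (fun _ => norm_nonneg _) (fun n => ?_) this
    rw [← ft_sub (TestFunction.memLp_two (φ n)) h.memLp]
    exact norm_ft_le ((TestFunction.memLp_two (φ n)).sub h.memLp) ξ
  have l4 := tendsto_integral_norm_sq_ft (fun n => TestFunction.memLp_two (φ n))
    (l1.eventually_le_const (lt_add_one _)) l3 R
  exact le_of_tendsto_of_tendsto' (l1.pow 2) (l4.add ((l2.pow 2).const_mul _))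
    fun n => nrm_sq_le_fourier_test (φ n) hR

/-- The Poincaré inequality on a bounded open set. -/
theorem exists_poincareConst (hd : 1 ≤ d) (hΩ : Bornology.IsBounded (Ω : Set (E d))) :
    ∃ K, PoincareConst Ω K := by
  have := isFiniteMeasure_leb hΩ
  set m := (leb Ω).real Set.univ
  set v := volume.real (Metric.closedBall (0 : E d) 1)
  have hm : 0 ≤ m := measureReal_nonneg
  have hv : 0 ≤ v := measureReal_nonneg
  -- Chosen so that `R ≤ 1` and `R^d v m ≤ 1/2`: the low frequencies then contribute at most half of
  -- `‖u‖²` and are absorbed on the left.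
  set R : ℝ := (2 * (v * m + 1))⁻¹
  have hR : 0 < R := by positivity
  have hR1 : R ≤ 1 := inv_le_one_of_one_le₀ (by nlinarith [mul_nonneg hv hm])
  have hRd : R ^ d * v * m ≤ 1 / 2 := by
    have h1 : R ^ d ≤ R := by simpa using pow_le_pow_of_le_one hR.le hR1 hd
    have h2 : R * (v * m) ≤ 1 / 2 := by
      have : R * (2 * (v * m + 1)) = 1 := inv_mul_cancel₀ (by positivity)
      nlinarith
    rw [mul_assoc]
    exact (mul_le_mul_of_nonneg_right h1 (by positivity)).trans h2
  refine ⟨√2 * (2 * Real.pi * R)⁻¹, by positivity, fun u G h => ?_⟩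
  have h1 := h.nrm_sq_le_fourier hR
  have h2 : ∫ ξ in Metric.closedBall (0 : E d) R, ‖ft Ω u ξ‖ ^ 2 ≤
      1 / 2 * nrm (leb Ω) u ^ 2 := by
    have hb : ∀ ξ ∈ Metric.closedBall (0 : E d) R, ‖‖ft Ω u ξ‖ ^ 2‖ ≤ m * nrm (leb Ω) u ^ 2 := by
      intro ξ _
      rw [Real.norm_of_nonneg (by positivity)]
      refine (pow_le_pow_left₀ (norm_nonneg _) (norm_ft_le h.memLp ξ) 2).trans_eq ?_
      rw [mul_pow, Real.sq_sqrt hm]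
    have h3 := norm_setIntegral_le_of_norm_le_const (μ := volume) measure_closedBall_lt_top hb
    have h4 : volume.real (Metric.closedBall (0 : E d) R) = R ^ d * v := by
      simp only [v, measureReal_def]
      rw [Measure.addHaar_closedBall' _ _ hR.le]
      simp [hR.le]
    rw [h4] at h3
    refine (le_abs_self _).trans (h3.trans ?_)
    nlinarith [sq_nonneg (nrm (leb Ω) u)]
  refine abs_le_of_sq_le_sq' ?_ (mul_nonneg (by positivity) (nrm_nonneg _)) |>.2
  rw [mul_pow, mul_pow, Real.sq_sqrt (by norm_num)]
  linarith

/-- A weakly null family bounded in `H¹₀` is strongly null in `L²`. -/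
theorem tendsto_nrm_zero_of_weak {K : ℝ} (hK : PoincareConst Ω K)
    (hΩ : Bornology.IsBounded (Ω : Set (E d))) {ι : Type*} {l : Filter ι}
    [l.IsCountablyGenerated] {u : ι → E d → ℝ} {G : ι → E d → E d}
    (h : ∀ i, MemH10 Ω (u i) (G i)) {C : ℝ} (hC : ∀ᶠ i in l, nrm (leb Ω) (G i) ≤ C)
    (hw : ∀ g, MemLp g 2 (leb Ω) → Tendsto (fun i => ∫ x, u i x * g x ∂(leb Ω)) l (𝓝 0)) :
    Tendsto (fun i => nrm (leb Ω) (u i)) l (𝓝 0) := by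
  have := isFiniteMeasure_leb hΩ
  have hM : ∀ᶠ i in l, nrm (leb Ω) (u i) ≤ K * C := by
    filter_upwards [hC] with i hi
    exact (hK.2 _ _ (h i)).trans (mul_le_mul_of_nonneg_left hi hK.1)
  -- Weak convergence is tested with the real and imaginary parts of the character.
  have hF (ξ : E d) : Tendsto (fun i => ft Ω (u i) ξ) l (𝓝 0) := by
    have hc : Continuous fun x : E d => (Real.fourierChar (-(inner ℝ x ξ)) : ℂ) :=
      continuous_subtype_val.comp (Real.continuous_fourierChar.comp (by fun_prop))
    have hb (x : E d) : ‖(Real.fourierChar (-(inner ℝ x ξ)) : ℂ)‖ ≤ 1 :=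
      (Circle.norm_coe _).le
    have h1 := hw (fun x => (Real.fourierChar (-(inner ℝ x ξ)) : ℂ).re)
      (MemLp.of_bound (Complex.continuous_re.comp hc).aestronglyMeasurable 1
        (ae_of_all _ fun x => (Complex.abs_re_le_norm _).trans (hb x)))
    have h2 := hw (fun x => (Real.fourierChar (-(inner ℝ x ξ)) : ℂ).im)
      (MemLp.of_bound (Complex.continuous_im.comp hc).aestronglyMeasurable 1
        (ae_of_all _ fun x => (Complex.abs_im_le_norm _).trans (hb x)))
    have h3 := ((Complex.continuous_ofReal.tendsto 0).comp h1).add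
      (((Complex.continuous_ofReal.tendsto 0).comp h2).mul_const Complex.I)
    simp only [Complex.ofReal_zero, zero_mul, add_zero] at h3
    exact h3.congr fun i => (ft_eq_integral_re_add_im (h i).memLp ξ).symm
  rw [Metric.tendsto_nhds]
  intro ε hε
  have hC0 : 0 ≤ |C| := abs_nonneg C
  -- High frequencies then contribute at most `(ε/2)²` uniformly in the family, and the low ones are
  -- eventually below `ε²/2`.
  set R : ℝ := (|C| + 1) / ε
  have hR : 0 < R := by positivity
  have h1 := tendsto_integral_norm_sq_ft (fun i => (h i).memLp) hM hF R
  simp only [norm_zero, ne_eq, OfNat.ofNat_ne_zero, not_false_eq_true, zero_pow,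
    integral_zero] at h1
  filter_upwards [hC, h1.eventually_lt_const (show 0 < ε ^ 2 / 2 by positivity)] with i hi hi2
  rw [Real.dist_eq, sub_zero, abs_of_nonneg (nrm_nonneg _)]
  refine lt_of_pow_lt_pow_left₀ 2 hε.le (((h i).nrm_sq_le_fourier hR).trans_lt ?_)
  have h3 : (2 * Real.pi * R)⁻¹ * nrm (leb Ω) (G i) ≤ ε / 2 := by
    have h4 : nrm (leb Ω) (G i) ≤ |C| + 1 := hi.trans ((le_abs_self C).trans (by linarith))
    have h5 : R * ε = |C| + 1 := by simp only [R]; field_simp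
    rw [inv_mul_le_iff₀ (by positivity)]
    nlinarith [Real.pi_gt_three]
  have h6 := pow_le_pow_left₀ (mul_nonneg (by positivity) (nrm_nonneg _)) h3 2
  rw [mul_pow] at h6
  nlinarith [sq_pos_of_pos hε]

end Fourier

/-! ### Lebesgue points in `L¹` and `L²`. -/

section LebesguePoints

variable {Ω : TopologicalSpace.Opens (E d)}

/-- Lebesgue measure on the part of a ball inside `Ω`. -/
def ballLeb (Ω : TopologicalSpace.Opens (E d)) (x₀ : E d) (r : ℝ) : Measure (E d) :=
  (leb Ω).restrict (Metric.ball x₀ r)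

theorem ballLeb_le (x₀ : E d) (r : ℝ) : ballLeb Ω x₀ r ≤ leb Ω := Measure.restrict_le_self

instance (x₀ : E d) (r : ℝ) : IsFiniteMeasure (ballLeb Ω x₀ r) :=
  ⟨by
    rw [ballLeb, Measure.restrict_apply_univ]
    exact (Measure.restrict_apply_le _ _).trans_lt measure_ball_lt_top⟩

/-- The square root of `r ^ d`. -/
def rt (d : ℕ) (r : ℝ) : ℝ := √(r ^ d)

theorem rt_pos {r : ℝ} (hr : 0 < r) : 0 < rt d r := Real.sqrt_pos.2 (by positivity)

theorem rt_sq {r : ℝ} (hr : 0 < r) : rt d r ^ 2 = r ^ d := Real.sq_sqrt (by positivity)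

theorem rt_mul {M r : ℝ} (hM : 0 < M) : rt d (M * r) = rt d M * rt d r := by
  unfold rt
  rw [mul_pow, Real.sqrt_mul (by positivity)]

/-- Lebesgue differentiation for the extension of `f` by zero. The averages are over closed balls;
passing to the open ball inside `Ω` only decreases the integral, and the volume differs from `r ^ d`
by a constant. -/
theorem ae_tendsto_integral_norm_sub {F : Type*} [NormedAddCommGroup F] {f : E d → F}
    (hf : Integrable f (leb Ω)) : ∀ᵐ x₀ ∂(leb Ω),
      Tendsto (fun r : ℝ => (r ^ d)⁻¹ * ∫ x, ‖f x - f x₀‖ ∂(ballLeb Ω x₀ r)) (𝓝[>] 0) (𝓝 0) := by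
  set g := (Ω : Set (E d)).indicator f
  have hg : Integrable g volume := (integrable_indicator_iff Ω.isOpen.measurableSet).2 hf
  have hm : ∀ᵐ x₀ ∂(leb Ω), x₀ ∈ (Ω : Set (E d)) := ae_restrict_mem Ω.isOpen.measurableSet
  have hL : ∀ᵐ x₀ ∂(leb Ω), Tendsto
      (fun r : ℝ => ⨍ y in Metric.closedBall x₀ r, ‖g y - g x₀‖ ∂volume) (𝓝[>] 0) (𝓝 0) := by
    refine ae_restrict_of_ae ?_
    filter_upwards [IsUnifLocDoublingMeasure.ae_tendsto_average_norm_sub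
      (μ := (volume : Measure (E d))) hg.locallyIntegrable 1] with x hx
    refine hx (fun _ => x) (fun r => r) tendsto_id ?_
    filter_upwards [self_mem_nhdsWithin] with r hr
    rw [one_mul]
    exact Metric.mem_closedBall_self (le_of_lt hr)
  filter_upwards [hm, hL] with x₀ hx₀ hlim
  set v := volume.real (Metric.closedBall (0 : E d) 1)
  have hl2 := hlim.const_mul v
  rw [mul_zero] at hl2
  refine tendsto_of_tendsto_of_tendsto_of_le_of_le' tendsto_const_nhds hl2 ?_ ?_
  · filter_upwards [self_mem_nhdsWithin] with r hr
    have : (0 : ℝ) < r := hr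
    positivity
  · filter_upwards [self_mem_nhdsWithin] with r hr
    have hr : (0 : ℝ) < r := hr
    have hv : 0 < v := ENNReal.toReal_pos
      (Metric.measure_closedBall_pos volume (0 : E d) one_pos).ne' measure_closedBall_lt_top.ne
    have h4 : volume.real (Metric.closedBall x₀ r) = r ^ d * v := by
      simp only [v, measureReal_def]
      rw [Measure.addHaar_closedBall' _ _ hr.le]
      simp [hr.le]
    have hint : IntegrableOn (fun x => ‖g x - g x₀‖) (Metric.closedBall x₀ r) volume :=
      (hg.integrableOn.sub (integrableOn_const measure_closedBall_lt_top.ne)).norm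
    rw [setAverage_eq, h4, smul_eq_mul, mul_inv, mul_assoc, mul_left_comm, ← mul_assoc v,
      mul_inv_cancel₀ hv.ne', one_mul]
    refine mul_le_mul_of_nonneg_left ?_ (by positivity)
    have e1 : ∫ x, ‖f x - f x₀‖ ∂(ballLeb Ω x₀ r) = ∫ x, ‖g x - g x₀‖ ∂(ballLeb Ω x₀ r) := by
      refine integral_congr_ae ?_
      have : ∀ᵐ x ∂(ballLeb Ω x₀ r), x ∈ (Ω : Set (E d)) :=
        ae_restrict_of_ae (ae_restrict_mem Ω.isOpen.measurableSet)
      filter_upwards [this] with x hx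
      simp only [g, Set.indicator_of_mem hx, Set.indicator_of_mem hx₀]
    rw [e1]
    refine integral_mono_measure ?_ (ae_of_all _ fun _ => norm_nonneg _) hint
    exact (Measure.restrict_mono_set _ Metric.ball_subset_closedBall).trans
      (Measure.restrict_mono_measure Measure.restrict_le_self _)

variable {H : Type*} [NormedAddCommGroup H] [InnerProductSpace ℝ H]

/-- `x₀` is an `L²` Lebesgue point of `f`. -/
def IsLebPoint (Ω : TopologicalSpace.Opens (E d)) (f : E d → H) (x₀ : E d) : Prop :=
  Tendsto (fun r : ℝ => nrm (ballLeb Ω x₀ r) (fun x => f x - f x₀) / rt d r) (𝓝[>] 0) (𝓝 0)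

/-- Since `|f - f₀|² = (|f|² - |f₀|²) - 2⟨f - f₀, f₀⟩` with `f₀ = f x₀`, it is enough that `x₀` is
an `L¹` Lebesgue point of both `f` and `|f|²`. -/
theorem ae_isLebPoint [IsFiniteMeasure (leb Ω)] {f : E d → H} (hf : MemLp f 2 (leb Ω)) :
    ∀ᵐ x₀ ∂(leb Ω), IsLebPoint Ω f x₀ := by
  filter_upwards [ae_tendsto_integral_norm_sub (hf.integrable (by norm_num)),
    ae_tendsto_integral_norm_sub (integrable_norm_sq_of_memLp hf)] with x₀ h1 h2
  have h3 := (h2.add (h1.const_mul (2 * ‖f x₀‖))).sqrt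
  rw [mul_zero, add_zero, Real.sqrt_zero] at h3
  have hnn : ∀ᶠ r : ℝ in 𝓝[>] 0, 0 ≤ nrm (ballLeb Ω x₀ r) (fun x => f x - f x₀) / rt d r :=
    Eventually.of_forall fun r => div_nonneg (nrm_nonneg _) (Real.sqrt_nonneg _)
  refine tendsto_of_tendsto_of_tendsto_of_le_of_le' tendsto_const_nhds h3 hnn ?_
  filter_upwards [self_mem_nhdsWithin] with r hr
  have hr : (0 : ℝ) < r := hr
  rw [nrm, rt, ← Real.sqrt_div (integral_nonneg fun _ => by positivity)]
  refine Real.sqrt_le_sqrt ?_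
  have hf' : MemLp f 2 (ballLeb Ω x₀ r) := hf.mono_measure (ballLeb_le _ _)
  have i1 : Integrable (fun x => ‖f x - f x₀‖) (ballLeb Ω x₀ r) :=
    ((hf'.integrable (by norm_num)).sub (integrable_const _)).norm
  have i2 : Integrable (fun x => ‖‖f x‖ ^ 2 - ‖f x₀‖ ^ 2‖) (ballLeb Ω x₀ r) :=
    ((integrable_norm_sq_of_memLp hf').sub (integrable_const _)).norm
  rw [mul_left_comm, ← mul_add, div_eq_inv_mul, ← integral_const_mul (2 * ‖f x₀‖),
    ← integral_add i2 (i1.const_mul _)]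
  refine mul_le_mul_of_nonneg_left ?_ (by positivity)
  refine integral_mono (integrable_norm_sq_of_memLp (hf'.sub (memLp_const _)))
    (i2.add (i1.const_mul _)) fun x => ?_
  have e : ‖f x - f x₀‖ ^ 2 =
      (‖f x‖ ^ 2 - ‖f x₀‖ ^ 2) - 2 * inner ℝ (f x - f x₀) (f x₀) := by
    rw [norm_sub_sq_real, inner_sub_left, real_inner_self_eq_norm_sq]
    ring
  have h5 := neg_le_of_abs_le (abs_real_inner_le_norm (f x - f x₀) (f x₀))
  have h6 := le_abs_self (‖f x‖ ^ 2 - ‖f x₀‖ ^ 2)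
  simp only [Real.norm_eq_abs] at h6 ⊢
  rw [e]
  nlinarith

theorem IsLebPoint.tendsto_scaled {f : E d → H} {x₀ : E d} (h : IsLebPoint Ω f x₀) {M : ℝ}
    (hM : 0 < M) : Tendsto
      (fun r : ℝ => nrm (ballLeb Ω x₀ (M * r)) (fun x => f x - f x₀) / rt d r) (𝓝[>] 0) (𝓝 0) := by
  have hs : Tendsto (fun r : ℝ => M * r) (𝓝[>] 0) (𝓝[>] 0) := by
    refine tendsto_nhdsWithin_iff.2 ⟨?_, ?_⟩
    · have : Tendsto (fun r : ℝ => M * r) (𝓝 0) (𝓝 (M * 0)) := (continuous_const_mul M).tendsto 0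
      rw [mul_zero] at this
      exact this.mono_left nhdsWithin_le_nhds
    · filter_upwards [self_mem_nhdsWithin] with r hr using mul_pos hM hr
  have h1 := (h.comp hs).const_mul (rt d M)
  rw [mul_zero] at h1
  refine h1.congr' ?_
  filter_upwards [self_mem_nhdsWithin] with r hr
  rw [Function.comp_apply, rt_mul hM]
  have h2 := (rt_pos (d := d) hM).ne'
  have h3 := (rt_pos (d := d) (show 0 < r from hr)).ne'
  field_simp

theorem volumeReal_ballLeb_le (x₀ : E d) {r : ℝ} (hr : 0 < r) :
    (ballLeb Ω x₀ r).real Set.univ ≤ r ^ d * volume.real (Metric.ball (0 : E d) 1) := by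
  have h4 : volume.real (Metric.ball x₀ r) = r ^ d * volume.real (Metric.ball (0 : E d) 1) := by
    simp only [measureReal_def]
    rw [Measure.addHaar_ball_of_pos _ _ hr]
    simp [hr.le]
  rw [← h4, ballLeb, measureReal_restrict_apply_univ]
  exact ENNReal.toReal_mono measure_ball_lt_top.ne (Measure.restrict_apply_le _ _)

theorem nrm_const_ballLeb_le (c : H) (x₀ : E d) {r : ℝ} (hr : 0 < r) :
    nrm (ballLeb Ω x₀ r) (fun _ => c) ≤
      √(volume.real (Metric.ball (0 : E d) 1)) * ‖c‖ * rt d r := by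
  have : nrm (ballLeb Ω x₀ r) (fun _ => c) = √((ballLeb Ω x₀ r).real Set.univ) * ‖c‖ := by
    rw [nrm, integral_const, smul_eq_mul, Real.sqrt_mul measureReal_nonneg,
      Real.sqrt_sq (norm_nonneg _)]
  rw [this, mul_right_comm, rt, ← Real.sqrt_mul measureReal_nonneg,
    mul_comm (volume.real _)]
  gcongr
  exact volumeReal_ballLeb_le x₀ hr

theorem IsLebPoint.exists_nrm_le [IsFiniteMeasure (leb Ω)] {f : E d → H} {x₀ : E d}
    (hf : MemLp f 2 (leb Ω)) (h : IsLebPoint Ω f x₀) :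
    ∃ C, 0 ≤ C ∧ ∀ᶠ r : ℝ in 𝓝[>] 0, nrm (ballLeb Ω x₀ r) f ≤ C * rt d r := by
  refine ⟨√(volume.real (Metric.ball (0 : E d) 1)) * ‖f x₀‖ + 1, by positivity, ?_⟩
  filter_upwards [h.eventually_le_const one_pos, self_mem_nhdsWithin] with r h1 hr
  have hr : (0 : ℝ) < r := hr
  rw [div_le_one (rt_pos hr)] at h1
  have h2 := nrm_add_le (f := fun x => f x - f x₀) (g := fun _ => f x₀)
    ((hf.mono_measure (ballLeb_le x₀ r)).sub (memLp_const _)) (memLp_const _)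
  simp only [sub_add_cancel] at h2
  have h3 := nrm_const_ballLeb_le (Ω := Ω) (f x₀) x₀ hr
  linarith

end LebesguePoints

/-! ### The explicit corrector of the ball. -/

section Corrector

/-- Integrating by parts moves both derivatives onto the compactly supported `φ`, where second
derivatives are symmetric. -/
theorem integral_fderiv_mul_fderiv_comm {ψ φ : E d → ℝ} (hψ : ContDiff ℝ (⊤ : ℕ∞) ψ)
    (hφ : ContDiff ℝ (⊤ : ℕ∞) φ) (hc : HasCompactSupport φ) (v w : E d) :
    ∫ x, fderiv ℝ ψ x v * fderiv ℝ φ x w = ∫ x, fderiv ℝ ψ x w * fderiv ℝ φ x v := by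
  have hd1 (v : E d) : ContDiff ℝ (⊤ : ℕ∞) fun x => fderiv ℝ φ x v :=
    (hφ.fderiv_right (m := (⊤ : ℕ∞)) (by simp)).clm_apply contDiff_const
  have hc1 (v : E d) : HasCompactSupport fun x => fderiv ℝ φ x v :=
    (hc.fderiv (𝕜 := ℝ)).comp_left (g := fun L : E d →L[ℝ] ℝ => L v) rfl
  have hc2 (v w : E d) : HasCompactSupport fun x => fderiv ℝ (fun x => fderiv ℝ φ x v) x w :=
    ((hc1 v).fderiv (𝕜 := ℝ)).comp_left (g := fun L : E d →L[ℝ] ℝ => L w) rfl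
  have hcψ (v : E d) : Continuous fun x => fderiv ℝ ψ x v :=
    (hψ.continuous_fderiv (by simp)).clm_apply continuous_const
  have key (v w : E d) : ∫ x, fderiv ℝ ψ x v * fderiv ℝ φ x w =
      - ∫ x, ψ x * fderiv ℝ (fun x => fderiv ℝ φ x w) x v := by
    have hcc : Continuous fun x => fderiv ℝ (fun x => fderiv ℝ φ x w) x v :=
      ((hd1 w).continuous_fderiv (by simp)).clm_apply continuous_const
    have := integral_mul_fderiv_eq_neg_fderiv_mul_of_integrable (μ := (volume : Measure (E d)))
      (f := ψ) (g := fun x => fderiv ℝ φ x w) (v := v)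
      (((hcψ v).mul (hd1 w).continuous).integrable_of_hasCompactSupport (hc1 w).mul_left)
      ((hψ.continuous.mul hcc).integrable_of_hasCompactSupport (hc2 w v).mul_left)
      ((hψ.continuous.mul (hd1 w).continuous).integrable_of_hasCompactSupport (hc1 w).mul_left)
      (fun x _ => hψ.differentiable (by simp) x) (fun x _ => (hd1 w).differentiable (by simp) x)
    rw [this, neg_neg]
  rw [key v w, key w v]
  congr 2
  ext1 x
  congr 1
  have hdd : DifferentiableAt ℝ (fderiv ℝ φ) x :=
    (hφ.fderiv_right (m := (⊤ : ℕ∞)) (by simp)).differentiable (by simp) x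
  have e (v w : E d) : fderiv ℝ (fun x => fderiv ℝ φ x w) x v = fderiv ℝ (fderiv ℝ φ) x v w := by
    rw [fderiv_clm_apply hdd (differentiableAt_const _)]
    simp
  rw [e, e]
  exact (hφ.contDiffAt.isSymmSndFDerivAt (by
    simp only [minSmoothness_of_isRCLikeNormedField]
    exact WithTop.coe_le_coe.2 le_top)).eq v w

/-- A smooth approximation of `min 1 (‖x‖ ^ (-d))`. -/
def prof (n : ℕ) (x : E d) : ℝ :=
  (1 + (‖x‖ ^ 2) ^ (d * (n + 1))) ^ (-(1 / (2 * ((n : ℝ) + 1))))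

/-- The factor in `∇ (prof n) = - profD n • x`. -/
def profD (n : ℕ) (x : E d) : ℝ :=
  d * (1 + (‖x‖ ^ 2) ^ (d * (n + 1))) ^ (-(1 / (2 * ((n : ℝ) + 1))) - 1) *
    (‖x‖ ^ 2) ^ (d * (n + 1) - 1)

/-- Only powers of `‖x‖ ^ 2` occur, so the origin is harmless, and the base of the real power is at
least one. -/
theorem contDiff_prof (n : ℕ) : ContDiff ℝ (⊤ : ℕ∞) (prof (d := d) n) := by
  unfold prof
  refine ContDiff.rpow_const_of_ne (contDiff_const.add ((contDiff_norm_sq ℝ).pow _)) fun x => ?_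
  positivity

theorem hasFDerivAt_prof (n : ℕ) (x : E d) :
    HasFDerivAt (prof n) (-(profD n x) • innerSL ℝ x) x := by
  have h1 : HasFDerivAt (fun x : E d => ‖x‖ ^ 2) (2 • innerSL ℝ x) x :=
    (hasStrictFDerivAt_norm_sq x).hasFDerivAt
  have h2 : HasDerivAt (fun s : ℝ => (1 + s ^ (d * (n + 1))) ^ (-(1 / (2 * ((n : ℝ) + 1)))))
      _ (‖x‖ ^ 2) :=
    ((hasDerivAt_pow (d * (n + 1)) (‖x‖ ^ 2)).const_add 1).rpow_const (Or.inl (by positivity))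
  refine (h2.comp_hasFDerivAt x h1).congr_fderiv ?_
  ext v
  simp only [smul_apply, smul_eq_mul, profD, Nat.cast_mul, Nat.cast_add,
    Nat.cast_one, nsmul_eq_mul, Nat.cast_ofNat]
  have : ((n : ℝ) + 1) ≠ 0 := by positivity
  field_simp

theorem continuous_profD (n : ℕ) : Continuous (profD (d := d) n) := by
  unfold profD
  refine (continuous_const.mul (Continuous.rpow_const (by fun_prop) fun x => Or.inl ?_)).mul
    (by fun_prop)
  positivity

theorem prof_nonneg (n : ℕ) (x : E d) : 0 ≤ prof n x := by
  unfold prof; positivity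

theorem profD_nonneg (n : ℕ) (x : E d) : 0 ≤ profD n x := by
  unfold profD; positivity

/-- The last factor lies in `[0, 1)` and tends to 0 inside the unit ball and to 1 outside. This
gives both the bound and the limit of `profD`. -/
theorem profD_mul_norm_sq (hd : 1 ≤ d) (n : ℕ) (x : E d) : profD n x * ‖x‖ ^ 2 =
    d * prof n x * ((‖x‖ ^ 2) ^ (d * (n + 1)) / (1 + (‖x‖ ^ 2) ^ (d * (n + 1)))) := by
  unfold profD prof
  have hm : d * (n + 1) - 1 + 1 = d * (n + 1) :=
    Nat.sub_add_cancel (Nat.mul_pos hd (Nat.succ_pos n))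
  have hp : 0 < 1 + (‖x‖ ^ 2) ^ (d * (n + 1)) := by positivity
  rw [Real.rpow_sub hp, Real.rpow_one, mul_assoc, ← pow_succ, hm]
  field_simp

theorem profD_mul_norm_sq_le (hd : 1 ≤ d) (n : ℕ) (x : E d) :
    profD n x * ‖x‖ ^ 2 ≤ d * prof n x := by
  rw [profD_mul_norm_sq hd]
  refine mul_le_of_le_one_right (mul_nonneg (Nat.cast_nonneg _) (prof_nonneg _ _)) ?_
  rw [div_le_one (by positivity)]
  linarith

theorem pow_rpow_neg {t : ℝ} (ht : 0 ≤ t) (n : ℕ) :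
    ((t ^ 2) ^ (d * (n + 1))) ^ (-(1 / (2 * ((n : ℝ) + 1)))) = (t ^ d)⁻¹ := by
  rw [← pow_mul, ← Real.rpow_natCast, ← Real.rpow_mul ht]
  have : ((2 * (d * (n + 1)) : ℕ) : ℝ) * -(1 / (2 * ((n : ℝ) + 1))) = -(d : ℝ) := by
    have : ((n : ℝ) + 1) ≠ 0 := by positivity
    push_cast
    field_simp
  rw [this, Real.rpow_neg ht, Real.rpow_natCast]

variable (d) in
/-- A square integrable majorant. -/
def majorant (x : E d) : ℝ := 2 ^ d * ((1 + ‖x‖) ^ d)⁻¹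

/-- By `pow_rpow_neg` the majorant is the same negative power of `((1 + ‖x‖)/2)^{2d(n+1)}`, and `(1
+ ‖x‖)/2` is at most the larger of 1 and `‖x‖`. The bound is independent of `n`, and its square
decays like `|x|^{-2d}`. -/
theorem prof_le_majorant (n : ℕ) (x : E d) : prof n x ≤ majorant d x := by
  have h1 : majorant d x = (((1 + ‖x‖) / 2) ^ d)⁻¹ := by
    unfold majorant
    rw [div_pow, inv_div]
    rfl
  rw [h1, ← pow_rpow_neg (by positivity) n]
  refine Real.rpow_le_rpow_of_nonpos (by positivity) ?_ (by
    rw [neg_nonpos]; positivity)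
  have hx := norm_nonneg x
  rcases le_total ‖x‖ 1 with h | h
  · have : (((1 + ‖x‖) / 2) ^ 2) ^ (d * (n + 1)) ≤ 1 :=
      pow_le_one₀ (by positivity) (pow_le_one₀ (by positivity) (by linarith))
    have h2 : 0 ≤ (‖x‖ ^ 2) ^ (d * (n + 1)) := by positivity
    linarith
  · have : (((1 + ‖x‖) / 2) ^ 2) ^ (d * (n + 1)) ≤ (‖x‖ ^ 2) ^ (d * (n + 1)) := by
      gcongr
      linarith
    linarith

theorem majorant_nonneg (x : E d) : 0 ≤ majorant d x := by
  unfold majorant; positivity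

theorem integrable_majorant_sq (hd : 1 ≤ d) :
    Integrable (fun x => majorant d x ^ 2) (volume : Measure (E d)) := by
  have h : (Module.finrank ℝ (E d) : ℝ) < ((2 * d : ℕ) : ℝ) := by
    rw [finrank_euclideanSpace_fin]
    exact_mod_cast (by omega : d < 2 * d)
  refine ((integrable_one_add_norm (μ := (volume : Measure (E d))) h).const_mul
    ((2 ^ d) ^ 2)).congr (ae_of_all _ fun x => ?_)
  simp only [majorant]
  rw [Real.rpow_neg (by positivity), Real.rpow_natCast, mul_pow, inv_pow, ← pow_mul, ← pow_mul,
    mul_comm d 2]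

/-- The limit of `prof n`. -/
def prof₀ (x : E d) : ℝ := if ‖x‖ < 1 then 1 else (‖x‖ ^ d)⁻¹

/-- The limit of `profD n`. -/
def profD₀ (x : E d) : ℝ := if ‖x‖ < 1 then 0 else d * (‖x‖ ^ d)⁻¹ * (‖x‖ ^ 2)⁻¹

theorem tendsto_exponent :
    Tendsto (fun n : ℕ => -(1 / (2 * ((n : ℝ) + 1)))) atTop (𝓝 0) := by
  have h := (tendsto_one_div_add_atTop_nhds_zero_nat (𝕜 := ℝ)).const_mul (-(1 / 2))
  rw [mul_zero] at h
  refine h.congr fun n => ?_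
  have : ((n : ℝ) + 1) ≠ 0 := by positivity
  field_simp

theorem tendsto_mul_succ (hd : 1 ≤ d) : Tendsto (fun n : ℕ => d * (n + 1)) atTop atTop :=
  tendsto_atTop_mono (fun n => (Nat.le_succ n).trans (Nat.le_mul_of_pos_left _ hd)) tendsto_id

theorem tendsto_prof (hd : 1 ≤ d) {x : E d} (hx : ‖x‖ ≠ 1) :
    Tendsto (fun n => prof n x) atTop (𝓝 (prof₀ x)) := by
  rcases lt_or_gt_of_ne hx with h | h
  · rw [prof₀, if_pos h]
    have h1 : Tendsto (fun n : ℕ => 1 + (‖x‖ ^ 2) ^ (d * (n + 1))) atTop (𝓝 (1 + 0)) :=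
      tendsto_const_nhds.add ((tendsto_pow_atTop_nhds_zero_of_lt_one (by positivity)
        (pow_lt_one₀ (norm_nonneg _) h (by norm_num))).comp (tendsto_mul_succ hd))
    have := h1.rpow tendsto_exponent (Or.inl (by norm_num))
    rwa [add_zero, Real.rpow_zero] at this
  · rw [prof₀, if_neg h.not_gt]
    have hx0 : 0 < ‖x‖ := by linarith
    have h1 : Tendsto (fun n : ℕ => 1 + ((‖x‖ ^ 2) ^ (d * (n + 1)))⁻¹) atTop (𝓝 (1 + 0)) :=
      tendsto_const_nhds.add (((tendsto_pow_atTop_atTop_of_one_lt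
        (one_lt_pow₀ h (by norm_num))).comp (tendsto_mul_succ hd)).inv_tendsto_atTop)
    have h2 := (h1.rpow tendsto_exponent (Or.inl (by norm_num))).const_mul ((‖x‖ ^ d)⁻¹)
    simp only [add_zero, Real.rpow_zero, mul_one] at h2
    refine h2.congr fun n => ?_
    rw [← pow_rpow_neg hx0.le n, ← Real.mul_rpow (by positivity) (by positivity), prof]
    congr 1
    field_simp
    ring

/-- The unit sphere must be excluded: there the factor in `profD_mul_norm_sq` is `1/2` for every
`n`. The origin is excluded in order to divide by `‖x‖ ^ 2`. Both sets are null. -/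
theorem tendsto_profD (hd : 1 ≤ d) {x : E d} (hx : ‖x‖ ≠ 1) (hx0 : x ≠ 0) :
    Tendsto (fun n => profD n x) atTop (𝓝 (profD₀ x)) := by
  have hn : ‖x‖ ^ 2 ≠ 0 := by positivity
  have key (n : ℕ) : profD n x = d * prof n x *
      ((‖x‖ ^ 2) ^ (d * (n + 1)) / (1 + (‖x‖ ^ 2) ^ (d * (n + 1)))) * (‖x‖ ^ 2)⁻¹ := by
    rw [← profD_mul_norm_sq hd, mul_assoc, mul_inv_cancel₀ hn, mul_one]
  simp_rw [key]
  have h0 := (tendsto_prof hd hx).const_mul (d : ℝ)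
  rcases lt_or_gt_of_ne hx with h | h
  · rw [profD₀, if_pos h]
    have h1 : Tendsto (fun n : ℕ => (‖x‖ ^ 2) ^ (d * (n + 1))) atTop (𝓝 0) :=
      (tendsto_pow_atTop_nhds_zero_of_lt_one (by positivity)
        (pow_lt_one₀ (norm_nonneg _) h (by norm_num))).comp (tendsto_mul_succ hd)
    have h2 := h1.div (h1.const_add 1) (by norm_num)
    simpa using (h0.mul h2).mul_const ((‖x‖ ^ 2)⁻¹)
  · have h1 : Tendsto (fun n : ℕ => ((‖x‖ ^ 2) ^ (d * (n + 1)))⁻¹) atTop (𝓝 0) :=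
      ((tendsto_pow_atTop_atTop_of_one_lt
        (one_lt_pow₀ h (by norm_num))).comp (tendsto_mul_succ hd)).inv_tendsto_atTop
    have h2 := ((h1.add_const 1).inv₀ (by norm_num))
    have h3 := (h0.mul h2).mul_const ((‖x‖ ^ 2)⁻¹)
    rw [prof₀, if_neg h.not_gt, zero_add, inv_one, mul_one] at h3
    rw [profD₀, if_neg h.not_gt]
    refine h3.congr fun n => ?_
    congr 2
    have : (‖x‖ ^ 2) ^ (d * (n + 1)) ≠ 0 := by positivity
    field_simp

/-- The smooth fields `∇ (prof n • ⟨·, e⟩)`. -/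
def field (n : ℕ) (e x : E d) : E d := prof n x • e - (profD n x * inner ℝ x e) • x

/-- The gradient of the corrector `⟨x, e⟩ min 1 (‖x‖ ^ (-d))`. -/
def field₀ (e x : E d) : E d := prof₀ x • e - (profD₀ x * inner ℝ x e) • x

theorem field₀_of_mem_ball (e : E d) {x : E d} (hx : x ∈ Metric.ball (0 : E d) 1) :
    field₀ e x = e := by
  rw [mem_ball_zero_iff] at hx
  simp [field₀, prof₀, profD₀, hx]

theorem continuous_field (n : ℕ) (e : E d) : Continuous (field n e) := by
  have h1 := (contDiff_prof (d := d) n).continuous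
  have h2 := continuous_profD (d := d) n
  unfold field
  fun_prop

theorem norm_profD_smul_le (hd : 1 ≤ d) (n : ℕ) (e x : E d) :
    ‖(profD n x * inner ℝ x e) • x‖ ≤ d * prof n x * ‖e‖ := by
  rw [norm_smul, norm_mul, Real.norm_of_nonneg (profD_nonneg _ _)]
  have h1 := norm_inner_le_norm (𝕜 := ℝ) x e
  calc profD n x * ‖inner ℝ x e‖ * ‖x‖ ≤ profD n x * (‖x‖ * ‖e‖) * ‖x‖ := by
        have := profD_nonneg n x
        gcongr
    _ = profD n x * ‖x‖ ^ 2 * ‖e‖ := by ring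
    _ ≤ _ := mul_le_mul_of_nonneg_right (profD_mul_norm_sq_le hd n x) (norm_nonneg _)

theorem norm_field_le (hd : 1 ≤ d) (n : ℕ) (e x : E d) :
    ‖field n e x‖ ≤ (1 + d) * ‖e‖ * majorant d x := by
  have h1 := norm_sub_le (prof n x • e) ((profD n x * inner ℝ x e) • x)
  have h2 := norm_profD_smul_le hd n e x
  rw [norm_smul, Real.norm_of_nonneg (prof_nonneg _ _)] at h1
  calc ‖field n e x‖ ≤ (1 + d) * ‖e‖ * prof n x := by rw [field]; linarith
    _ ≤ _ := by gcongr; exact prof_le_majorant n x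

theorem ae_norm_ne_one : ∀ᵐ x : E d, ‖x‖ ≠ 1 := by
  have h : volume (Metric.sphere (0 : E d) 1) = 0 :=
    Measure.addHaar_sphere_of_ne_zero _ _ one_ne_zero
  rw [ae_iff]
  convert h using 2
  ext x
  simp

theorem ae_ne_zero (hd : 1 ≤ d) : ∀ᵐ x : E d, x ≠ 0 := by
  have : Nonempty (Fin d) := ⟨⟨0, hd⟩⟩
  rw [ae_iff]
  simp

theorem tendsto_field (hd : 1 ≤ d) (e : E d) {x : E d} (hx : ‖x‖ ≠ 1) (hx0 : x ≠ 0) :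
    Tendsto (fun n => field n e x) atTop (𝓝 (field₀ e x)) :=
  ((tendsto_prof hd hx).smul_const e).sub
    (((tendsto_profD hd hx hx0).mul_const _).smul_const x)

theorem aestronglyMeasurable_field₀ (hd : 1 ≤ d) (e : E d) :
    AEStronglyMeasurable (field₀ e) volume := by
  refine aestronglyMeasurable_of_tendsto_ae atTop
    (fun n => (continuous_field n e).aestronglyMeasurable) ?_
  filter_upwards [ae_norm_ne_one, ae_ne_zero hd] with x h1 h2 using tendsto_field hd e h1 h2

theorem norm_field₀_le (hd : 1 ≤ d) (e : E d) :
    ∀ᵐ x, ‖field₀ e x‖ ≤ (1 + d) * ‖e‖ * majorant d x := by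
  filter_upwards [ae_norm_ne_one, ae_ne_zero hd] with x h1 h2
  exact le_of_tendsto' (tendsto_field hd e h1 h2).norm fun n => norm_field_le hd n e x

theorem fderiv_prof_mul (n : ℕ) (x v w : E d) :
    fderiv ℝ (fun x => prof n x * inner ℝ x w) x v =
      prof n x * inner ℝ v w - profD n x * inner ℝ x v * inner ℝ x w := by
  have h1 : HasFDerivAt (fun x : E d => inner ℝ x w) ((innerSL ℝ).flip w) x :=
    ((innerSL ℝ).flip w).hasFDerivAt
  have h2 : HasFDerivAt (fun x => prof n x * inner ℝ x w) _ x := (hasFDerivAt_prof n x).mul h1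
  rw [h2.fderiv]
  simp only [add_apply, smul_apply, smul_eq_mul,
    ContinuousLinearMap.flip_apply, innerSL_apply_apply]
  ring

/-- As `prof n` is radial, the Jacobian of `x ↦ prof n x • x` is symmetric, so the gradient of its
`e`-component is also its derivative in the direction `e`. -/
theorem inner_field_eq_sum (n : ℕ) (e x ζ : E d) : inner ℝ (field n e x) ζ =
    ∑ i, fderiv ℝ (fun x => prof n x * inner ℝ x (EuclideanSpace.single i (1 : ℝ))) x e *
      inner ℝ ζ (EuclideanSpace.single i (1 : ℝ)) := by
  have hs (u : E d) : inner ℝ u ζ = ∑ i, u i * ζ i := by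
    simp [PiLp.inner_apply, mul_comm]
  simp_rw [fderiv_prof_mul, EuclideanSpace.inner_single_right]
  rw [field, inner_sub_left, real_inner_smul_left, real_inner_smul_left, hs e, hs x,
    Finset.mul_sum, Finset.mul_sum, ← Finset.sum_sub_distrib]
  refine Finset.sum_congr rfl fun i _ => ?_
  simp only [one_mul, conj_trivial]
  ring

theorem sum_fderiv_prof_mul (n : ℕ) (x : E d) :
    ∑ i, fderiv ℝ (fun x => prof n x * inner ℝ x (EuclideanSpace.single i (1 : ℝ))) x
      (EuclideanSpace.single i (1 : ℝ)) = d * prof n x - profD n x * ‖x‖ ^ 2 := by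
  simp_rw [fderiv_prof_mul, EuclideanSpace.inner_single_right]
  rw [Finset.sum_sub_distrib, EuclideanSpace.norm_sq_eq, Finset.mul_sum]
  congr 1
  · simp
  · refine Finset.sum_congr rfl fun i _ => ?_
    simp only [one_mul, conj_trivial, Real.norm_eq_abs, sq_abs]
    ring

theorem contDiff_prof_mul (n : ℕ) (w : E d) :
    ContDiff ℝ (⊤ : ℕ∞) fun x => prof n x * inner ℝ x w :=
  (contDiff_prof n).mul ((innerSL ℝ).flip w).contDiff

/-- Exchanging the two derivatives in each summand of `inner_field_eq_sum` turns the directional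
derivative of `prof n x • x` into its divergence. This replaces a surface integral over the sphere.
-/
theorem integral_inner_field {φ : E d → ℝ} (hφ : ContDiff ℝ (⊤ : ℕ∞) φ)
    (hc : HasCompactSupport φ) (n : ℕ) (e : E d) :
    ∫ x, inner ℝ (field n e x) (gradient φ x) =
      ∫ x, (d * prof n x - profD n x * ‖x‖ ^ 2) * inner ℝ e (gradient φ x) := by
  have hcont {ψ : E d → ℝ} (hψ : ContDiff ℝ (⊤ : ℕ∞) ψ) (v : E d) :
      Continuous fun x => fderiv ℝ ψ x v :=
    (hψ.continuous_fderiv (by simp)).clm_apply continuous_const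
  have hc1 (v : E d) : HasCompactSupport fun x => fderiv ℝ φ x v :=
    (hc.fderiv (𝕜 := ℝ)).comp_left (g := fun L : E d →L[ℝ] ℝ => L v) rfl
  have hint (i : Fin d) (v w : E d) : Integrable fun x =>
      fderiv ℝ (fun x => prof n x * inner ℝ x (EuclideanSpace.single i (1 : ℝ))) x v *
      fderiv ℝ φ x w :=
    ((hcont (contDiff_prof_mul n _) v).mul (hcont hφ w)).integrable_of_hasCompactSupport
      (hc1 w).mul_left
  simp_rw [inner_field_eq_sum, ← sum_fderiv_prof_mul, Finset.sum_mul, real_inner_comm _ e,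
    inner_gradient]
  rw [integral_finsetSum _ fun i _ => hint i _ _, integral_finsetSum _ fun i _ => hint i _ _]
  exact Finset.sum_congr rfl fun i _ =>
    integral_fderiv_mul_fderiv_comm (contDiff_prof_mul n _) hφ hc _ _

theorem majorant_le (x : E d) : majorant d x ≤ 2 ^ d := by
  unfold majorant
  refine mul_le_of_le_one_right (by positivity) (inv_le_one_of_one_le₀ (one_le_pow₀ ?_))
  linarith [norm_nonneg x]

/-- Dominated convergence in `integral_inner_field`. The divergence of `prof n x • x` tends to `d`
inside the ball and to zero outside, where the limit field `x / |x|^d` is divergence free. -/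
theorem integral_inner_field₀ (hd : 1 ≤ d) {φ : E d → ℝ} (hφ : ContDiff ℝ (⊤ : ℕ∞) φ)
    (hc : HasCompactSupport φ) (e : E d) :
    ∫ x, inner ℝ (field₀ e x) (gradient φ x) =
      d * ∫ x in Metric.ball (0 : E d) 1, inner ℝ e (gradient φ x) := by
  have hgc := continuous_gradient hφ
  have hgi : Integrable (fun x => ‖gradient φ x‖) :=
    hgc.norm.integrable_of_hasCompactSupport (hasCompactSupport_gradient hc).norm
  have l1 : Tendsto (fun n => ∫ x, inner ℝ (field n e x) (gradient φ x)) atTop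
      (𝓝 (∫ x, inner ℝ (field₀ e x) (gradient φ x))) := by
    refine tendsto_integral_of_dominated_convergence
      (fun x => (1 + d) * ‖e‖ * 2 ^ d * ‖gradient φ x‖)
      (fun n => ((continuous_field n e).inner hgc).aestronglyMeasurable) (hgi.const_mul _)
      (fun n => ae_of_all _ fun x => ?_) ?_
    · refine (norm_inner_le_norm _ _).trans ?_
      gcongr
      refine (norm_field_le hd n e x).trans ?_
      gcongr
      exact majorant_le x
    · filter_upwards [ae_norm_ne_one, ae_ne_zero hd] with x h1 h2
      exact (tendsto_field hd e h1 h2).inner tendsto_const_nhds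
  have l2 : Tendsto (fun n => ∫ x, (d * prof n x - profD n x * ‖x‖ ^ 2) *
      inner ℝ e (gradient φ x)) atTop
      (𝓝 (∫ x, (Metric.ball (0 : E d) 1).indicator
        (fun x => d * inner ℝ e (gradient φ x)) x)) := by
    refine tendsto_integral_of_dominated_convergence
      (fun x => d * 2 ^ d * (‖e‖ * ‖gradient φ x‖))
      (fun n => ?_) ((hgi.const_mul _).const_mul _) (fun n => ae_of_all _ fun x => ?_) ?_
    · have h1 := (contDiff_prof (d := d) n).continuous
      have h2 := continuous_profD (d := d) n
      exact Continuous.aestronglyMeasurable (by fun_prop)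
    · rw [norm_mul]
      have h1 : 0 ≤ d * prof n x - profD n x * ‖x‖ ^ 2 :=
        sub_nonneg.2 (profD_mul_norm_sq_le hd n x)
      rw [Real.norm_of_nonneg h1]
      have h2 : 0 ≤ profD n x * ‖x‖ ^ 2 := mul_nonneg (profD_nonneg _ _) (by positivity)
      have h3 : (d : ℝ) * prof n x ≤ d * 2 ^ d := by
        gcongr
        exact (prof_le_majorant n x).trans (majorant_le x)
      refine mul_le_mul (by linarith) (norm_inner_le_norm _ _) (norm_nonneg _) (by positivity)
    · filter_upwards [ae_norm_ne_one, ae_ne_zero hd] with x h1 h2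
      have h3 := (((tendsto_prof hd h1).const_mul (d : ℝ)).sub
        ((tendsto_profD hd h1 h2).mul_const (‖x‖ ^ 2))).mul_const (inner ℝ e (gradient φ x))
      convert h3 using 2
      have hn : ‖x‖ ^ 2 ≠ 0 := by positivity
      by_cases hx : ‖x‖ < 1
      · rw [Set.indicator_of_mem (by simpa using hx)]
        simp [prof₀, profD₀, hx]
      · rw [Set.indicator_of_notMem (by simpa using hx)]
        simp only [prof₀, profD₀, hx, if_false]
        rw [mul_assoc _ _ (‖x‖ ^ 2), inv_mul_cancel₀ hn]
        ring
  have := tendsto_nhds_unique (l1.congr fun n => integral_inner_field hφ hc n e) l2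
  rw [this, integral_indicator measurableSet_ball, integral_const_mul]

theorem memLp_majorant (hd : 1 ≤ d) : MemLp (majorant d) 2 (volume : Measure (E d)) := by
  have hm : Continuous (majorant d) := by
    unfold majorant
    refine continuous_const.mul (Continuous.inv₀ (by fun_prop) fun x => ?_)
    positivity
  exact (memLp_two_iff_integrable_sq hm.aestronglyMeasurable).2 (integrable_majorant_sq hd)

theorem memLp_field₀ (hd : 1 ≤ d) (e : E d) : MemLp (field₀ e) 2 volume := by
  refine (memLp_majorant hd).of_le_mul (c := (1 + d) * ‖e‖) (aestronglyMeasurable_field₀ hd e) ?_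
  filter_upwards [norm_field₀_le hd e] with x hx
  rwa [Real.norm_of_nonneg (majorant_nonneg x)]

/-- The transmission problem solved by the corrector. -/
theorem integral_coeff_mul_inner_field₀ (hd : 1 ≤ d) {φ : E d → ℝ} (hφ : ContDiff ℝ (⊤ : ℕ∞) φ)
    (hc : HasCompactSupport φ) (e : E d) (b s : ℝ) :
    ∫ x, (s + (Metric.ball (0 : E d) 1).indicator (fun _ => b - s) x) *
        inner ℝ (field₀ e x) (gradient φ x) =
      (b + s * (d - 1)) * ∫ x in Metric.ball (0 : E d) 1, inner ℝ e (gradient φ x) := by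
  have hi := integrable_inner_of_memLp (memLp_field₀ hd e) (memLp_gradient hφ hc 2 volume)
  have e1 (x : E d) : (s + (Metric.ball (0 : E d) 1).indicator (fun _ => b - s) x) *
        inner ℝ (field₀ e x) (gradient φ x) = s * inner ℝ (field₀ e x) (gradient φ x) +
        (Metric.ball (0 : E d) 1).indicator (fun x => (b - s) * inner ℝ e (gradient φ x)) x := by
    by_cases hx : x ∈ Metric.ball (0 : E d) 1
    · simp only [Set.indicator_of_mem hx, field₀_of_mem_ball e hx]
      ring
    · simp only [Set.indicator_of_notMem hx]
      ring
  have hi2 : Integrable ((Metric.ball (0 : E d) 1).indicator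
      fun x => (b - s) * inner ℝ e (gradient φ x)) := by
    refine IntegrableOn.integrable_indicator ?_ measurableSet_ball
    exact (((memLp_one_iff_integrable.1 (memLp_gradient hφ hc 1 volume)).const_inner e).const_mul
      (b - s)).integrableOn
  simp_rw [e1]
  rw [integral_add (hi.const_mul s) hi2, integral_const_mul, integral_inner_field₀ hd hφ hc,
    integral_indicator measurableSet_ball, integral_const_mul]
  ring

/-- The corrector is smoothed by `prof n` and cut off at distance of order `n`, with one index for
both. Only its gradient has to be approximated in `L²`; the potential itself need not be square
integrable. -/
theorem exists_test_approx (hd : 1 ≤ d) (e : E d) {ε : ℝ} (hε : 0 < ε) :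
    ∃ V : E d → ℝ, ContDiff ℝ (⊤ : ℕ∞) V ∧ HasCompactSupport V ∧
      nrm volume (fun x => gradient V x - field₀ e x) < ε := by
  let η : ContDiffBump (0 : E d) := ⟨1, 2, one_pos, one_lt_two⟩
  have hη : ContDiff ℝ (⊤ : ℕ∞) η := η.contDiff
  obtain ⟨C, hC⟩ := (hη.continuous_fderiv (by simp)).bounded_above_of_compact_support
    (η.hasCompactSupport.fderiv (𝕜 := ℝ))
  have hC0 : 0 ≤ C := (norm_nonneg _).trans (hC 0)
  let c (n : ℕ) : ℝ := ((n : ℝ) + 1)⁻¹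
  have hc (n : ℕ) : 0 < c n := by positivity
  let ηn (n : ℕ) (x : E d) : ℝ := η (c n • x)
  have hηn (n : ℕ) : ContDiff ℝ (⊤ : ℕ∞) (ηn n) := hη.comp (contDiff_const_smul (c n))
  let V (n : ℕ) (x : E d) : ℝ := ηn n x * (prof n x * inner ℝ x e)
  have hV (n : ℕ) : ContDiff ℝ (⊤ : ℕ∞) (V n) := (hηn n).mul (contDiff_prof_mul n e)
  have hcs (n : ℕ) : HasCompactSupport (V n) :=
    (η.hasCompactSupport.comp_smul (hc n).ne').mul_right
  have hgrad (n : ℕ) (x : E d) : gradient (V n) x =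
      ηn n x • field n e x + (prof n x * inner ℝ x e) • gradient (ηn n) x := by
    refine ext_inner_right ℝ fun v => ?_
    have h2 : HasFDerivAt (V n) _ x := ((hηn n).differentiable (by simp) x).hasFDerivAt.mul
      ((contDiff_prof_mul n e).differentiable (by simp) x).hasFDerivAt
    rw [inner_gradient, h2.fderiv, inner_add_left, real_inner_smul_left, real_inner_smul_left,
      inner_gradient]
    simp only [add_apply, smul_apply, smul_eq_mul, fderiv_prof_mul, field,
      inner_sub_left, real_inner_smul_left]
    rw [real_inner_comm e v]
    ring
  have hgη (n : ℕ) (x : E d) : ‖gradient (ηn n) x‖ = c n * ‖fderiv ℝ η (c n • x)‖ := by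
    rw [norm_gradient]
    have : fderiv ℝ (ηn n) x = c n • fderiv ℝ η (c n • x) := fderiv_comp_smul (c n)
    rw [this, norm_smul, Real.norm_of_nonneg (hc n).le]
  have hbound (n : ℕ) (x : E d) :
      ‖gradient (V n) x‖ ≤ ((1 + d) * ‖e‖ + 2 * C * ‖e‖) * majorant d x := by
    rw [hgrad]
    refine (norm_add_le _ _).trans ?_
    rw [add_mul]
    refine add_le_add ?_ ?_
    · rw [norm_smul, Real.norm_of_nonneg η.nonneg]
      exact (mul_le_of_le_one_left (norm_nonneg _) η.le_one).trans (norm_field_le hd n e x)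
    · rw [norm_smul, hgη, norm_mul, Real.norm_of_nonneg (prof_nonneg _ _)]
      -- On the support of the cutoff's gradient `c n * ‖x‖ ≤ 2`, which cancels the growth of `⟨x,
      -- e⟩` and leaves a multiple of the majorant.
      by_cases hx : ‖c n • x‖ ≤ 2
      · rw [norm_smul, Real.norm_of_nonneg (hc n).le] at hx
        calc prof n x * ‖inner ℝ x e‖ * (c n * ‖fderiv ℝ η (c n • x)‖)
            ≤ majorant d x * (‖x‖ * ‖e‖) * (c n * C) := by
              have h1 := majorant_nonneg x
              have h2 := (hc n).le
              have h3 := prof_le_majorant n x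
              have h4 := norm_inner_le_norm (𝕜 := ℝ) x e
              have h5 := hC (c n • x)
              gcongr
          _ = (c n * ‖x‖) * (C * ‖e‖ * majorant d x) := by ring
          _ ≤ 2 * (C * ‖e‖ * majorant d x) := by
              have := majorant_nonneg x
              gcongr
          _ = _ := by ring
      · have : fderiv ℝ η (c n • x) = 0 := by
          refine image_eq_zero_of_notMem_tsupport fun h => hx ?_
          have := tsupport_fderiv_subset ℝ h
          rw [η.tsupport_eq, mem_closedBall_zero_iff] at this
          exact this
        rw [this, norm_zero, mul_zero, mul_zero]
        have := majorant_nonneg x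
        positivity
  have hpt : ∀ᵐ x : E d, Tendsto (fun n => gradient (V n) x) atTop (𝓝 (field₀ e x)) := by
    filter_upwards [ae_norm_ne_one, ae_ne_zero hd] with x h1 h2
    refine (tendsto_field hd e h1 h2).congr' ?_
    have hev : ∀ᶠ n : ℕ in atTop, ‖c n • x‖ < 1 := by
      have : Tendsto (fun n => ‖c n • x‖) atTop (𝓝 0) := by
        have := ((tendsto_one_div_add_atTop_nhds_zero_nat (𝕜 := ℝ)).smul_const x).norm
        simpa [c] using this
      exact this.eventually_lt_const one_pos
    filter_upwards [hev] with n hn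
    have h3 : η =ᶠ[𝓝 (c n • x)] 1 :=
      η.eventuallyEq_one_of_mem_ball (by simpa [η] using hn)
    have h4 : fderiv ℝ η (c n • x) = 0 := by
      rw [h3.fderiv_eq]
      simp
    have h5 : gradient (ηn n) x = 0 := by
      rw [← norm_eq_zero, hgη, h4, norm_zero, mul_zero]
    have h6 : ηn n x = 1 := h3.eq_of_nhds
    rw [hgrad, h5, h6, smul_zero, add_zero, one_smul]
  set B := (1 + d) * ‖e‖ + 2 * C * ‖e‖
  have hB : 0 ≤ B := by positivity
  have hlim : Tendsto (fun n => ∫ x, ‖gradient (V n) x - field₀ e x‖ ^ 2) atTop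
      (𝓝 (∫ _ : E d, (0 : ℝ))) := by
    refine tendsto_integral_of_dominated_convergence (fun x => (2 * B) ^ 2 * majorant d x ^ 2)
      (fun n => ?_) ((integrable_majorant_sq hd).const_mul _) (fun n => ?_) ?_
    · exact (((continuous_gradient (hV n)).aestronglyMeasurable.sub
        (aestronglyMeasurable_field₀ hd e)).norm.pow 2)
    · filter_upwards [hpt] with x hx
      have h1 : ‖field₀ e x‖ ≤ B * majorant d x := le_of_tendsto' hx.norm fun n => hbound n x
      have h2 := norm_sub_le (gradient (V n) x) (field₀ e x)
      have h3 := hbound n x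
      rw [Real.norm_of_nonneg (by positivity), ← mul_pow]
      gcongr
      linarith
    · filter_upwards [hpt] with x hx
      have := ((hx.sub_const (field₀ e x)).norm).pow 2
      simpa using this
  have hl2 := hlim.sqrt
  rw [integral_zero, Real.sqrt_zero] at hl2
  obtain ⟨n, hn⟩ := (hl2.eventually_lt_const hε).exists
  exact ⟨V n, hV n, hcs n, hn⟩

end Corrector

/-! ### Rescaling to small balls. -/

section Scaling

variable {Ω : TopologicalSpace.Opens (E d)}

theorem integral_comp_rescale {F : Type*} [NormedAddCommGroup F] [NormedSpace ℝ F]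
    (f : E d → F) (x₀ : E d) {r : ℝ} (hr : 0 < r) :
    ∫ x, f (r⁻¹ • (x - x₀)) = r ^ d • ∫ x, f x := by
  rw [integral_sub_right_eq_self (fun x => f (r⁻¹ • x)) x₀,
    Measure.integral_comp_inv_smul_of_nonneg _ _ hr.le, finrank_euclideanSpace_fin]

theorem integrable_comp_rescale {f : E d → ℝ} (hf : Integrable f) (x₀ : E d) {r : ℝ}
    (hr : 0 < r) : Integrable fun x => f (r⁻¹ • (x - x₀)) :=
  (hf.comp_smul (inv_ne_zero hr.ne')).comp_sub_right x₀

theorem memLp_comp_rescale {f : E d → E d} (hm : Measurable f) (hf : MemLp f 2 volume) (x₀ : E d)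
    {r : ℝ} (hr : 0 < r) : MemLp (fun x => f (r⁻¹ • (x - x₀))) 2 volume := by
  refine (memLp_two_iff_integrable_sq_norm ?_).2
    (integrable_comp_rescale (integrable_norm_sq_of_memLp hf) x₀ hr)
  exact (hm.comp (by fun_prop)).aestronglyMeasurable

theorem nrm_comp_rescale (f : E d → E d) (x₀ : E d) {r : ℝ} (hr : 0 < r) :
    nrm volume (fun x => f (r⁻¹ • (x - x₀))) = rt d r * nrm volume f := by
  rw [nrm, integral_comp_rescale (fun x => ‖f x‖ ^ 2) x₀ hr, smul_eq_mul,
    Real.sqrt_mul (by positivity), rt, nrm]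

theorem measurable_field₀ (e : E d) : Measurable (field₀ e) := by
  have hs : MeasurableSet {x : E d | ‖x‖ < 1} := measurableSet_lt measurable_norm measurable_const
  have h1 : Measurable (prof₀ (d := d)) :=
    Measurable.ite hs measurable_const (by fun_prop)
  have h2 : Measurable (profD₀ (d := d)) :=
    Measurable.ite hs measurable_const (by fun_prop)
  unfold field₀
  fun_prop

theorem rescale_mem_ball (x x₀ : E d) {r : ℝ} (hr : 0 < r) :
    r⁻¹ • (x - x₀) ∈ Metric.ball (0 : E d) 1 ↔ x ∈ Metric.ball x₀ r := by
  rw [mem_ball_zero_iff, norm_smul, norm_inv, Real.norm_of_nonneg hr.le, inv_mul_lt_iff₀ hr,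
    mul_one, mem_ball_iff_norm]

theorem gradient_rescale {V : E d → ℝ} (hV : Differentiable ℝ V) (x₀ x : E d) {r : ℝ}
    (hr : 0 < r) :
    gradient (fun x => r * V (r⁻¹ • (x - x₀))) x = gradient V (r⁻¹ • (x - x₀)) := by
  refine ext_inner_right ℝ fun v => ?_
  have h1 : HasFDerivAt (fun x : E d => r⁻¹ • (x - x₀)) (r⁻¹ • ContinuousLinearMap.id ℝ (E d)) x :=
    ((hasFDerivAt_id x).sub_const x₀).const_smul r⁻¹
  have h2 : HasFDerivAt (fun x => r * V (r⁻¹ • (x - x₀))) _ x :=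
    ((hV _).hasFDerivAt.comp x h1).const_mul r
  rw [inner_gradient, inner_gradient, h2.fderiv]
  simp [hr.ne']

/-- The test function is `r * V ((x - x₀) / r)`; the prefactor `r` cancels the `r⁻¹` of the chain
rule. Its support lies in the ball of radius `M * r`, hence in `Ω` for small `r`. -/
theorem exists_test_rescale {V : E d → ℝ} (hV : ContDiff ℝ (⊤ : ℕ∞) V) (hc : HasCompactSupport V)
    {x₀ : E d} (hx₀ : x₀ ∈ (Ω : Set (E d))) : ∃ M : ℝ, 0 < M ∧
      (∀ x ∉ Metric.ball (0 : E d) M, gradient V x = 0) ∧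
      ∀ᶠ r : ℝ in 𝓝[>] 0, ∃ φ : TestFunction Ω ℝ (⊤ : ℕ∞),
        gradient φ = fun x => gradient V (r⁻¹ • (x - x₀)) := by
  obtain ⟨M, hM0, hM⟩ := hc.isBounded.subset_ball_lt 0 (0 : E d)
  refine ⟨M, hM0, fun x hx => ?_, ?_⟩
  · have : fderiv ℝ V x = 0 :=
      image_eq_zero_of_notMem_tsupport fun h => hx (hM (tsupport_fderiv_subset ℝ h))
    rw [gradient, this, map_zero]
  · obtain ⟨ε, hε, hball⟩ := Metric.isOpen_iff.1 Ω.isOpen x₀ hx₀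
    filter_upwards [Ioo_mem_nhdsGT (show 0 < ε / M by positivity)] with r hr
    have hrM : r * M < ε := (lt_div_iff₀ hM0).1 hr.2
    have hr0 : 0 < r := hr.1
    let T : E d ≃ₜ E d := (Homeomorph.subRight x₀).trans
      (Homeomorph.smulOfNeZero r⁻¹ (inv_ne_zero hr0.ne'))
    have hT (x : E d) : T x = r⁻¹ • (x - x₀) := rfl
    have hcd : ContDiff ℝ (⊤ : ℕ∞) fun x => r * V (r⁻¹ • (x - x₀)) :=
      contDiff_const.mul (hV.comp (by fun_prop))
    have hcs : HasCompactSupport fun x => r * V (r⁻¹ • (x - x₀)) :=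
      (hc.comp_homeomorph T).mul_left
    refine ⟨⟨fun x => r * V (r⁻¹ • (x - x₀)), hcd, hcs, ?_⟩, ?_⟩
    · intro x hx
      have h1 : x ∈ tsupport (V ∘ T) := tsupport_mul_subset_right hx
      rw [tsupport_comp_eq_preimage] at h1
      have h2 := hM h1
      rw [hT, mem_ball_zero_iff, norm_smul, norm_inv, Real.norm_of_nonneg hr0.le,
        inv_mul_lt_iff₀ hr0] at h2
      exact hball (mem_ball_iff_norm.2 (h2.trans hrM))
    · ext1 x
      exact gradient_rescale (hV.differentiable (by simp)) x₀ x hr0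

theorem MemH10.integral_inner_eq_zero {Z : E d → E d} (hZ : MemLp Z 2 (leb Ω))
    (h : ∀ φ : TestFunction Ω ℝ (⊤ : ℕ∞), ∫ x, inner ℝ (Z x) (gradient φ x) ∂(leb Ω) = 0)
    {u : E d → ℝ} {G : E d → E d} (hu : MemH10 Ω u G) :
    ∫ x, inner ℝ (Z x) (G x) ∂(leb Ω) = 0 := by
  obtain ⟨φ, -, h2⟩ := hu.exists_tendsto
  have h3 := h2.const_mul (nrm (leb Ω) Z)
  rw [mul_zero] at h3
  rw [← abs_eq_zero]
  refine le_antisymm (ge_of_tendsto' h3 fun n => ?_) (abs_nonneg _)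
  have hφ := TestFunction.memLp_gradient (φ n)
  refine le_trans (le_of_eq ?_) (abs_integral_inner_le hZ (hφ.sub hu.memLp_grad))
  simp only [inner_sub_right]
  rw [integral_sub (integrable_inner_of_memLp hZ hφ) (integrable_inner_of_memLp hZ hu.memLp_grad),
    h, zero_sub, abs_neg]

/-- The coefficient of the transmission problem: `b` on the ball and `s` outside. -/
def coeff (b s : ℝ) (x₀ : E d) (r : ℝ) (x : E d) : ℝ :=
  s + (Metric.ball x₀ r).indicator (fun _ => b - s) x

theorem norm_coeff_smul_le (b s : ℝ) (x₀ : E d) (r : ℝ) (H : E d → E d) (x : E d) :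
    ‖coeff b s x₀ r x • H x‖ ≤ (|s| + |b - s|) * ‖H x‖ := by
  rw [norm_smul]
  refine mul_le_mul_of_nonneg_right ?_ (norm_nonneg _)
  exact (norm_add_le _ _).trans (add_le_add le_rfl (norm_indicator_le_norm_self _ _))

theorem memLp_coeff_smul (b s : ℝ) (x₀ : E d) (r : ℝ) {H : E d → E d} {μ : Measure (E d)}
    (hH : MemLp H 2 μ) : MemLp (fun x => coeff b s x₀ r x • H x) 2 μ := by
  have hm : Measurable (coeff b s x₀ r) :=
    measurable_const.add (measurable_const.indicator measurableSet_ball)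
  exact hH.of_le_mul (hm.aestronglyMeasurable.smul hH.1)
    (ae_of_all _ (norm_coeff_smul_le b s x₀ r H))

/-- The rescaled corrector solves the rescaled transmission problem, tested in `H¹₀(Ω)`. -/
theorem MemH10.integral_corrector (hd : 1 ≤ d) {u : E d → ℝ} {G : E d → E d} (hu : MemH10 Ω u G)
    (x₀ e : E d) {r : ℝ} (hr : 0 < r) (b s : ℝ) :
    ∫ x, inner ℝ (coeff b s x₀ r x • field₀ e (r⁻¹ • (x - x₀))) (G x) ∂(leb Ω) =
      (b + s * (d - 1)) * ∫ x, inner ℝ e (G x) ∂(ballLeb Ω x₀ r) := by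
  set κ := b + s * ((d : ℝ) - 1)
  let A : E d → ℝ := coeff b s x₀ r
  let Fr (x : E d) : E d := field₀ e (r⁻¹ • (x - x₀))
  let I (x : E d) : E d := (Metric.ball x₀ r).indicator (fun _ => e) x
  have hFr : MemLp Fr 2 (leb Ω) :=
    (memLp_comp_rescale (measurable_field₀ e) (memLp_field₀ hd e) x₀ hr).restrict _
  have hAF : MemLp (fun x => A x • Fr x) 2 (leb Ω) := memLp_coeff_smul b s x₀ r hFr
  have hI : MemLp I 2 (leb Ω) := by
    refine memLp_indicator_const 2 measurableSet_ball e (Or.inr ?_)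
    exact ((Measure.restrict_apply_le _ _).trans_lt measure_ball_lt_top).ne
  have hIint (H : E d → E d) : ∫ x, inner ℝ (I x) (H x) ∂(leb Ω) =
      ∫ x, inner ℝ e (H x) ∂(ballLeb Ω x₀ r) := by
    rw [ballLeb, ← integral_indicator measurableSet_ball]
    refine integral_congr_ae (ae_of_all _ fun x => ?_)
    by_cases hx : x ∈ Metric.ball x₀ r
    · simp only [I, Set.indicator_of_mem hx]
    · simp only [I, Set.indicator_of_notMem hx, inner_zero_left]
  have hsplit {H : E d → E d} (hH : MemLp H 2 (leb Ω)) :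
      ∫ x, inner ℝ (A x • Fr x - κ • I x) (H x) ∂(leb Ω) =
        ∫ x, inner ℝ (A x • Fr x) (H x) ∂(leb Ω) -
          κ * ∫ x, inner ℝ e (H x) ∂(ballLeb Ω x₀ r) := by
    have e (x : E d) : inner ℝ (A x • Fr x - κ • I x) (H x) =
        inner ℝ (A x • Fr x) (H x) - κ * inner ℝ (I x) (H x) := by
      rw [inner_sub_left, real_inner_smul_left (I x)]
    simp_rw [e]
    rw [integral_sub (integrable_inner_of_memLp hAF hH)
      ((integrable_inner_of_memLp hI hH).const_mul κ), integral_const_mul, hIint]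
  have key := MemH10.integral_inner_eq_zero (Z := fun x => A x • Fr x - κ • I x)
    (hAF.sub (hI.const_smul κ)) (fun φ => ?_) hu
  · rw [hsplit hu.memLp_grad] at key
    exact sub_eq_zero.1 key
  · rw [hsplit (TestFunction.memLp_gradient φ), sub_eq_zero]
    -- This is `r⁻¹ φ(x₀ + r ξ)`, written as a rescaling with centre `-x₀/r` and radius `1/r` so
    -- that `gradient_rescale` applies.
    let ψ (ξ : E d) : ℝ := r⁻¹ * φ (r⁻¹⁻¹ • (ξ - (-(r⁻¹ • x₀))))
    have hψc : ContDiff ℝ (⊤ : ℕ∞) ψ := contDiff_const.mul (φ.contDiff.comp (by fun_prop))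
    have hψs : HasCompactSupport ψ := by
      refine HasCompactSupport.mul_left (f := fun _ => r⁻¹) ?_
      exact φ.hasCompactSupport.comp_homeomorph ((Homeomorph.subRight (-(r⁻¹ • x₀))).trans
        (Homeomorph.smulOfNeZero r⁻¹⁻¹ (inv_ne_zero (inv_ne_zero hr.ne'))))
    have hψg (x : E d) : gradient ψ (r⁻¹ • (x - x₀)) = gradient φ x := by
      have := gradient_rescale (TestFunction.differentiable φ) (-(r⁻¹ • x₀)) (r⁻¹ • (x - x₀))
        (inv_pos.2 hr)
      refine this.trans ?_
      congr 1
      rw [inv_inv, sub_neg_eq_add, smul_sub, sub_add_cancel, smul_smul, mul_inv_cancel₀ hr.ne',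
        one_smul]
    have h1 := integral_coeff_mul_inner_field₀ hd hψc hψs e b s
    have h2 := congrArg (fun t => r ^ d • t) h1
    rw [← integral_comp_rescale _ x₀ hr, smul_eq_mul, mul_left_comm,
      ← integral_indicator measurableSet_ball, ← smul_eq_mul (r ^ d),
      ← integral_comp_rescale _ x₀ hr] at h2
    have hz (x : E d) (hx : x ∉ (Ω : Set (E d))) : gradient φ x = 0 :=
      TestFunction.gradient_eq_zero φ hx
    rw [← hIint, setIntegral_leb_of_support _ fun x hx => by rw [hz x hx, inner_zero_right],
      setIntegral_leb_of_support _ fun x hx => by rw [hz x hx, inner_zero_right]]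
    refine Eq.trans (integral_congr_ae (ae_of_all _ fun x => ?_)) (h2.trans ?_)
    · simp only [hψg, A, Fr, coeff, real_inner_smul_left]
      congr 2
      by_cases hx : x ∈ Metric.ball x₀ r
      · rw [Set.indicator_of_mem hx, Set.indicator_of_mem ((rescale_mem_ball x x₀ hr).2 hx)]
      · rw [Set.indicator_of_notMem hx,
          Set.indicator_of_notMem fun h => hx ((rescale_mem_ball x x₀ hr).1 h)]
    · congr 1
      refine integral_congr_ae (ae_of_all _ fun x => ?_)
      by_cases hx : x ∈ Metric.ball x₀ r
      · simp only [I, Set.indicator_of_mem hx]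
        rw [Set.indicator_of_mem ((rescale_mem_ball x x₀ hr).2 hx), hψg]
      · simp only [I, Set.indicator_of_notMem hx, inner_zero_left]
        rw [Set.indicator_of_notMem fun h => hx ((rescale_mem_ball x x₀ hr).1 h)]

end Scaling

/-! ### Equations and energy bounds for the perturbed state. -/

section Perturbation

variable {Ω : TopologicalSpace.Opens (E d)}

theorem image_unitBall (x₀ : E d) {r : ℝ} (hr : 0 < r) :
    (fun x' => x₀ + r • x') '' Metric.ball (0 : E d) 1 = Metric.ball x₀ r := by
  ext x
  constructor
  · rintro ⟨ξ, hξ, rfl⟩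
    rw [← rescale_mem_ball _ _ hr]
    simpa [smul_smul, hr.ne'] using hξ
  · intro hx
    refine ⟨r⁻¹ • (x - x₀), (rescale_mem_ball _ _ hr).2 hx, ?_⟩
    simp [smul_smul, hr.ne']

theorem perturb_of_mem (a : E d → Mat d) (B : Mat d) {x₀ x : E d} {r : ℝ} (hr : 0 < r)
    (hx : x ∈ Metric.ball x₀ r) : perturb a B x₀ (Metric.ball 0 1) r x = B := by
  rw [perturb, image_unitBall x₀ hr, Set.indicator_of_mem hx, add_sub_cancel]

theorem perturb_of_notMem (a : E d → Mat d) (B : Mat d) {x₀ x : E d} {r : ℝ} (hr : 0 < r)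
    (hx : x ∉ Metric.ball x₀ r) : perturb a B x₀ (Metric.ball 0 1) r x = a x := by
  rw [perturb, image_unitBall x₀ hr, Set.indicator_of_notMem hx, add_zero]

theorem IsAdmissible.perturb {α : ℝ} {a : E d → Mat d} (ha : IsAdmissible Ω α a) {B : Mat d}
    (hB : B ∈ ellipticMatrices d α) (x₀ : E d) {r : ℝ} (hr : 0 < r) :
    IsAdmissible Ω α (perturb a B x₀ (Metric.ball 0 1) r) := by
  constructor
  · intro i j
    have h : (fun x => TopDeriv.perturb a B x₀ (Metric.ball 0 1) r x i j) = fun x =>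
        a x i j + (Metric.ball x₀ r).indicator (fun z => B i j - a z i j) x := by
      ext1 x
      by_cases hx : x ∈ Metric.ball x₀ r
      · rw [perturb_of_mem a B hr hx, Set.indicator_of_mem hx, add_sub_cancel]
      · rw [perturb_of_notMem a B hr hx, Set.indicator_of_notMem hx, add_zero]
    rw [h]
    exact (ha.memLp i j).add (((memLp_top_const (B i j)).sub (ha.memLp i j)).indicator
      measurableSet_ball)
  · filter_upwards [ha.elliptic] with x hx
    by_cases hxb : x ∈ Metric.ball x₀ r
    · rwa [perturb_of_mem a B hr hxb]
    · rwa [perturb_of_notMem a B hr hxb]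

variable {a : E d → Mat d} {B : Mat d} {C C' α : ℝ} {x₀ : E d} {r : ℝ}

theorem energyForm_perturb (ha : IsBdd (leb Ω) a C) (hD : IsBdd (leb Ω) (fun x => B - a x) C')
    (hr : 0 < r) {G H : E d → E d} (hG : MemLp G 2 (leb Ω)) (hH : MemLp H 2 (leb Ω)) :
    energyForm Ω (perturb a B x₀ (Metric.ball 0 1) r) G H = energyForm Ω a G H +
      ∫ x, inner ℝ (act (fun x => B - a x) G x) (H x) ∂(ballLeb Ω x₀ r) := by
  have h1 := integrable_inner_of_memLp (ha.memLp_act hG) hH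
  have h2 := integrable_inner_of_memLp (hD.memLp_act hG) hH
  rw [ballLeb, ← integral_indicator measurableSet_ball]
  refine Eq.trans (integral_congr_ae (ae_of_all _ fun x => ?_))
    (integral_add h1 (h2.indicator measurableSet_ball))
  by_cases hx : x ∈ Metric.ball x₀ r
  · simp only [perturb_of_mem a B hr hx, Set.indicator_of_mem hx, act_apply]
    rw [← inner_add_left, ← LinearMap.add_apply, ← map_add, add_sub_cancel]
  · simp only [perturb_of_notMem a B hr hx, Set.indicator_of_notMem hx, act_apply, add_zero]

variable {f y y' : E d → ℝ} {Gy G' : E d → E d}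

/-- The equation satisfied by the difference of the perturbed and the unperturbed state. -/
theorem energyForm_perturb_sub (ha : IsAdmissible Ω α a) (hB : B ∈ ellipticMatrices d α)
    (hr : 0 < r) (hy : IsState Ω f a y Gy)
    (hy' : IsState Ω f (perturb a B x₀ (Metric.ball 0 1) r) y' G') {v : E d → ℝ} {Gv : E d → E d}
    (hv : MemH10 Ω v Gv) :
    energyForm Ω (perturb a B x₀ (Metric.ball 0 1) r) (fun x => G' x - Gy x) Gv =
      - ∫ x, inner ℝ (act (fun x => B - a x) Gy x) (Gv x) ∂(ballLeb Ω x₀ r) := by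
  obtain ⟨C, hC⟩ := ha.exists_isBdd
  obtain ⟨C', hC'⟩ := hC.const_sub B
  obtain ⟨C'', hC''⟩ := (ha.perturb hB x₀ hr).exists_isBdd
  rw [energyForm_sub_left hC'' hy'.1.memLp_grad hy.1.memLp_grad hv.memLp_grad, hy'.2 _ _ hv,
    energyForm_perturb hC hC' hr hy.1.memLp_grad hv.memLp_grad, hy.2 _ _ hv]
  ring

/-- The difference is tested in its own equation: coercivity bounds the left side below,
Cauchy–Schwarz on the ball bounds the right side, and one factor is divided out. -/
theorem nrm_grad_sub_le (hα : 0 < α) (ha : IsAdmissible Ω α a) (hB : B ∈ ellipticMatrices d α)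
    (hr : 0 < r) (hy : IsState Ω f a y Gy)
    (hy' : IsState Ω f (perturb a B x₀ (Metric.ball 0 1) r) y' G') :
    nrm (leb Ω) (fun x => G' x - Gy x) ≤
      α⁻¹ * nrm (ballLeb Ω x₀ r) (act (fun x => B - a x) Gy) := by
  obtain ⟨C, hC⟩ := ha.exists_isBdd
  obtain ⟨C', hC'⟩ := hC.const_sub B
  have hs := hy'.1.sub hy.1
  have h1 := (ha.perturb hB x₀ hr).coercive hs.memLp_grad
  rw [energyForm_perturb_sub ha hB hr hy hy' hs] at h1
  have h2 := neg_le_of_abs_le (abs_integral_inner_le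
    ((hC'.memLp_act hy.1.memLp_grad).mono_measure (ballLeb_le x₀ r))
    (hs.memLp_grad.mono_measure (ballLeb_le x₀ r)))
  have h3 := mul_le_mul_of_nonneg_left (nrm_mono_measure (ballLeb_le x₀ r) hs.memLp_grad)
    (nrm_nonneg (μ := ballLeb Ω x₀ r) (act (fun x => B - a x) Gy))
  rw [le_inv_mul_iff₀ hα]
  rcases (nrm_nonneg (μ := leb Ω) (fun x => G' x - Gy x)).eq_or_lt with h | h
  · rw [← h, mul_zero]
    exact nrm_nonneg _
  · refine le_of_mul_le_mul_right ?_ h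
    linarith

/-- Duality between the perturbation of the state and an adjoint problem. -/
theorem integral_mul_sub_eq (ha : IsAdmissible Ω α a)
    (hr : 0 < r) (hy : IsState Ω f a y Gy)
    (hy' : IsState Ω f (perturb a B x₀ (Metric.ball 0 1) r) y' G') {g z : E d → ℝ}
    {Gz : E d → E d} (hz : MemH10 Ω z Gz)
    (hza : ∀ v Gv, MemH10 Ω v Gv → energyForm Ω a Gv Gz = ∫ x, g x * v x ∂(leb Ω)) :
    ∫ x, g x * (y' x - y x) ∂(leb Ω) =
      - ∫ x, inner ℝ (act (fun x => B - a x) G' x) (Gz x) ∂(ballLeb Ω x₀ r) := by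
  obtain ⟨C, hC⟩ := ha.exists_isBdd
  obtain ⟨C', hC'⟩ := hC.const_sub B
  have h1 := hy'.2 _ _ hz
  rw [energyForm_perturb hC hC' hr hy'.1.memLp_grad hz.memLp_grad] at h1
  rw [← hza _ _ (hy'.1.sub hy.1),
    energyForm_sub_left hC hy'.1.memLp_grad hy.1.memLp_grad hz.memLp_grad, hy.2 _ _ hz]
  linarith

end Perturbation

/-! ### Orders of magnitude of the state perturbation. -/

section Asymptotics

variable {Ω : TopologicalSpace.Opens (E d)} {a : E d → Mat d} {B : Mat d} {α : ℝ} {x₀ : E d}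
  {f y : E d → ℝ} {Gy : E d → E d}

theorem act_sub_right (A : E d → Mat d) (G H : E d → E d) :
    act A (fun x => G x - H x) = fun x => act A G x - act A H x := by
  ext1 x
  simp only [act_apply, map_sub]

theorem IsBdd.mono_ball {A : E d → Mat d} {C : ℝ} (h : IsBdd (leb Ω) A C) (x₀ : E d) (r : ℝ) :
    IsBdd (ballLeb Ω x₀ r) A C := h.restrict _

theorem tendsto_nrm_ballLeb (hd : 1 ≤ d) {H : Type*} [NormedAddCommGroup H]
    [InnerProductSpace ℝ H] {G : E d → H} (hG : MemLp G 2 (leb Ω)) (x₀ : E d) :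
    Tendsto (fun r : ℝ => nrm (ballLeb Ω x₀ r) G) (𝓝[>] 0) (𝓝 0) := by
  have h1 : Tendsto (leb Ω ∘ fun r : ℝ => Metric.ball x₀ r) (𝓝[>] 0) (𝓝 0) := by
    have h2 : Tendsto (fun r : ℝ => ENNReal.ofReal
        (r ^ d * volume.real (Metric.ball (0 : E d) 1))) (𝓝[>] 0) (𝓝 0) := by
      have h3 : Tendsto (fun r : ℝ => ENNReal.ofReal
          (r ^ d * volume.real (Metric.ball (0 : E d) 1))) (𝓝 0) (𝓝 (ENNReal.ofReal
          (0 ^ d * volume.real (Metric.ball (0 : E d) 1)))) :=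
        Continuous.tendsto (ENNReal.continuous_ofReal.comp (by fun_prop)) 0
      rw [zero_pow (by omega), zero_mul, ENNReal.ofReal_zero] at h3
      exact h3.mono_left nhdsWithin_le_nhds
    refine tendsto_of_tendsto_of_tendsto_of_le_of_le' tendsto_const_nhds h2
      (Eventually.of_forall fun _ => zero_le) ?_
    filter_upwards [self_mem_nhdsWithin] with r hr
    have h4 := volumeReal_ballLeb_le (Ω := Ω) x₀ (show 0 < r from hr)
    rw [ballLeb, measureReal_restrict_apply_univ] at h4
    have hfin : leb Ω (Metric.ball x₀ r) ≠ ⊤ :=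
      ((Measure.restrict_apply_le _ _).trans_lt measure_ball_lt_top).ne
    rw [Function.comp_apply, ← ofReal_measureReal hfin]
    exact ENNReal.ofReal_le_ofReal h4
  have h5 := ((integrable_norm_sq_of_memLp hG).tendsto_setIntegral_nhds_zero h1).sqrt
  rw [Real.sqrt_zero] at h5
  exact h5

/-- Hypotheses on a family of perturbed states around the point `x₀`. -/
structure PerturbedFamily (Ω : TopologicalSpace.Opens (E d)) (α : ℝ) (a : E d → Mat d) (B : Mat d)
    (x₀ : E d) (f y : E d → ℝ) (Gy : E d → E d) (yr : ℝ → E d → ℝ) (Gr : ℝ → E d → E d) :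
    Prop where
  pos : 0 < α
  bounded : Bornology.IsBounded (Ω : Set (E d))
  mem : x₀ ∈ (Ω : Set (E d))
  adm : IsAdmissible Ω α a
  ell : B ∈ ellipticMatrices d α
  state : IsState Ω f a y Gy
  -- Required for all real `r`, because `tendsto_nrm_zero_of_weak` asks for membership at every
  -- index; for `r ≤ 0` any element serves.
  memH10 : ∀ r, MemH10 Ω (yr r) (Gr r)
  pstate : ∀ r, 0 < r → IsState Ω f (perturb a B x₀ (Metric.ball 0 1) r) (yr r) (Gr r)
  lebPoint : IsLebPoint Ω (act (fun x => B - a x) Gy) x₀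

namespace PerturbedFamily

variable {yr : ℝ → E d → ℝ} {Gr : ℝ → E d → E d}

theorem exists_grad_bound (h : PerturbedFamily Ω α a B x₀ f y Gy yr Gr) :
    ∃ K, 0 ≤ K ∧ ∀ᶠ r : ℝ in 𝓝[>] 0,
      nrm (leb Ω) (fun x => Gr r x - Gy x) ≤ K * rt d r := by
  obtain ⟨C, hC⟩ := h.adm.exists_isBdd
  obtain ⟨C', hC'⟩ := hC.const_sub B
  have := isFiniteMeasure_leb h.bounded
  obtain ⟨K, hK, hb⟩ := h.lebPoint.exists_nrm_le (hC'.memLp_act h.state.1.memLp_grad)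
  refine ⟨α⁻¹ * K, mul_nonneg (inv_nonneg.2 h.pos.le) hK, ?_⟩
  filter_upwards [hb, self_mem_nhdsWithin] with r h1 hr
  refine (nrm_grad_sub_le h.pos h.adm h.ell hr h.state (h.pstate r hr)).trans ?_
  rw [mul_assoc]
  exact mul_le_mul_of_nonneg_left h1 (inv_nonneg.2 h.pos.le)

/-- The perturbation of the state is of higher order in `L²`. -/
theorem tendsto_nrm_sub (hd : 1 ≤ d) (h : PerturbedFamily Ω α a B x₀ f y Gy yr Gr) :
    Tendsto (fun r : ℝ => nrm (leb Ω) (fun x => yr r x - y x) / rt d r) (𝓝[>] 0) (𝓝 0) := by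
  obtain ⟨C, hC⟩ := h.adm.exists_isBdd
  obtain ⟨C', hC'⟩ := hC.const_sub B
  have := isFiniteMeasure_leb h.bounded
  obtain ⟨P, hP⟩ := exists_poincareConst hd h.bounded
  obtain ⟨K, hK, hb⟩ := h.exists_grad_bound
  obtain ⟨Q, hQ, hbQ⟩ := h.lebPoint.exists_nrm_le (hC'.memLp_act h.state.1.memLp_grad)
  have key := tendsto_nrm_zero_of_weak hP h.bounded (l := 𝓝[>] (0 : ℝ))
    (u := fun r x => (rt d r)⁻¹ * (yr r x - y x))
    (G := fun r x => (rt d r)⁻¹ • (Gr r x - Gy x))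
    (fun r => ((h.memH10 r).sub h.state.1).const_smul _) (C := K) ?_ ?_
  · refine key.congr' ?_
    filter_upwards [self_mem_nhdsWithin] with r hr
    have h1 := nrm_smul (μ := leb Ω) (rt d r)⁻¹ (fun x => yr r x - y x)
    simp only [smul_eq_mul] at h1
    rw [h1, abs_of_nonneg (inv_nonneg.2 (rt_pos hr).le), inv_mul_eq_div]
  · filter_upwards [hb, self_mem_nhdsWithin] with r h1 hr
    rw [nrm_smul, abs_of_nonneg (inv_nonneg.2 (rt_pos hr).le), inv_mul_le_iff₀ (rt_pos hr),
      mul_comm]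
    exact h1
  -- For weak convergence, `g` is taken as right side of an adjoint problem with solution `z`.
  -- Duality bounds the pairing by a constant times the `L²` norm of `∇z` on the shrinking ball.
  · intro g hg
    obtain ⟨z, Gz, hz, hza⟩ := h.adm.transpose.exists_isState h.pos hP hg
    have hza' : ∀ v Gv, MemH10 Ω v Gv → energyForm Ω a Gv Gz = ∫ x, g x * v x ∂(leb Ω) :=
      fun v Gv hv => by rw [← energyForm_transpose, hza v Gv hv]
    have hlim := (tendsto_nrm_ballLeb hd hz.memLp_grad x₀).const_mul (Q + C' * K)
    rw [mul_zero] at hlim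
    rw [tendsto_zero_iff_abs_tendsto_zero]
    refine tendsto_of_tendsto_of_tendsto_of_le_of_le' tendsto_const_nhds hlim
      (Eventually.of_forall fun _ => abs_nonneg _) ?_
    filter_upwards [hb, hbQ, self_mem_nhdsWithin] with r h1 h2 hr
    have hρ := rt_pos (d := d) (show 0 < r from hr)
    have e1 : ∫ x, (rt d r)⁻¹ * (yr r x - y x) * g x ∂(leb Ω) =
        (rt d r)⁻¹ * ∫ x, g x * (yr r x - y x) ∂(leb Ω) := by
      rw [← integral_const_mul]
      congr 1
      ext1 x
      ring
    rw [Function.comp_apply, e1,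
      integral_mul_sub_eq h.adm hr h.state (h.pstate r hr) hz hza', abs_mul, abs_neg,
      abs_of_nonneg (inv_nonneg.2 hρ.le), inv_mul_le_iff₀ hρ]
    have hs := ((h.memH10 r).sub h.state.1).memLp_grad
    have m1 := (hC'.memLp_act h.state.1.memLp_grad).mono_measure (ballLeb_le x₀ r)
    have m2 := (hC'.memLp_act hs).mono_measure (ballLeb_le x₀ r)
    have m3 := (hC'.memLp_act (h.memH10 r).memLp_grad).mono_measure (ballLeb_le x₀ r)
    have h3 := abs_integral_inner_le m3 (hz.memLp_grad.mono_measure (ballLeb_le x₀ r))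
    have h4 : nrm (ballLeb Ω x₀ r) (act (fun x => B - a x) (Gr r)) ≤ (Q + C' * K) * rt d r := by
      have h5 := nrm_add_le m1 m2
      have h6 := (hC'.mono_ball x₀ r).nrm_act_le (hs.mono_measure (ballLeb_le x₀ r))
      have h7 := nrm_mono_measure (ballLeb_le x₀ r) hs
      have h8 := mul_le_mul_of_nonneg_left (h7.trans h1) hC'.nonneg
      rw [act_sub_right] at h5 h6
      simp only [add_sub_cancel] at h5
      linarith
    refine h3.trans ((mul_le_mul_of_nonneg_right h4 (nrm_nonneg _)).trans_eq ?_)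
    ring

end PerturbedFamily

end Asymptotics

/-! ### The polarization estimate at fixed radius. -/

section Polarization

variable {Ω : TopologicalSpace.Opens (E d)}

/-- The entries of a matrix field as a vector field. -/
def entries (a : E d → Mat d) (x : E d) : EuclideanSpace ℝ (Fin d × Fin d) :=
  WithLp.toLp 2 fun p => a x p.1 p.2

theorem norm_entries_sub_sq (a : E d → Mat d) (x x' : E d) :
    ‖entries a x - entries a x'‖ ^ 2 = ∑ i, ∑ j, (a x - a x') i j ^ 2 := by
  rw [EuclideanSpace.norm_sq_eq, Fintype.sum_prod_type]
  simp [entries]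

theorem IsBdd.memLp_entries [IsFiniteMeasure (leb Ω)] {a : E d → Mat d} {C : ℝ}
    (h : IsBdd (leb Ω) a C) : MemLp (entries a) 2 (leb Ω) := by
  have hm : AEMeasurable (fun x (p : Fin d × Fin d) => a x p.1 p.2) (leb Ω) :=
    aemeasurable_pi_lambda _ fun p => (h.meas p.1 p.2).aemeasurable
  refine MemLp.of_bound ((by fun_prop : Measurable (WithLp.toLp 2 :
    (Fin d × Fin d → ℝ) → _)).comp_aemeasurable hm).aestronglyMeasurable C ?_
  filter_upwards [h.bound] with x hx
  refine abs_le_of_sq_le_sq' ?_ h.nonneg |>.2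
  have : ‖entries a x‖ ^ 2 = ∑ i, ∑ j, a x i j ^ 2 := by
    rw [EuclideanSpace.norm_sq_eq, Fintype.sum_prod_type]
    simp [entries]
  exact this.trans_le hx

theorem norm_transpose_sub_le (a : E d → Mat d) (x x' ξ : E d) :
    ‖Matrix.toEuclideanLin (a x - a x').transpose ξ‖ ≤ ‖entries a x - entries a x'‖ * ‖ξ‖ := by
  refine abs_le_of_sq_le_sq' ?_ (by positivity) |>.2
  rw [mul_pow, norm_entries_sub_sq, Finset.sum_comm]
  exact norm_sq_toEuclideanLin_le _ _

theorem nrm_le_of_indicator {H : Type*} [NormedAddCommGroup H] [InnerProductSpace ℝ H]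
    {R : E d → E d} {Z : E d → H} (hZ : MemLp Z 2 (leb Ω)) {L : ℝ} (hL : 0 ≤ L) {x₀ : E d} {r : ℝ}
    (h : ∀ x, ‖R x‖ ≤ L * (Metric.ball x₀ r).indicator (fun x => ‖Z x‖) x) :
    nrm (leb Ω) R ≤ L * nrm (ballLeb Ω x₀ r) Z := by
  have e : nrm (ballLeb Ω x₀ r) Z = nrm (leb Ω) ((Metric.ball x₀ r).indicator Z) := by
    rw [nrm, nrm, ballLeb, ← integral_indicator measurableSet_ball]
    congr 2
    ext1 x
    by_cases hx : x ∈ Metric.ball x₀ r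
    · simp only [Set.indicator_of_mem hx]
    · simp [Set.indicator_of_notMem hx]
  rw [e]
  nth_rw 1 [← abs_of_nonneg hL]
  rw [← nrm_smul]
  refine nrm_mono_of_ae_le ((hZ.indicator measurableSet_ball).const_smul L)
    (ae_of_all _ fun x => (h x).trans_eq ?_)
  rw [norm_smul, Real.norm_of_nonneg hL, norm_indicator_eq_indicator_norm]

theorem volumeReal_ballLeb {x₀ : E d} {r : ℝ} (hr : 0 < r)
    (h : Metric.ball x₀ r ⊆ (Ω : Set (E d))) :
    (ballLeb Ω x₀ r).real Set.univ = r ^ d * volume.real (Metric.ball (0 : E d) 1) := by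
  rw [ballLeb, measureReal_restrict_apply_univ, leb, measureReal_restrict_apply measurableSet_ball,
    Set.inter_eq_self_of_subset_left h, measureReal_def, Measure.addHaar_ball_of_pos _ _ hr]
  simp [hr.le, measureReal_def]

theorem eventually_ball_subset {x₀ : E d} (h : x₀ ∈ (Ω : Set (E d))) :
    ∀ᶠ r : ℝ in 𝓝[>] 0, Metric.ball x₀ r ⊆ (Ω : Set (E d)) := by
  obtain ⟨ε, hε, hb⟩ := Metric.isOpen_iff.1 Ω.isOpen x₀ h
  filter_upwards [Ioo_mem_nhdsGT hε] with r hr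
  exact (Metric.ball_subset_ball hr.2.le).trans hb

variable {a : E d → Mat d} {α b s : ℝ} {x₀ : E d} {f y : E d → ℝ} {Gy : E d → E d}
  {yr : ℝ → E d → ℝ} {Gr : ℝ → E d → E d}

/-- The localized equation tested with an approximation `φ` of the rescaled corrector. -/
theorem PerturbedFamily.abs_integral_inner_add_le (hd : 1 ≤ d)
    (h : PerturbedFamily Ω α a (b • 1) x₀ f y Gy yr Gr) (hs : a x₀ = s • 1) (e : E d)
    {r M L ε : ℝ} (hr : 0 < r) (hsub : Metric.ball x₀ r ⊆ (Ω : Set (E d))) (hL : 0 ≤ L)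
    {V : E d → ℝ} (hV : ContDiff ℝ (⊤ : ℕ∞) V) (hVc : HasCompactSupport V)
    (hVL : ∀ x, ‖gradient V x‖ ≤ L)
    (hVM : ∀ x ∉ Metric.ball (0 : E d) M, gradient V x = 0)
    (hVε : nrm volume (fun x => gradient V x - field₀ e x) ≤ ε) (φ : TestFunction Ω ℝ (⊤ : ℕ∞))
    (hφ : gradient φ = fun x => gradient V (r⁻¹ • (x - x₀))) :
    |(b + s * (d - 1)) * ∫ x, inner ℝ e (Gr r x - Gy x) ∂(ballLeb Ω x₀ r) +
      inner ℝ (act (fun x => b • 1 - a x) Gy x₀) e *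
        (r ^ d * volume.real (Metric.ball (0 : E d) 1))| ≤
      (|s| + |b - s|) * (rt d r * ε) * nrm (leb Ω) (fun x => Gr r x - Gy x) +
      L * nrm (ballLeb Ω x₀ (M * r)) (fun x => entries a x - entries a x₀) *
        nrm (leb Ω) (fun x => Gr r x - Gy x) +
      nrm (ballLeb Ω x₀ r) (fun x => act (fun x => b • 1 - a x) Gy x -
        act (fun x => b • 1 - a x) Gy x₀) * (rt d r * nrm volume (gradient V)) +
      √(volume.real (Metric.ball (0 : E d) 1)) * ‖act (fun x => b • 1 - a x) Gy x₀‖ * rt d r *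
        (rt d r * ε) := by
  obtain ⟨C, hC⟩ := h.adm.exists_isBdd
  obtain ⟨C', hC'⟩ := hC.const_sub (b • (1 : Mat d))
  obtain ⟨C'', hC''⟩ := (h.adm.perturb h.ell x₀ hr).exists_isBdd
  have hfin := isFiniteMeasure_leb h.bounded
  have hg := (h.memH10 r).sub h.state.1
  set g := fun x => Gr r x - Gy x with hgdef
  set Q := act (fun x => b • (1 : Mat d) - a x) Gy with hQdef
  have hQ : MemLp Q 2 (leb Ω) := hC'.memLp_act h.state.1.memLp_grad
  set Fr : E d → E d := fun x => field₀ e (r⁻¹ • (x - x₀)) with hFrdef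
  have hFv : MemLp Fr 2 volume := memLp_comp_rescale (measurable_field₀ e) (memLp_field₀ hd e) x₀ hr
  have hF : MemLp Fr 2 (leb Ω) := hFv.restrict _
  have hφm := TestFunction.memLp_gradient φ
  have hVm := memLp_gradient hV hVc 2 (volume : Measure (E d))
  have hφv : MemLp (gradient φ) 2 volume := by
    rw [hφ]
    exact memLp_comp_rescale (continuous_gradient hV).measurable hVm x₀ hr
  have hle : ballLeb Ω x₀ r ≤ volume := (ballLeb_le x₀ r).trans Measure.restrict_le_self
  have hdiff : nrm volume (fun x => gradient φ x - Fr x) ≤ rt d r * ε := by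
    have := nrm_comp_rescale (fun x => gradient V x - field₀ e x) x₀ hr
    rw [hφ, hFrdef]
    rw [this]
    exact mul_le_mul_of_nonneg_left hVε (rt_pos hr).le
  have hφn : nrm volume (gradient φ) = rt d r * nrm volume (gradient V) := by
    rw [hφ]
    exact nrm_comp_rescale (gradient V) x₀ hr
  let D : E d → E d := fun x => gradient φ x - Fr x
  have hD : MemLp D 2 (leb Ω) := hφm.sub hF
  let A : E d → ℝ := coeff b s x₀ r
  let ar : E d → Mat d := perturb a (b • 1) x₀ (Metric.ball 0 1) r
  -- The error of freezing the coefficient at `x₀`. It vanishes on the small ball, where both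
  -- coefficients are `b`, and outside the ball of radius `M * r`, where `gradient φ` is zero; in
  -- between it is governed by the oscillation of `a`.
  let R : E d → E d := fun x => A x • gradient φ x - act (fun x => (ar x).transpose) (gradient φ) x
  have hAφ : MemLp (fun x => A x • gradient φ x) 2 (leb Ω) := memLp_coeff_smul b s x₀ r hφm
  have hAD : MemLp (fun x => A x • D x) 2 (leb Ω) := memLp_coeff_smul b s x₀ r hD
  have haφ : MemLp (act (fun x => (ar x).transpose) (gradient φ)) 2 (leb Ω) :=
    hC''.transpose.memLp_act hφm
  have hR : MemLp R 2 (leb Ω) := hAφ.sub haφ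
  have i1 := hg.integral_corrector hd x₀ e hr b s
  -- The corrector is not an admissible test function, so it is replaced by `φ` at the cost of `D`,
  -- and the frozen coefficient by the true one at the cost of `R`.
  have i2 : ∫ x, inner ℝ (A x • Fr x) (g x) ∂(leb Ω) =
      energyForm Ω ar g (gradient φ) + ∫ x, inner ℝ (R x) (g x) ∂(leb Ω) -
        ∫ x, inner ℝ (A x • D x) (g x) ∂(leb Ω) := by
    have e1 : energyForm Ω ar g (gradient φ) =
        ∫ x, inner ℝ (act (fun x => (ar x).transpose) (gradient φ) x) (g x) ∂(leb Ω) :=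
      (energyForm_transpose ar (gradient φ) g).symm
    have j1 := integrable_inner_of_memLp haφ hg.memLp_grad
    have j2 := integrable_inner_of_memLp hR hg.memLp_grad
    have j12 : Integrable (fun x => inner ℝ (act (fun x => (ar x).transpose) (gradient φ) x) (g x) +
      inner ℝ (R x) (g x)) (leb Ω) := j1.add j2
    rw [e1, ← integral_add j1 j2,
      ← integral_sub j12 (integrable_inner_of_memLp hAD hg.memLp_grad)]
    refine integral_congr_ae (ae_of_all _ fun x => ?_)
    simp only [R, D, inner_sub_left, smul_sub]
    ring
  have i3 : energyForm Ω ar g (gradient φ) =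
      - ∫ x, inner ℝ (Q x) (gradient φ x) ∂(ballLeb Ω x₀ r) :=
    energyForm_perturb_sub h.adm h.ell hr h.state (h.pstate r hr) (TestFunction.memH10 φ)
  have i4 : ∫ x, inner ℝ (Q x) (gradient φ x) ∂(ballLeb Ω x₀ r) =
      ∫ x, inner ℝ (Q x - Q x₀) (gradient φ x) ∂(ballLeb Ω x₀ r) +
      ∫ x, inner ℝ (Q x₀) (D x) ∂(ballLeb Ω x₀ r) +
      inner ℝ (Q x₀) e * (r ^ d * volume.real (Metric.ball (0 : E d) 1)) := by
    have e1 : inner ℝ (Q x₀) e * (r ^ d * volume.real (Metric.ball (0 : E d) 1)) =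
        ∫ _, inner ℝ (Q x₀) e ∂(ballLeb Ω x₀ r) := by
      rw [integral_const, volumeReal_ballLeb hr hsub, smul_eq_mul, mul_comm]
    have m1 := integrable_inner_of_memLp
      ((hQ.mono_measure (ballLeb_le x₀ r)).sub (memLp_const (Q x₀)))
      (hφm.mono_measure (ballLeb_le x₀ r))
    have m2 := integrable_inner_of_memLp (memLp_const (μ := ballLeb Ω x₀ r) (Q x₀))
      (hD.mono_measure (ballLeb_le x₀ r))
    have m12 : Integrable (fun x => inner ℝ (Q x - Q x₀) (gradient φ x) + inner ℝ (Q x₀) (D x))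
      (ballLeb Ω x₀ r) := m1.add m2
    refine Eq.symm ?_
    rw [e1]
    refine ((congrArg (· + _) (integral_add m1 m2).symm).trans
      (integral_add m12 (integrable_const _)).symm).trans ?_
    refine setIntegral_congr_fun measurableSet_ball fun x hx => ?_
    -- The corrector's gradient is constant on the ball, so the main term is exact.
    have hx' : Fr x = e := field₀_of_mem_ball e ((rescale_mem_ball x x₀ hr).2 hx)
    simp only [D, hx', inner_sub_left, inner_sub_right]
    ring
  have b1 : |∫ x, inner ℝ (A x • D x) (g x) ∂(leb Ω)| ≤
      (|s| + |b - s|) * (rt d r * ε) * nrm (leb Ω) g := by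
    refine (abs_integral_inner_le hAD hg.memLp_grad).trans
      (mul_le_mul_of_nonneg_right ?_ (nrm_nonneg _))
    have h1 : nrm (leb Ω) (fun x => A x • D x) ≤ (|s| + |b - s|) * nrm (leb Ω) D := by
      rw [← abs_of_nonneg (show 0 ≤ |s| + |b - s| by positivity), ← nrm_smul]
      refine nrm_mono_of_ae_le (hD.const_smul (|s| + |b - s|)) (ae_of_all _ fun x => ?_)
      rw [norm_smul (|s| + |b - s|), Real.norm_of_nonneg (by positivity)]
      exact norm_coeff_smul_le b s x₀ r D x
    refine h1.trans (mul_le_mul_of_nonneg_left ?_ (by positivity))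
    exact (nrm_mono_measure Measure.restrict_le_self (hφv.sub hFv)).trans hdiff
  have b2 : |∫ x, inner ℝ (R x) (g x) ∂(leb Ω)| ≤
      L * nrm (ballLeb Ω x₀ (M * r)) (fun x => entries a x - entries a x₀) * nrm (leb Ω) g := by
    refine (abs_integral_inner_le hR hg.memLp_grad).trans
      (mul_le_mul_of_nonneg_right ?_ (nrm_nonneg _))
    refine nrm_le_of_indicator (hC.memLp_entries.sub (memLp_const _)) hL fun x => ?_
    have hnn : 0 ≤ L * (Metric.ball x₀ (M * r)).indicator
        (fun x => ‖entries a x - entries a x₀‖) x :=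
      mul_nonneg hL (Set.indicator_nonneg (fun _ _ => norm_nonneg _) _)
    by_cases hx : x ∈ Metric.ball x₀ r
    · have : R x = 0 := by
        simp only [R, A, ar, coeff, act_apply, perturb_of_mem a _ hr hx, Set.indicator_of_mem hx,
          Matrix.transpose_smul, Matrix.transpose_one, toEuclideanLin_scalar]
        rw [add_sub_cancel, sub_self]
      rwa [this, norm_zero]
    · have hRx : R x = - Matrix.toEuclideanLin (a x - a x₀).transpose (gradient φ x) := by
        simp only [R, A, ar, coeff, act_apply, perturb_of_notMem a _ hr hx,
          Set.indicator_of_notMem hx, hs, Matrix.transpose_sub, Matrix.transpose_smul,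
          Matrix.transpose_one, map_sub, LinearMap.sub_apply, toEuclideanLin_scalar]
        rw [add_zero, neg_sub]
      by_cases hxM : x ∈ Metric.ball x₀ (M * r)
      · rw [Set.indicator_of_mem hxM, hRx, norm_neg, mul_comm]
        refine (norm_transpose_sub_le a x x₀ _).trans ?_
        refine mul_le_mul_of_nonneg_left ?_ (norm_nonneg _)
        rw [hφ]
        exact hVL _
      · have : gradient φ x = 0 := by
          rw [hφ]
          refine hVM _ fun hin => hxM ?_
          rw [mem_ball_zero_iff, norm_smul, norm_inv, Real.norm_of_nonneg hr.le,
            inv_mul_lt_iff₀ hr, mul_comm] at hin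
          exact mem_ball_iff_norm.2 hin
        rw [hRx, this, map_zero, neg_zero, norm_zero]
        exact hnn
  have b3 : |∫ x, inner ℝ (Q x - Q x₀) (gradient φ x) ∂(ballLeb Ω x₀ r)| ≤
      nrm (ballLeb Ω x₀ r) (fun x => Q x - Q x₀) * (rt d r * nrm volume (gradient V)) := by
    refine (abs_integral_inner_le ((hQ.mono_measure (ballLeb_le x₀ r)).sub (memLp_const (Q x₀)))
      (hφm.mono_measure (ballLeb_le x₀ r))).trans (mul_le_mul_of_nonneg_left ?_ (nrm_nonneg _))
    rw [← hφn]
    exact nrm_mono_measure hle hφv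
  have b4 : |∫ x, inner ℝ (Q x₀) (D x) ∂(ballLeb Ω x₀ r)| ≤
      √(volume.real (Metric.ball (0 : E d) 1)) * ‖Q x₀‖ * rt d r * (rt d r * ε) := by
    refine (abs_integral_inner_le (memLp_const (μ := ballLeb Ω x₀ r) (Q x₀))
      (hD.mono_measure (ballLeb_le x₀ r))).trans ?_
    refine mul_le_mul (nrm_const_ballLeb_le (Q x₀) x₀ hr)
      ((nrm_mono_measure hle (hφv.sub hFv)).trans hdiff) (nrm_nonneg _) ?_
    have := rt_pos (d := d) hr
    positivity
  have e0 : (b + s * ((d : ℝ) - 1)) * ∫ x, inner ℝ e (g x) ∂(ballLeb Ω x₀ r) +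
      inner ℝ (Q x₀) e * (r ^ d * volume.real (Metric.ball (0 : E d) 1)) =
      ∫ x, inner ℝ (R x) (g x) ∂(leb Ω) - ∫ x, inner ℝ (A x • D x) (g x) ∂(leb Ω) -
      ∫ x, inner ℝ (Q x - Q x₀) (gradient φ x) ∂(ballLeb Ω x₀ r) -
      ∫ x, inner ℝ (Q x₀) (D x) ∂(ballLeb Ω x₀ r) := by
    rw [← i1]
    refine (congrArg (· + _) i2).trans ?_
    rw [i3, i4]
    ring
  rw [e0, abs_le]
  rw [abs_le] at b1 b2 b3 b4
  constructor <;> linarith [b1.1, b1.2, b2.1, b2.2, b3.1, b3.2, b4.1, b4.2]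

end Polarization

/-! ### Limits of the difference quotient. -/

section TopologicalDerivative

variable {Ω : TopologicalSpace.Opens (E d)} {a : E d → Mat d} {α b s : ℝ} {x₀ : E d}
  {f y : E d → ℝ} {Gy : E d → E d} {yr : ℝ → E d → ℝ} {Gr : ℝ → E d → E d}

/-- The limit of the mean polarization on the shrinking ball. -/
theorem PerturbedFamily.tendsto_integral_inner (hd : 1 ≤ d)
    (h : PerturbedFamily Ω α a (b • 1) x₀ f y Gy yr Gr) (hs : a x₀ = s • 1)
    (hleb : IsLebPoint Ω (entries a) x₀) (hκ : 0 < b + s * ((d : ℝ) - 1)) (e : E d) :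
    Tendsto (fun r : ℝ => (r ^ d)⁻¹ * ∫ x, inner ℝ e (Gr r x - Gy x) ∂(ballLeb Ω x₀ r))
      (𝓝[>] 0) (𝓝 (-(volume.real (Metric.ball (0 : E d) 1) *
        inner ℝ (act (fun x => b • 1 - a x) Gy x₀) e) / (b + s * ((d : ℝ) - 1)))) := by
  set κ := b + s * ((d : ℝ) - 1)
  set v := volume.real (Metric.ball (0 : E d) 1)
  set Q := act (fun x => b • (1 : Mat d) - a x) Gy
  let X (r : ℝ) : ℝ := (r ^ d)⁻¹ * ∫ x, inner ℝ e (Gr r x - Gy x) ∂(ballLeb Ω x₀ r)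
  suffices hX : Tendsto (fun r => κ * X r + v * inner ℝ (Q x₀) e) (𝓝[>] 0) (𝓝 0) by
    have h1 := (hX.sub_const (v * inner ℝ (Q x₀) e)).div_const κ
    rw [zero_sub] at h1
    refine h1.congr fun r => ?_
    rw [add_sub_cancel_right, mul_div_cancel_left₀ _ hκ.ne']
  obtain ⟨K, hK, hb⟩ := h.exists_grad_bound
  rw [Metric.tendsto_nhds]
  intro δ hδ
  -- The two errors proportional to `ε` sum to at most `(K₁ - 1) ε r^d`, so `ε = δ / (2 K₁)` keeps
  -- them below `δ/2`. `V`, `L` and `M` are fixed before `r`, and the other two errors then vanish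
  -- by the Lebesgue point property.
  set K₁ := (|s| + |b - s|) * K + √v * ‖Q x₀‖ + 1
  have hK₁ : 0 < K₁ := by positivity
  obtain ⟨V, hV, hVc, hVε⟩ := exists_test_approx hd e (show 0 < δ / (2 * K₁) by positivity)
  obtain ⟨L, hL⟩ := (continuous_gradient hV).bounded_above_of_compact_support
    (hasCompactSupport_gradient hVc)
  have hL0 : 0 ≤ L := (norm_nonneg _).trans (hL 0)
  obtain ⟨M, hM, hVM, hφ⟩ := exists_test_rescale hV hVc h.mem
  have hω := (((hleb.tendsto_scaled hM).const_mul L).mul_const K).add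
    (h.lebPoint.mul_const (nrm volume (gradient V)))
  simp only [mul_zero, zero_mul, add_zero] at hω
  filter_upwards [hb, hφ, eventually_ball_subset h.mem, self_mem_nhdsWithin,
    hω.eventually_lt_const (half_pos hδ)] with r h1 ⟨φ, h2⟩ h3 h4 h5
  have hr : (0 : ℝ) < r := h4
  have hρ := rt_pos (d := d) hr
  have key := h.abs_integral_inner_add_le hd hs e hr h3 hL0 hV hVc hL hVM hVε.le φ h2
  set ε := δ / (2 * K₁)
  have hε : K₁ * ε = δ / 2 := by
    simp only [ε]; field_simp
  have hε0 : 0 < ε := by positivity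
  set w₁ := nrm (ballLeb Ω x₀ (M * r)) (fun x => entries a x - entries a x₀)
  set w₂ := nrm (ballLeb Ω x₀ r) (fun x => Q x - Q x₀)
  set N := nrm (leb Ω) (fun x => Gr r x - Gy x)
  have hw₁ : 0 ≤ w₁ := nrm_nonneg _
  rw [Real.dist_eq, sub_zero]
  have e1 : κ * X r + v * inner ℝ (Q x₀) e = (rt d r ^ 2)⁻¹ *
      (κ * ∫ x, inner ℝ e (Gr r x - Gy x) ∂(ballLeb Ω x₀ r) +
        inner ℝ (Q x₀) e * (r ^ d * v)) := by
    rw [rt_sq hr]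
    simp only [X]
    field_simp
  rw [e1, abs_mul, abs_of_nonneg (by positivity), inv_mul_lt_iff₀ (by positivity)]
  refine key.trans_lt ?_
  have c1 : (|s| + |b - s|) * (rt d r * ε) * N ≤ (|s| + |b - s|) * (rt d r * ε) * (K * rt d r) := by
    gcongr
  have c2 : L * w₁ * N ≤ L * w₁ * (K * rt d r) := by gcongr
  have c3 : rt d r ^ 2 * (L * (w₁ / rt d r) * K + w₂ / rt d r * nrm volume (gradient V)) =
      L * w₁ * (K * rt d r) + w₂ * (rt d r * nrm volume (gradient V)) := by
    field_simp
  have c4 : rt d r ^ 2 * (K₁ * ε) = (|s| + |b - s|) * (rt d r * ε) * (K * rt d r) +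
      √v * ‖Q x₀‖ * rt d r * (rt d r * ε) + rt d r ^ 2 * ε := by
    simp only [K₁]; ring
  have c5 : rt d r ^ 2 * (L * (w₁ / rt d r) * K + w₂ / rt d r * nrm volume (gradient V)) <
      rt d r ^ 2 * (δ / 2) := by
    gcongr
  have c6 : 0 < rt d r ^ 2 * ε := by positivity
  rw [hε] at c4
  linarith

/-- The state chosen inside `J` is almost everywhere equal to any other solution, by uniqueness. -/
theorem J_eq {K : ℝ} (hα : 0 < α) (hK : PoincareConst Ω K) (ha : IsAdmissible Ω α a)
    (yd : E d → ℝ) (hy : IsState Ω f a y Gy) :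
    J Ω f yd a = 1 / 2 * ∫ x, (y x - yd x) ^ 2 ∂(leb Ω) := by
  have hex : ∃ y Gy, IsState Ω f a y Gy := ⟨y, Gy, hy⟩
  obtain ⟨G, hG⟩ : ∃ G, IsState Ω f a (state Ω f a) G :=
    Classical.epsilon_spec (p := fun y => ∃ Gy, IsState Ω f a y Gy) hex
  unfold J
  congr 1
  refine integral_congr_ae ?_
  filter_upwards [hG.ae_eq hα hK ha hy] with x hx
  rw [hx]

theorem integral_sq_sub {u w yd : E d → ℝ} (hu : MemLp u 2 (leb Ω)) (hw : MemLp w 2 (leb Ω))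
    (hyd : MemLp yd 2 (leb Ω)) :
    1 / 2 * ∫ x, (w x - yd x) ^ 2 ∂(leb Ω) - 1 / 2 * ∫ x, (u x - yd x) ^ 2 ∂(leb Ω) =
      ∫ x, (u x - yd x) * (w x - u x) ∂(leb Ω) +
        1 / 2 * nrm (leb Ω) (fun x => w x - u x) ^ 2 := by
  have h1 : Integrable (fun x => (u x - yd x) * (w x - u x)) (leb Ω) :=
    (hu.sub hyd).integrable_mul (hw.sub hu)
  have h2 : Integrable (fun x => ‖w x - u x‖ ^ 2) (leb Ω) :=
    integrable_norm_sq_of_memLp (hw.sub hu)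
  have h3 : Integrable (fun x => (w x - yd x) ^ 2) (leb Ω) := (hw.sub hyd).integrable_sq
  have h4 : Integrable (fun x => (u x - yd x) ^ 2) (leb Ω) := (hu.sub hyd).integrable_sq
  rw [nrm_sq, ← integral_const_mul, ← integral_const_mul, ← integral_const_mul,
    ← integral_sub (h3.const_mul _) (h4.const_mul _), ← integral_add h1 (h2.const_mul _)]
  refine integral_congr_ae (ae_of_all _ fun x => ?_)
  simp only [Real.norm_eq_abs, sq_abs]
  ring

theorem le_of_smul_one_mem (hd : 1 ≤ d) (h : s • (1 : Mat d) ∈ ellipticMatrices d α) : α ≤ s := by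
  have h1 := h (EuclideanSpace.single ⟨0, hd⟩ 1)
  rw [toEuclideanLin_scalar, real_inner_smul_left, real_inner_self_eq_norm_sq] at h1
  simpa using h1

theorem act_smul_one (hs : a x₀ = s • 1) (G : E d → E d) :
    act (fun x => b • 1 - a x) G x₀ = (b - s) • G x₀ := by
  rw [act_apply, hs, ← sub_smul, toEuclideanLin_scalar]

theorem act_transpose_smul_one (hs : a x₀ = s • 1) (G : E d → E d) :
    act (fun x => (b • 1 - a x).transpose) G x₀ = (b - s) • G x₀ := by
  rw [act_apply, hs, ← sub_smul, Matrix.transpose_smul, Matrix.transpose_one,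
    toEuclideanLin_scalar]

theorem tendsto_integral_ballLeb {m : E d → ℝ} (hm : Integrable m (leb Ω))
    (hx₀ : x₀ ∈ (Ω : Set (E d)))
    (h : Tendsto (fun r : ℝ => (r ^ d)⁻¹ * ∫ x, ‖m x - m x₀‖ ∂(ballLeb Ω x₀ r)) (𝓝[>] 0) (𝓝 0)) :
    Tendsto (fun r : ℝ => (r ^ d)⁻¹ * ∫ x, m x ∂(ballLeb Ω x₀ r)) (𝓝[>] 0)
      (𝓝 (volume.real (Metric.ball (0 : E d) 1) * m x₀)) := by
  rw [tendsto_iff_norm_sub_tendsto_zero]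
  refine tendsto_of_tendsto_of_tendsto_of_le_of_le' tendsto_const_nhds h
    (Eventually.of_forall fun _ => norm_nonneg _) ?_
  filter_upwards [eventually_ball_subset hx₀, self_mem_nhdsWithin] with r h1 hr
  have hr : (0 : ℝ) < r := hr
  have e1 : (r ^ d)⁻¹ * ∫ x, m x ∂(ballLeb Ω x₀ r) -
      volume.real (Metric.ball (0 : E d) 1) * m x₀ =
      (r ^ d)⁻¹ * ∫ x, (m x - m x₀) ∂(ballLeb Ω x₀ r) := by
    rw [integral_sub (hm.mono_measure (ballLeb_le x₀ r)) (integrable_const _), integral_const,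
      volumeReal_ballLeb hr h1, smul_eq_mul]
    field_simp
  rw [e1, norm_mul, Real.norm_of_nonneg (by positivity)]
  exact mul_le_mul_of_nonneg_left (norm_integral_le_integral_norm _) (by positivity)

/-- The matrix is transposed onto `Gp`, and the resulting field is frozen at `x₀`. The freezing
error is `o(r^{d/2})` times the `O(r^{d/2})` gradient bound; the frozen part is the mean
polarization in the direction `e = (b - s) ∇p(x₀)`. -/
theorem PerturbedFamily.tendsto_integral_act (hd : 1 ≤ d)
    (h : PerturbedFamily Ω α a (b • 1) x₀ f y Gy yr Gr) (hs : a x₀ = s • 1)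
    (hleb : IsLebPoint Ω (entries a) x₀) (hκ : 0 < b + s * ((d : ℝ) - 1)) {Gp : E d → E d}
    (hGp : MemLp Gp 2 (leb Ω))
    (hP : IsLebPoint Ω (act (fun x => (b • 1 - a x).transpose) Gp) x₀) :
    Tendsto (fun r : ℝ => (r ^ d)⁻¹ * ∫ x, inner ℝ
        (act (fun x => b • 1 - a x) (fun x => Gr r x - Gy x) x) (Gp x) ∂(ballLeb Ω x₀ r))
      (𝓝[>] 0) (𝓝 (-(volume.real (Metric.ball (0 : E d) 1) *
        inner ℝ ((b - s) • Gy x₀) ((b - s) • Gp x₀)) / (b + s * ((d : ℝ) - 1)))) := by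
  obtain ⟨C, hC⟩ := h.adm.exists_isBdd
  obtain ⟨C', hC'⟩ := hC.const_sub (b • (1 : Mat d))
  have hfin := isFiniteMeasure_leb h.bounded
  set P := act (fun x => (b • (1 : Mat d) - a x).transpose) Gp
  have hPm : MemLp P 2 (leb Ω) := hC'.transpose.memLp_act hGp
  have h1 := h.tendsto_integral_inner hd hs hleb hκ (P x₀)
  have hPx : P x₀ = (b - s) • Gp x₀ := act_transpose_smul_one hs Gp
  rw [act_smul_one hs, hPx] at h1
  rw [← hPx] at h1 ⊢
  obtain ⟨K, hK, hb⟩ := h.exists_grad_bound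
  have h2 : Tendsto (fun r : ℝ => (r ^ d)⁻¹ *
      ∫ x, inner ℝ (P x - P x₀) (Gr r x - Gy x) ∂(ballLeb Ω x₀ r)) (𝓝[>] 0) (𝓝 0) := by
    have h3 := hP.mul_const K
    rw [zero_mul] at h3
    rw [tendsto_zero_iff_abs_tendsto_zero]
    refine tendsto_of_tendsto_of_tendsto_of_le_of_le' tendsto_const_nhds h3
      (Eventually.of_forall fun _ => abs_nonneg _) ?_
    filter_upwards [hb, self_mem_nhdsWithin] with r h4 hr
    have hr : (0 : ℝ) < r := hr
    have hρ := rt_pos (d := d) hr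
    have hg := ((h.memH10 r).sub h.state.1).memLp_grad
    have hPs : MemLp (fun x => P x - P x₀) 2 (ballLeb Ω x₀ r) :=
      (hPm.mono_measure (ballLeb_le x₀ r)).sub (memLp_const (P x₀))
    have h5 := abs_integral_inner_le hPs (hg.mono_measure (ballLeb_le x₀ r))
    have h6 := (nrm_mono_measure (ballLeb_le x₀ r) hg).trans h4
    rw [Function.comp_apply, abs_mul, abs_of_nonneg (by positivity), ← rt_sq hr,
      inv_mul_le_iff₀ (by positivity)]
    refine h5.trans ((mul_le_mul_of_nonneg_left h6 (nrm_nonneg _)).trans_eq ?_)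
    field_simp
  have h7 := h2.add h1
  rw [zero_add] at h7
  refine h7.congr fun r => ?_
  have hg := ((h.memH10 r).sub h.state.1).memLp_grad.mono_measure (ballLeb_le x₀ r)
  have hPs : MemLp (fun x => P x - P x₀) 2 (ballLeb Ω x₀ r) :=
    (hPm.mono_measure (ballLeb_le x₀ r)).sub (memLp_const (P x₀))
  rw [← mul_add, ← integral_add (integrable_inner_of_memLp hPs hg)
    (integrable_inner_of_memLp (memLp_const _) hg)]
  congr 1
  refine integral_congr_ae (ae_of_all _ fun x => ?_)
  have hPX : inner ℝ (act (fun x => b • 1 - a x) (fun x => Gr r x - Gy x) x) (Gp x) =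
      inner ℝ (Gr r x - Gy x) (P x) := inner_toEuclideanLin_transpose _ _ _
  dsimp only
  rw [hPX, ← inner_add_left, sub_add_cancel, real_inner_comm]

/-- Assembles the three limits: Lebesgue differentiation, polarization, and the negligible quadratic
term. Ellipticity of `b` and `s` makes the denominator positive. -/
theorem PerturbedFamily.hasTopologicalDerivative (hd : 1 ≤ d)
    (h : PerturbedFamily Ω α a (b • 1) x₀ f y Gy yr Gr) {yd : E d → ℝ}
    (hyd : MemLp yd 2 (leb Ω)) {p : E d → ℝ} {Gp : E d → E d} (hp : IsAdjoint Ω yd a y p Gp)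
    (hs : a x₀ = s • 1) (hsα : α ≤ s)
    (hleb : IsLebPoint Ω (entries a) x₀)
    (hP : IsLebPoint Ω (act (fun x => (b • 1 - a x).transpose) Gp) x₀)
    (hm : Tendsto (fun r : ℝ => (r ^ d)⁻¹ * ∫ x, ‖inner ℝ (act (fun x => b • 1 - a x) Gy x) (Gp x) -
      inner ℝ (act (fun x => b • 1 - a x) Gy x₀) (Gp x₀)‖ ∂(ballLeb Ω x₀ r)) (𝓝[>] 0) (𝓝 0)) :
    HasTopologicalDerivative Ω f yd a (b • 1) x₀ (Metric.ball 0 1)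
      (-(inner ℝ (Gy x₀) (Gp x₀)) * (s * d / (b + s * ((d : ℝ) - 1))) * (b - s)) := by
  obtain ⟨C, hC⟩ := h.adm.exists_isBdd
  obtain ⟨C', hC'⟩ := hC.const_sub (b • (1 : Mat d))
  obtain ⟨K, hK⟩ := exists_poincareConst hd h.bounded
  have hbα := le_of_smul_one_mem hd h.ell
  have hd1 : (1 : ℝ) ≤ d := by exact_mod_cast hd
  have hκ : 0 < b + s * ((d : ℝ) - 1) := by
    have := mul_nonneg (h.pos.le.trans hsα) (sub_nonneg.2 hd1)
    linarith [h.pos]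
  set v := volume.real (Metric.ball (0 : E d) 1)
  have hv : 0 < v := ENNReal.toReal_pos
    (Metric.measure_ball_pos volume (0 : E d) one_pos).ne' measure_ball_lt_top.ne
  have hGy := h.state.1.memLp_grad
  have hGp := hp.1.memLp_grad
  have l1 := tendsto_integral_ballLeb (integrable_inner_of_memLp (hC'.memLp_act hGy) hGp) h.mem hm
  have l2 := h.tendsto_integral_act hd hs hleb hκ hGp hP
  have l3 := ((h.tendsto_nrm_sub hd).pow 2).const_mul (1 / 2)
  have l4 := (((l1.add l2).neg).add l3).div_const v
  rw [act_smul_one hs] at l4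
  have e1 : (-(v * inner ℝ ((b - s) • Gy x₀) (Gp x₀) + -(v *
      inner ℝ ((b - s) • Gy x₀) ((b - s) • Gp x₀)) / (b + s * ((d : ℝ) - 1))) + 1 / 2 * 0 ^ 2) / v =
      -(inner ℝ (Gy x₀) (Gp x₀)) * (s * d / (b + s * ((d : ℝ) - 1))) * (b - s) := by
    rw [real_inner_smul_left, real_inner_smul_left, real_inner_smul_right]
    field_simp
    ring
  rw [e1] at l4
  refine l4.congr' ?_
  filter_upwards [self_mem_nhdsWithin] with r hr
  have hr : (0 : ℝ) < r := hr
  have hst := h.pstate r hr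
  have hg := (hst.1.sub h.state.1).memLp_grad
  have i1 := integrable_inner_of_memLp ((hC'.memLp_act hGy).mono_measure (ballLeb_le x₀ r))
    (hGp.mono_measure (ballLeb_le x₀ r))
  have i2 := integrable_inner_of_memLp ((hC'.memLp_act hg).mono_measure (ballLeb_le x₀ r))
    (hGp.mono_measure (ballLeb_le x₀ r))
  have e2 : ∫ x, inner ℝ (act (fun x => b • 1 - a x) (Gr r) x) (Gp x) ∂(ballLeb Ω x₀ r) =
      ∫ x, inner ℝ (act (fun x => b • 1 - a x) Gy x) (Gp x) ∂(ballLeb Ω x₀ r) +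
      ∫ x, inner ℝ (act (fun x => b • 1 - a x) (fun x => Gr r x - Gy x) x) (Gp x)
        ∂(ballLeb Ω x₀ r) := by
    rw [← integral_add i1 i2]
    refine integral_congr_ae (ae_of_all _ fun x => ?_)
    simp only [act_sub_right]
    rw [← inner_add_left, add_sub_cancel]
  rw [J_eq h.pos hK (h.adm.perturb h.ell x₀ hr) yd hst, J_eq h.pos hK h.adm yd h.state,
    integral_sq_sub h.state.1.memLp hst.1.memLp hyd,
    integral_mul_sub_eq h.adm hr h.state hst hp.1 hp.2, e2, div_pow, rt_sq hr]
  have := hv.ne'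
  have hvd : volume.real (Metric.ball (0 : E d) 1) = v := rfl
  rw [hvd]
  field_simp

end TopologicalDerivative

end TopDeriv

end

theorem mainTheorem2 (d : ℕ) (hd : 1 ≤ d)
    (Ω : TopologicalSpace.Opens (TopDeriv.E d))
    (hΩc : IsConnected (Ω : Set (TopDeriv.E d)))
    (hΩb : Bornology.IsBounded (Ω : Set (TopDeriv.E d)))
    (α : ℝ) (hα : 0 < α)
    (f yd : TopDeriv.E d → ℝ)
    (hf : MemLp f 2 (TopDeriv.leb Ω)) (hyd : MemLp yd 2 (TopDeriv.leb Ω))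
    (a : TopDeriv.E d → TopDeriv.Mat d) (ha : TopDeriv.IsAdmissible Ω α a)
    (y : TopDeriv.E d → ℝ) (Gy : TopDeriv.E d → TopDeriv.E d)
    (hy : TopDeriv.IsState Ω f a y Gy)
    (p : TopDeriv.E d → ℝ) (Gp : TopDeriv.E d → TopDeriv.E d)
    (hp : TopDeriv.IsAdjoint Ω yd a y p Gp)
    (b : ℝ) (hb : b • (1 : TopDeriv.Mat d) ∈ TopDeriv.ellipticMatrices d α) :
    ∀ᵐ x₀ ∂(TopDeriv.leb Ω), ∀ s : ℝ, a x₀ = s • (1 : TopDeriv.Mat d) →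
      TopDeriv.HasTopologicalDerivative Ω f yd a (b • (1 : TopDeriv.Mat d)) x₀
        (Metric.ball (0 : TopDeriv.E d) 1)
        (-(inner ℝ (Gy x₀) (Gp x₀)) * (s * d / (b + s * ((d : ℝ) - 1))) * (b - s)) := by
  have hfin := TopDeriv.isFiniteMeasure_leb hΩb
  obtain ⟨C, hC⟩ := ha.exists_isBdd
  obtain ⟨C', hC'⟩ := hC.const_sub (b • (1 : TopDeriv.Mat d))
  obtain ⟨K, hK⟩ := TopDeriv.exists_poincareConst hd hΩb
  have hQ := hC'.memLp_act hy.1.memLp_grad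
  -- All exceptional null sets are independent of `s`, so `s` may be introduced after `x₀`.
  filter_upwards [ae_restrict_mem Ω.isOpen.measurableSet, ha.elliptic,
    TopDeriv.ae_isLebPoint hC.memLp_entries, TopDeriv.ae_isLebPoint hQ,
    TopDeriv.ae_isLebPoint (hC'.transpose.memLp_act hp.1.memLp_grad),
    TopDeriv.ae_tendsto_integral_norm_sub
      (TopDeriv.integrable_inner_of_memLp hQ hp.1.memLp_grad)] with x₀ hx₀ hell h1 h2 h3 h4 s hs
  have hex (r : ℝ) : ∃ y' G', TopDeriv.MemH10 Ω y' G' ∧ (0 < r →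
      TopDeriv.IsState Ω f (TopDeriv.perturb a (b • 1) x₀ (Metric.ball 0 1) r) y' G') := by
    by_cases hr : 0 < r
    · obtain ⟨y', G', h⟩ := (ha.perturb hb x₀ hr).exists_isState hα hK hf
      exact ⟨y', G', h.1, fun _ => h⟩
    -- For `r ≤ 0` the unperturbed state serves as default value.
    · exact ⟨y, Gy, hy.1, fun h => absurd h hr⟩
  choose yr Gr hmem hst using hex
  have hfam : TopDeriv.PerturbedFamily Ω α a (b • 1) x₀ f y Gy yr Gr :=
    ⟨hα, hΩb, hx₀, ha, hb, hy, hmem, hst, h2⟩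
  rw [hs] at hell
  exact hfam.hasTopologicalDerivative hd hyd hp hs (TopDeriv.le_of_smul_one_mem hd hell) h1 h3 h4
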